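/- Let $\alpha>0$. There is a constant $K=K(\alpha)>0$ such that the following holds. Let $\Sigma,\Gamma,\Phi$ be finite alphabets and let $\mu$ be a probability distribution on $\Sigma\times\Gamma\times\Phi$ in which every atom (element of the support) has probability at least $\alpha$. Assume that $\mu$ is pairwise-connected, that is, the bipartite graphs on the vertex sets $\Sigma\sqcup\Gamma$, $\Sigma\sqcup\Phi$, $\Gamma\sqcup\Phi$ whose edges are the pairs in the supports of the marginals $\mu_{x,y}$, $\mu_{x,z}$, $\mu_{y,z}$, respectively, are all connected. Then for every $\varepsilon>0$ there is $\delta\in(0,1)$, with $\delta\ge\exp(-K\varepsilon^{-K})$ whenever $\varepsilon\le 1$, such that the marginal $\mu_x$ of $\mu$ on $\Sigma$ can be written as $\mu_x=(1-\delta)\nu+\delta U$, where $U$ is the uniform distribution on $\Sigma$ and $\nu$ is a probability distribution on $\Sigma$, and such that for every $n$ and all functions $f\colon\Sigma^n\to\mathbb{C}$, $g\colon\Gamma^n\to\mathbb{C}$, $h\colon\Phi^n\to\mathbb{C}$ of absolute value at most $1$ everywhere with \[ \Big|\mathop{\mathbb{E}}_{(x,y,z)\sim\mu^{\otimes n}}[f(x)g(y)h(z)]\Big|\ge\varepsilon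 \] one has \[ \Pr_{I,\,z}\Big[\exists\,\{P_i\colon\Sigma\to\mathbb{C},\ \|P_i\|_\infty\le 1\}_{i\in\bar I}\ \text{ with }\ \Big|\mathop{\mathbb{E}}_{x\sim U^{\bar I}}\Big[f_{I\to z}(x)\prod_{i\in\bar I}P_i(x_i)\Big]\Big|\ge\delta\Big]\ge\delta. \] Here $I\subseteq[n]$ is a random set containing each $i\in[n]$ independently with probability $1-\delta$, $\bar I=[n]\setminus I$, the entries of $z\in\Sigma^I$ are, given $I$, independent with law $\nu$, and $f_{I\to z}\colon\Sigma^{\bar I}\to\mathbb{C}$ is the function obtained from $f$ by fixing the coordinates in $I$ to $z$. -/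

import Mathlib

open scoped BigOperators

noncomputable section

namespace LocalInverse

/-- Marginal of a distribution on `A × B × C` on the first coordinate. -/
def margX {A B C : Type*} [Fintype B] [Fintype C] (μ : A × B × C → ℝ) (a : A) : ℝ :=
  ∑ b, ∑ c, μ (a, b, c)

/-- Marginal on the first and second coordinates. -/
def margXY {A B C : Type*} [Fintype C] (μ : A × B × C → ℝ) (a : A) (b : B) : ℝ :=
  ∑ c, μ (a, b, c)

/-- Marginal on the first and third coordinates. -/
def margXZ {A B C : Type*} [Fintype B] (μ : A × B × C → ℝ) (a : A) (c : C) : ℝ :=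
  ∑ b, μ (a, b, c)

/-- Marginal on the second and third coordinates. -/
def margYZ {A B C : Type*} [Fintype A] (μ : A × B × C → ℝ) (b : B) (c : C) : ℝ :=
  ∑ a, μ (a, b, c)

/-- The bipartite graph on the disjoint union of `A` and `B` whose edges are the pairs
in the support of `m`. -/
def supportGraph {A B : Type*} (m : A → B → ℝ) : SimpleGraph (A ⊕ B) :=
  SimpleGraph.fromRel fun u v => ∃ a b, u = Sum.inl a ∧ v = Sum.inr b ∧ m a b ≠ 0

/-- The three bipartite graphs given by the supports of the two-coordinate marginals
are connected. -/
def PairwiseConnected {A B C : Type*} [Fintype A] [Fintype B] [Fintype C]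
    (μ : A × B × C → ℝ) : Prop :=
  (supportGraph (margXY μ)).Connected ∧
  (supportGraph (margXZ μ)).Connected ∧
  (supportGraph (margYZ μ)).Connected

/-- The expectation of `f(x) g(y) h(z)` where the triples `(x i, y i, z i)` are drawn
independently from `μ`. -/
def corr3 {A B C : Type*} [Fintype A] [Fintype B] [Fintype C] {n : ℕ}
    (μ : A × B × C → ℝ) (f : (Fin n → A) → ℂ) (g : (Fin n → B) → ℂ)
    (h : (Fin n → C) → ℂ) : ℂ :=
  ∑ w : Fin n → A × B × C, ((∏ i, μ (w i) : ℝ) : ℂ) *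
    (f (fun i => (w i).1) * g (fun i => (w i).2.1) * h (fun i => (w i).2.2))

/-- The restricted function: the coordinates in `I` are fixed to `z`. -/
def restrict {A : Type*} {n : ℕ} (f : (Fin n → A) → ℂ) (I : Finset (Fin n)) (z : I → A) :
    ({i // i ∉ I} → A) → ℂ :=
  fun x => f fun i => if hi : i ∈ I then z ⟨i, hi⟩ else x ⟨i, hi⟩

open Classical in
/-- The probability of the event `E I z`, where each `i` belongs to `I` independently with
probability `1 - δ` and, given `I`, the entries of `z` are independent with law `ν`. -/
def restrictionProb {A : Type*} [Fintype A] {n : ℕ} (δ : ℝ) (ν : A → ℝ)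
    (E : (I : Finset (Fin n)) → (I → A) → Prop) : ℝ :=
  ∑ I : Finset (Fin n), (1 - δ) ^ I.card * δ ^ (n - I.card) *
    ∑ z : I → A, if E I z then ∏ i, ν (z i) else 0

/-- The function `F` on `A ^ J` has correlation at least `δ` in absolute value, under the
uniform distribution, with a product of functions of single coordinates bounded by `1`. -/
def CorrelatesWithProduct {A J : Type*} [Fintype A] [Fintype J] [DecidableEq J]
    (F : (J → A) → ℂ) (δ : ℝ) : Prop :=
  ∃ P : J → A → ℂ, (∀ i a, ‖P i a‖ ≤ 1) ∧ δ ≤ ‖𝔼 x : J → A, F x * ∏ i, P i (x i)‖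

end LocalInverse

end

namespace LocalInverse
open Finset
open scoped BigOperators ComplexConjugate
set_option linter.unusedSectionVars false

/-! ### Expectations over finite types -/

section Expect
variable {X Y : Type*} [Fintype X] [Fintype Y]

/-! Cauchy–Schwarz reduces the correlation of three functions to a statement about `f` alone; an
increment argument then finds a product function correlated with a random restriction of `f`.

Reduction to `f`. Fix a cut `S` of the coordinates. One Cauchy–Schwarz step removes `h` by doubling
on `S`, a second removes `g` by doubling off `S`. What is left is an average of `f` over the four
corners of a box, where the coordinates of two opposite corners are joined by a two-step walk,
through `C` on `S` and through `B` off `S` (`norm_corr_pow_four_le`). Further doublings lengthen the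
walks (`norm_crossSum_pow_le_both`). By connectivity, a number of doublings depending only on `α`
makes both kernels at least some `β > 0` everywhere (`le_iterate_pairW_of_connected`). Such a kernel
contains, with mass `β`, a uniform letter independent of the other endpoint. Conditioning on
everything else is a random restriction, and the box norm of the restricted `f` across `S` is large
on average (`norm_crossSum_pow_four_le`). Averaging over `S` gives `pow_le_wsum_avgBox`.

Increment. Let `g` have mean square `1` and let `p` be its box functional averaged over all cuts, so
`0 ≤ p ≤ 1`. Restrictions do not decrease `p` on average (`avgBox_le_restrRatio`). If they do not
increase it by `κ`, the box functional is close to `p` on most cuts (`expect_abs_box_sub_le`).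
Decompose `g` by singular values across a random cut `R`, with squared singular values of sum `1`,
sum of squares `box R g` and maximum `L`. The products of top singular vectors for different cuts
are compared by a four-cycle inequality (`sq_expect_le_avgBox`). If no contraction of `g` across a
cut has normalized functional above `p` on average, this gives `L ≈ p`, so the spectrum is
essentially flat. But contracting a function of flat spectrum against a randomly phased combination
of singular vectors produces two main terms of size `p` and one diagonal correction
(`CutSVD.expect_box_phase`), which forces a gain to about `2p / (1 + p) > p`
(`CutSVD.topGain_mul_ge`). Hence restricting or contracting increases `p` (`increment`) as long as
`p` is away from `0` and `1`.

End of the increment. When `p` is within `1/1000` of `1`, `g` itself correlates with a product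
(`exists_prod_of_avgBox`). Coordinates are split off one at a time. The loss of each split is
repaired by `gap`: a best product correlation that is at least moderately large is automatically
very large, so errors do not accumulate.

Iteration. A contraction is an average of restrictions, so by convexity a product correlating with a
contraction gives one correlating with typical restrictions; `le_iterCorr` runs the increment on
this basis. The products found so far are bounded in mean square only; one more sparse restriction
makes their factors bounded by `1` (`prodSq_le_wsum`). Finally the successive restrictions are
composed into a single one (`wsum_optLaw_comp`) and compared with the law in the statement
(`wsum_bddInd_le_restrictionProb`). -/

theorem norm_sq_expect_mul_le (a b : X → ℂ) :
    ‖𝔼 x, a x * b x‖ ^ 2 ≤ (𝔼 x, ‖a x‖ ^ 2) * 𝔼 x, ‖b x‖ ^ 2 := by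
  calc ‖𝔼 x, a x * b x‖ ^ 2 ≤ (𝔼 x, ‖a x‖ * ‖b x‖) ^ 2 := by
        gcongr
        refine (RCLike.norm_expect_le (K := ℂ)).trans_eq ?_
        simp only [norm_mul]
    _ ≤ _ := expect_mul_sq_le_sq_mul_sq _ _ _

theorem norm_sq_expect_le [Nonempty X] (a : X → ℂ) : ‖𝔼 x, a x‖ ^ 2 ≤ 𝔼 x, ‖a x‖ ^ 2 := by
  simpa using norm_sq_expect_mul_le a (fun _ => 1)

theorem norm_expect_le_one [Nonempty X] {a : X → ℂ} (h : ∀ x, ‖a x‖ ≤ 1) : ‖𝔼 x, a x‖ ≤ 1 :=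
  (RCLike.norm_expect_le (K := ℂ)).trans (expect_le univ_nonempty fun x _ => h x)

theorem expect_mono {a b : X → ℝ} (h : ∀ x, a x ≤ b x) : 𝔼 x, a x ≤ 𝔼 x, b x :=
  expect_le_expect fun x _ => h x

theorem expect_nonneg' {a : X → ℝ} (h : ∀ x, 0 ≤ a x) : 0 ≤ 𝔼 x, a x :=
  expect_nonneg fun x _ => h x

theorem ofReal_expect (a : X → ℝ) : ((𝔼 x, a x : ℝ) : ℂ) = 𝔼 x, (a x : ℂ) := by
  rw [expect_univ, expect_univ]
  simp [NNRat.smul_def]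

theorem conj_expect (a : X → ℂ) : conj (𝔼 x, a x) = 𝔼 x, conj (a x) := by
  rw [expect_univ, expect_univ]
  simp [map_sum, NNRat.smul_def]

theorem expect_expect_comm {M : Type*} [AddCommMonoid M] [Module ℚ≥0 M] (F : X → Y → M) :
    𝔼 x, 𝔼 y, F x y = 𝔼 y, 𝔼 x, F x y :=
  expect_comm _ _ _

theorem expect_mul_expect_eq (a : X → ℂ) (b : Y → ℂ) :
    (𝔼 x, a x) * (𝔼 y, b y) = 𝔼 x, 𝔼 y, a x * b y :=
  Fintype.expect_mul_expect _ _

end Expect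

/-! ### Mixing two points coordinatewise -/

section Mix
variable {ι A : Type*}

/-- The point with coordinates from `z` on `R` and from `x` off `R`. -/
def mix (R : ι → Bool) (z x : ι → A) : ι → A := fun i => if R i then z i else x i

theorem mix_self (R : ι → Bool) (x : ι → A) : mix R x x = x := by
  funext i; simp [mix]

theorem mix_mix_left (R : ι → Bool) (z x y : ι → A) : mix R (mix R z x) y = mix R z y := by
  funext i; simp only [mix]; split <;> rfl

theorem mix_mix_right (R : ι → Bool) (z x y : ι → A) : mix R z (mix R x y) = mix R z y := by
  funext i; simp only [mix]; split <;> simp_all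

theorem mix_not (R : ι → Bool) (z x : ι → A) : mix (fun i => !R i) z x = mix R x z := by
  funext i; by_cases h : R i <;> simp [mix, h]

/-- Exchanging the coordinates in `R` of two points. -/
def swapEquiv (R : ι → Bool) : ((ι → A) × (ι → A)) ≃ ((ι → A) × (ι → A)) where
  toFun p := (mix R p.2 p.1, mix R p.1 p.2)
  invFun p := (mix R p.2 p.1, mix R p.1 p.2)
  left_inv p := by
    ext i <;> simp only [mix] <;> cases R i <;> simp
  right_inv p := by
    ext i <;> simp only [mix] <;> cases R i <;> simp

variable [Fintype ι] [DecidableEq ι] [Fintype A]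
variable {M : Type*} [AddCommMonoid M] [Module ℚ≥0 M]

theorem expect_mix_mix (R : ι → Bool) (F : (ι → A) → (ι → A) → M) :
    𝔼 x, 𝔼 y, F (mix R x y) (mix R y x) = 𝔼 x, 𝔼 y, F x y := by
  have h := Fintype.expect_equiv (swapEquiv (A := A) R)
    (fun p => F (mix R p.1 p.2) (mix R p.2 p.1)) (fun p => F p.2 p.1) (fun p => rfl)
  rw [← univ_product_univ, expect_product, expect_product] at h
  exact h.trans (expect_comm _ _ _)

theorem expect_mix [Nonempty A] (R : ι → Bool) (F : (ι → A) → M) :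
    𝔼 x, 𝔼 y, F (mix R x y) = 𝔼 x, F x := by
  rw [expect_mix_mix R (fun x _ => F x)]
  simp only [Fintype.expect_const]

end Mix

/-! ### The box functional of a matrix -/

section Box
variable {X Y : Type*} [Fintype X] [Fintype Y]

/-- The mean square of a function. -/
noncomputable def nsq (g : X → ℂ) : ℝ := 𝔼 x, ‖g x‖ ^ 2

/-- The fourth power of the box norm of a matrix, with respect to the uniform measures. -/
noncomputable def bx (M : X → Y → ℂ) : ℝ := 𝔼 y, 𝔼 y', ‖𝔼 x, M x y * conj (M x y')‖ ^ 2

theorem nsq_nonneg (g : X → ℂ) : 0 ≤ nsq g := expect_nonneg' fun _ => by positivity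

theorem bx_nonneg (M : X → Y → ℂ) : 0 ≤ bx M :=
  expect_nonneg' fun _ => expect_nonneg' fun _ => by positivity

theorem nsq_eq_zero {g : X → ℂ} (h : nsq g = 0) (x : X) : g x = 0 := by
  have := congrFun ((Fintype.expect_eq_zero_iff_of_nonneg
    (f := fun x => ‖g x‖ ^ 2) (fun _ => by positivity)).1 h) x
  simpa using this

/-- The expansion over pairs of rows and pairs of columns is symmetric under transposition, which
the definition through column correlations hides. -/
theorem ofReal_bx (M : X → Y → ℂ) : (bx M : ℂ) =
    𝔼 y, 𝔼 y', 𝔼 x, 𝔼 x', M x y * conj (M x y') * conj (M x' y) * M x' y' := by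
  unfold bx
  simp only [ofReal_expect, Complex.ofReal_pow]
  refine expect_congr rfl fun y _ => expect_congr rfl fun y' _ => ?_
  rw [← Complex.mul_conj', conj_expect, expect_mul_expect_eq]
  refine expect_congr rfl fun x _ => expect_congr rfl fun x' _ => ?_
  simp only [map_mul, Complex.conj_conj]; ring

theorem bx_transpose (M : X → Y → ℂ) : bx (fun y x => M x y) = bx M := by
  apply Complex.ofReal_injective
  rw [ofReal_bx, ofReal_bx]
  rw [expect_expect_comm]
  calc _ = 𝔼 x, 𝔼 x', 𝔼 y, 𝔼 y', M x y * conj (M x y') * conj (M x' y) * M x' y' := by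
        rw [expect_expect_comm]
        refine expect_congr rfl fun x _ => expect_congr rfl fun x' _ =>
          expect_congr rfl fun y _ => expect_congr rfl fun y' _ => ?_
        ring
    _ = 𝔼 x, 𝔼 y, 𝔼 x', 𝔼 y', M x y * conj (M x y') * conj (M x' y) * M x' y' := by
        refine expect_congr rfl fun x _ => ?_
        rw [expect_expect_comm]
    _ = 𝔼 y, 𝔼 x, 𝔼 x', 𝔼 y', M x y * conj (M x y') * conj (M x' y) * M x' y' := by
        rw [expect_expect_comm]
    _ = _ := by
        refine expect_congr rfl fun y _ => ?_
        calc _ = 𝔼 x, 𝔼 y', 𝔼 x', M x y * conj (M x y') * conj (M x' y) * M x' y' := by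
              refine expect_congr rfl fun x _ => ?_
              rw [expect_expect_comm]
          _ = _ := expect_expect_comm _

/-- The bilinear form behind the box functional is bounded by box functionals. -/
theorem expect_gram_mul_le {Z : Type*} [Fintype Z] (M : X → Y → ℂ) (L : Z → Y → ℂ) :
    ‖𝔼 y, 𝔼 y', (𝔼 x, M x y * conj (M x y')) * (𝔼 z, L z y * conj (L z y'))‖ ^ 2
      ≤ bx M * bx L := by
  have h := norm_sq_expect_mul_le (X := Y × Y)
    (fun p => 𝔼 x, M x p.1 * conj (M x p.2)) (fun p => 𝔼 z, L z p.1 * conj (L z p.2))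
  simp only [← univ_product_univ, expect_product] at h
  exact h

theorem bx_le_sq_nsq (M : X → Y → ℂ) : bx M ≤ (𝔼 x, 𝔼 y, ‖M x y‖ ^ 2) ^ 2 := by
  calc bx M ≤ 𝔼 y, 𝔼 y', (𝔼 x, ‖M x y‖ ^ 2) * 𝔼 x, ‖M x y'‖ ^ 2 := by
        refine expect_mono fun y => expect_mono fun y' => ?_
        simpa using norm_sq_expect_mul_le (fun x => M x y) (fun x => conj (M x y'))
    _ = (𝔼 y, 𝔼 x, ‖M x y‖ ^ 2) ^ 2 := by
        rw [sq, Fintype.expect_mul_expect]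
    _ = _ := by rw [expect_expect_comm]

/-- Correlation with a product of bounded functions of the rows and of the columns. -/
theorem norm_expect_mul_mul_le_bx [Nonempty X] [Nonempty Y] (M : X → Y → ℂ) (a : X → ℂ)
    (b : Y → ℂ) (ha : ∀ x, ‖a x‖ ≤ 1) (hb : ∀ y, ‖b y‖ ≤ 1) :
    ‖𝔼 x, 𝔼 y, M x y * a x * b y‖ ^ 4 ≤ bx M := by
  have h1 : ‖𝔼 x, 𝔼 y, M x y * a x * b y‖ ^ 2 ≤ 𝔼 x, ‖𝔼 y, M x y * b y‖ ^ 2 := by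
    calc _ ≤ 𝔼 x, ‖𝔼 y, M x y * a x * b y‖ ^ 2 := norm_sq_expect_le _
      _ ≤ _ := by
        refine expect_mono fun x => ?_
        have : 𝔼 y, M x y * a x * b y = (𝔼 y, M x y * b y) * a x := by
          rw [expect_mul]; exact expect_congr rfl fun y _ => by ring
        rw [this, norm_mul]
        have := ha x
        gcongr
        exact mul_le_of_le_one_right (norm_nonneg _) this
  have h2 : ((𝔼 x, ‖𝔼 y, M x y * b y‖ ^ 2 : ℝ) : ℂ)
      = 𝔼 y, 𝔼 y', (𝔼 x, M x y * conj (M x y')) * (b y * conj (b y')) := by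
    simp only [ofReal_expect, Complex.ofReal_pow, ← Complex.mul_conj', conj_expect,
      expect_mul_expect_eq]
    rw [expect_expect_comm]
    refine expect_congr rfl fun y _ => ?_
    rw [expect_expect_comm]
    refine expect_congr rfl fun y' _ => ?_
    rw [expect_mul]
    refine expect_congr rfl fun x _ => ?_
    simp only [map_mul]; ring
  have h3 : (𝔼 x, ‖𝔼 y, M x y * b y‖ ^ 2) ^ 2 ≤ bx M := by
    have h0 : (0:ℝ) ≤ 𝔼 x, ‖𝔼 y, M x y * b y‖ ^ 2 := expect_nonneg' fun _ => by positivity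
    have h4 : 𝔼 x, ‖𝔼 y, M x y * b y‖ ^ 2
        = ‖𝔼 y, 𝔼 y', (𝔼 x, M x y * conj (M x y')) * (b y * conj (b y'))‖ := by
      rw [← h2, Complex.norm_real, Real.norm_of_nonneg h0]
    rw [h4]
    calc _ ≤ 𝔼 y, ‖𝔼 y', (𝔼 x, M x y * conj (M x y')) * (b y * conj (b y'))‖ ^ 2 :=
          norm_sq_expect_le _
      _ ≤ 𝔼 y, 𝔼 y', ‖(𝔼 x, M x y * conj (M x y')) * (b y * conj (b y'))‖ ^ 2 :=
          expect_mono fun y => norm_sq_expect_le _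
      _ ≤ _ := by
        refine expect_mono fun y => expect_mono fun y' => ?_
        rw [norm_mul, norm_mul, RCLike.norm_conj]
        gcongr
        exact mul_le_of_le_one_right (norm_nonneg _)
          (mul_le_one₀ (hb y) (norm_nonneg _) (hb y'))
  calc ‖𝔼 x, 𝔼 y, M x y * a x * b y‖ ^ 4 = (‖𝔼 x, 𝔼 y, M x y * a x * b y‖ ^ 2) ^ 2 := by ring
    _ ≤ (𝔼 x, ‖𝔼 y, M x y * b y‖ ^ 2) ^ 2 := by gcongr
    _ ≤ _ := h3

end Box

/-! ### Cuts of a function on a product space -/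

section Cut
variable {ι A : Type*} [Fintype ι] [DecidableEq ι] [Fintype A]

/-- The box functional of `g` across the cut `S`. -/
noncomputable def box (S : ι → Bool) (g : (ι → A) → ℂ) : ℝ := bx fun x y => g (mix S x y)

/-- The average of the box functional over all cuts. -/
noncomputable def avgBox (g : (ι → A) → ℂ) : ℝ := 𝔼 S : ι → Bool, box S g

/-- The tensor square of `g`. -/
def tensorSq (g : (ι → A) → ℂ) (p : (ι → A) × (ι → A)) : ℂ := g p.1 * g p.2

theorem box_nonneg (S : ι → Bool) (g : (ι → A) → ℂ) : 0 ≤ box S g := bx_nonneg _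

theorem avgBox_nonneg (g : (ι → A) → ℂ) : 0 ≤ avgBox g := expect_nonneg' fun _ => box_nonneg _ _

theorem expect_prod_eq {X Y M : Type*} [Fintype X] [Fintype Y] [AddCommMonoid M] [Module ℚ≥0 M]
    (F : X × Y → M) : 𝔼 p, F p = 𝔼 x, 𝔼 y, F (x, y) := by
  rw [← univ_product_univ, expect_product]

variable [Nonempty A]

theorem expect_nsq_mix (S : ι → Bool) (g : (ι → A) → ℂ) :
    𝔼 x, 𝔼 y, ‖g (mix S x y)‖ ^ 2 = nsq g :=
  expect_mix S fun x => ‖g x‖ ^ 2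

theorem box_le (S : ι → Bool) (g : (ι → A) → ℂ) : box S g ≤ nsq g ^ 2 := by
  rw [← expect_nsq_mix S g]; exact bx_le_sq_nsq _

theorem avgBox_le (g : (ι → A) → ℂ) : avgBox g ≤ nsq g ^ 2 :=
  expect_le univ_nonempty fun S _ => box_le S g

theorem box_not (S : ι → Bool) (g : (ι → A) → ℂ) : box (fun i => !S i) g = box S g := by
  unfold box
  simp only [mix_not]
  exact bx_transpose _

/-- The box functional as a correlation of the tensor square with its image under a swap. -/
theorem ofReal_box (S : ι → Bool) (g : (ι → A) → ℂ) :
    (box S g : ℂ) = 𝔼 p, tensorSq g p * conj (tensorSq g (swapEquiv S p)) := by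
  rw [expect_prod_eq]
  let F : (ι → A) → (ι → A) → ℂ := fun u v =>
    tensorSq g (u, v) * conj (tensorSq g (swapEquiv S (u, v)))
  change _ = 𝔼 u, 𝔼 v, F u v
  have h1 : 𝔼 u, 𝔼 v, F u v = 𝔼 x, 𝔼 y, 𝔼 x', 𝔼 y', F (mix S x y) (mix S x' y') := by
    rw [← expect_mix S (fun u => 𝔼 v, F u v)]
    refine expect_congr rfl fun x _ => expect_congr rfl fun y _ => ?_
    exact (expect_mix S (fun v => F (mix S x y) v)).symm
  rw [h1, box, ofReal_bx]
  calc _ = 𝔼 y, 𝔼 y', 𝔼 x, 𝔼 x', F (mix S x y) (mix S x' y') := by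
        refine expect_congr rfl fun y _ => expect_congr rfl fun y' _ =>
          expect_congr rfl fun x _ => expect_congr rfl fun x' _ => ?_
        simp only [F, tensorSq, swapEquiv, Equiv.coe_fn_mk, mix_mix_left, mix_mix_right, map_mul]
        ring
    _ = 𝔼 y, 𝔼 x, 𝔼 y', 𝔼 x', F (mix S x y) (mix S x' y') :=
        expect_congr rfl fun y _ => expect_expect_comm _
    _ = 𝔼 x, 𝔼 y, 𝔼 y', 𝔼 x', F (mix S x y) (mix S x' y') := expect_expect_comm _
    _ = _ := expect_congr rfl fun x _ => expect_congr rfl fun y _ => expect_expect_comm _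

theorem expect_swapEquiv {M : Type*} [AddCommMonoid M] [Module ℚ≥0 M] (S : ι → Bool)
    (F : (ι → A) × (ι → A) → M) : 𝔼 p, F (swapEquiv S p) = 𝔼 p, F p :=
  Fintype.expect_equiv (swapEquiv S) _ _ fun _ => rfl

theorem swapEquiv_swapEquiv (S T : ι → Bool) (p : (ι → A) × (ι → A)) :
    swapEquiv S (swapEquiv T p) = swapEquiv (fun i => S i ^^ T i) p := by
  ext i <;> by_cases h : S i <;> by_cases h' : T i <;> simp [swapEquiv, mix, h, h']

theorem nsq_tensorSq (g : (ι → A) → ℂ) : nsq (tensorSq g) = nsq g ^ 2 := by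
  unfold nsq
  rw [expect_prod_eq, sq, Fintype.expect_mul_expect]
  simp only [tensorSq, norm_mul, mul_pow]

/-- The average of the tensor square over swaps inside `C`. -/
noncomputable def swapAvg (C : ι → Bool) (g : (ι → A) → ℂ) (p : (ι → A) × (ι → A)) : ℂ :=
  𝔼 S : ι → Bool, tensorSq g (swapEquiv (fun i => S i && C i) p)

/-- Exclusive or with a fixed set. -/
def xorEquiv (S : ι → Bool) : (ι → Bool) ≃ (ι → Bool) where
  toFun T i := S i ^^ T i
  invFun T i := S i ^^ T i
  left_inv T := by funext i; simp
  right_inv T := by funext i; simp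

/-- The swaps inside `C` form a group acting by isometries, and `swapAvg C` is the orthogonal
projection `P` of the tensor square `v` onto the invariants. The identity is `⟨v, P v⟩ = ‖P v‖²`,
with the left side read through `ofReal_box`. -/
theorem expect_box_and (C : ι → Bool) (g : (ι → A) → ℂ) :
    𝔼 S : ι → Bool, box (fun i => S i && C i) g = nsq (swapAvg C g) := by
  apply Complex.ofReal_injective
  unfold nsq
  simp only [ofReal_expect, Complex.ofReal_pow, ← Complex.mul_conj']
  symm
  calc 𝔼 p, swapAvg C g p * conj (swapAvg C g p)
      = 𝔼 p, 𝔼 T : ι → Bool, 𝔼 S : ι → Bool, tensorSq g (swapEquiv (fun i => T i && C i) p) *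
          conj (tensorSq g (swapEquiv (fun i => S i && C i) p)) := by
        refine expect_congr rfl fun p _ => ?_
        rw [swapAvg, conj_expect, expect_mul_expect_eq]
    _ = 𝔼 T : ι → Bool, 𝔼 S : ι → Bool, 𝔼 p, tensorSq g (swapEquiv (fun i => T i && C i) p) *
          conj (tensorSq g (swapEquiv (fun i => S i && C i) p)) := by
        rw [expect_expect_comm]
        exact expect_congr rfl fun T _ => expect_expect_comm _
    _ = 𝔼 T : ι → Bool, 𝔼 S : ι → Bool, (box (fun i => S i && C i) g : ℂ) := by
        refine expect_congr rfl fun T _ => ?_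
        refine Fintype.expect_equiv (xorEquiv T) _ _ fun S => ?_
        rw [ofReal_box, ← expect_swapEquiv (fun i => T i && C i)
          (fun p => tensorSq g p * conj (tensorSq g (swapEquiv _ p)))]
        refine expect_congr rfl fun p _ => ?_
        rw [swapEquiv_swapEquiv]
        congr 5
        funext i
        simp only [xorEquiv, Equiv.coe_fn_mk]
        cases T i <;> cases S i <;> cases C i <;> rfl
    _ = _ := by rw [Fintype.expect_const]

theorem avgBox_eq_nsq (g : (ι → A) → ℂ) : avgBox g = nsq (swapAvg (fun _ => true) g) := by
  rw [← expect_box_and]; simp [avgBox]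

/-- A uniform swap is the composition of independent uniform swaps inside and outside `C`. -/
theorem swapAvg_true (C : ι → Bool) (g : (ι → A) → ℂ) (p : (ι → A) × (ι → A)) :
    swapAvg (fun _ => true) g p
      = 𝔼 T : ι → Bool, swapAvg C g (swapEquiv (fun i => T i && !C i) p) := by
  unfold swapAvg
  simp only [Bool.and_true, swapEquiv_swapEquiv]
  rw [← expect_mix C (fun S : ι → Bool => tensorSq g (swapEquiv S p)), expect_expect_comm]
  refine expect_congr rfl fun T _ => expect_congr rfl fun S _ => ?_
  congr 3
  funext i
  simp only [mix]
  cases T i <;> cases S i <;> cases C i <;> rfl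

/-- Restricting the cuts to a subset does not decrease the average of the box functional. -/
theorem avgBox_le_expect_box_and (C : ι → Bool) (g : (ι → A) → ℂ) :
    avgBox g ≤ 𝔼 S : ι → Bool, box (fun i => S i && C i) g := by
  rw [expect_box_and C, avgBox_eq_nsq]
  unfold nsq
  calc _ = 𝔼 p, ‖𝔼 T : ι → Bool, swapAvg C g (swapEquiv (fun i => T i && !C i) p)‖ ^ 2 := by
        simp only [← swapAvg_true]
    _ ≤ 𝔼 p, 𝔼 T : ι → Bool, ‖swapAvg C g (swapEquiv (fun i => T i && !C i) p)‖ ^ 2 :=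
        expect_mono fun p => norm_sq_expect_le _
    _ = 𝔼 T : ι → Bool, 𝔼 p, ‖swapAvg C g (swapEquiv (fun i => T i && !C i) p)‖ ^ 2 :=
        expect_expect_comm _
    _ = 𝔼 _T : ι → Bool, 𝔼 p, ‖swapAvg C g p‖ ^ 2 := by
        refine expect_congr rfl fun T _ => ?_
        rw [expect_swapEquiv _ (fun p => ‖swapAvg C g p‖ ^ 2)]
    _ = _ := Fintype.expect_const _

theorem avgBox_le_expect_box_or (R : ι → Bool) (g : (ι → A) → ℂ) :
    avgBox g ≤ 𝔼 S : ι → Bool, box (fun i => S i || R i) g := by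
  refine (avgBox_le_expect_box_and (fun i => !R i) g).trans_eq ?_
  refine Fintype.expect_equiv (xorEquiv fun _ => true) _ _ fun S => ?_
  rw [← box_not]
  congr 1
  funext i
  simp [xorEquiv, Bool.not_and]

theorem nsq_sub_eq {X : Type*} [Fintype X] (a b : X → ℂ) :
    nsq (fun x => a x - b x) = nsq a + nsq b - 2 * (𝔼 x, a x * conj (b x)).re := by
  have h : ∀ x, ‖a x - b x‖ ^ 2 = ‖a x‖ ^ 2 + ‖b x‖ ^ 2 - 2 * (a x * conj (b x)).re := by
    intro x
    simp only [← Complex.normSq_eq_norm_sq, Complex.normSq_sub]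
  have h2 : (𝔼 x, a x * conj (b x)).re = 𝔼 x, (a x * conj (b x)).re := by
    rw [expect_univ, expect_univ]
    simp [NNRat.smul_def]
  unfold nsq
  simp only [h, h2, expect_sub_distrib, expect_add_distrib, mul_expect]

theorem nsq_tensorSq_sub_swap (S : ι → Bool) (g : (ι → A) → ℂ) :
    nsq (fun p => tensorSq g p - tensorSq g (swapEquiv S p)) = 2 * nsq g ^ 2 - 2 * box S g := by
  rw [nsq_sub_eq, ← ofReal_box, Complex.ofReal_re, nsq_tensorSq]
  have : nsq (fun p => tensorSq g (swapEquiv S p)) = nsq g ^ 2 := by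
    rw [← nsq_tensorSq]
    exact expect_swapEquiv S fun p => ‖tensorSq g p‖ ^ 2
  rw [this]; ring

/-- If the average over cuts is nearly maximal, so is the box functional of each cut. -/
theorem nsq_sub_box_le (S : ι → Bool) (g : (ι → A) → ℂ) :
    nsq g ^ 2 - box S g ≤ 2 * (nsq g ^ 2 - avgBox g) := by
  set U := swapAvg (fun _ => true) g with hU
  -- `U` is invariant under every swap, so `tensorSq g` and its swapped copy lie at the same
  -- distance from `U`; the triangle inequality compares them.
  have hUS : ∀ p, U (swapEquiv S p) = U p := by
    intro p
    simp only [hU, swapAvg, Bool.and_true, swapEquiv_swapEquiv]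
    refine Fintype.expect_equiv (xorEquiv S) _ _ fun T => ?_
    congr 3; funext i; simp [xorEquiv, Bool.xor_comm]
  have h1 := nsq_tensorSq_sub_swap S g
  have h2 : nsq (fun p => tensorSq g p - U p) = nsq g ^ 2 - avgBox g := by
    have h3 : 𝔼 p, tensorSq g p * conj (U p) = (avgBox g : ℂ) := by
      simp only [hU, swapAvg, Bool.and_true, conj_expect, mul_expect]
      rw [expect_expect_comm, avgBox, ofReal_expect]
      exact expect_congr rfl fun S _ => (ofReal_box S g).symm
    rw [nsq_sub_eq, h3, Complex.ofReal_re, nsq_tensorSq, ← avgBox_eq_nsq]; ring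
  have h4 : nsq (fun p => tensorSq g p - tensorSq g (swapEquiv S p))
      ≤ 2 * nsq (fun p => tensorSq g p - U p) + 2 * nsq (fun p => tensorSq g p - U p) := by
    have h5 : nsq (fun p => tensorSq g p - U p)
        = 𝔼 p, ‖tensorSq g (swapEquiv S p) - U (swapEquiv S p)‖ ^ 2 :=
      (expect_swapEquiv S fun p => ‖tensorSq g p - U p‖ ^ 2).symm
    nth_rewrite 2 [h5]
    unfold nsq
    rw [mul_expect, mul_expect, ← expect_add_distrib]
    refine expect_mono fun p => ?_
    rw [hUS]
    have h6 := norm_sub_le (tensorSq g p - U p) (tensorSq g (swapEquiv S p) - U p)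
    rw [sub_sub_sub_cancel_right] at h6
    nlinarith [sq_nonneg (‖tensorSq g p - U p‖ - ‖tensorSq g (swapEquiv S p) - U p‖),
      norm_nonneg (tensorSq g p - tensorSq g (swapEquiv S p))]
  linarith

theorem box_const_mul (S : ι → Bool) (c : ℂ) (g : (ι → A) → ℂ) :
    box S (fun x => c * g x) = ‖c‖ ^ 4 * box S g := by
  apply Complex.ofReal_injective
  rw [ofReal_box, Complex.ofReal_mul, ofReal_box, mul_expect]
  refine expect_congr rfl fun p _ => ?_
  have : ((‖c‖ ^ 4 : ℝ) : ℂ) = (c * conj c) ^ 2 := by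
    rw [Complex.mul_conj']; push_cast; ring
  simp only [tensorSq, map_mul, this]; ring

theorem nsq_const_mul {X : Type*} [Fintype X] (c : ℂ) (g : X → ℂ) :
    nsq (fun x => c * g x) = ‖c‖ ^ 2 * nsq g := by
  simp only [nsq, norm_mul, mul_pow, mul_expect]

theorem avgBox_const_mul (c : ℂ) (g : (ι → A) → ℂ) :
    avgBox (fun x => c * g x) = ‖c‖ ^ 4 * avgBox g := by
  simp only [avgBox, box_const_mul, mul_expect]

theorem norm_expect_tensor_le {X : Type*} [Fintype X] (e : X × X ≃ X × X) (a b c d : X → ℂ) :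
    ‖𝔼 p : X × X, (a p.1 * b p.2) * conj (c (e p).1 * d (e p).2)‖ ^ 2
      ≤ nsq a * nsq b * (nsq c * nsq d) := by
  refine (norm_sq_expect_mul_le _ _).trans_eq ?_
  have h : ∀ u v : X → ℂ, 𝔼 p : X × X, ‖u p.1 * v p.2‖ ^ 2 = nsq u * nsq v := by
    intro u v
    rw [expect_prod_eq]
    simp only [nsq, Fintype.expect_mul_expect, norm_mul, mul_pow]
  congr 1
  · exact h a b
  · rw [← h c d]
    simp only [RCLike.norm_conj]
    exact Fintype.expect_equiv e _ _ fun p => rfl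

/-- The box functional is Lipschitz on the unit ball. -/
theorem abs_box_sub_box_le (S : ι → Bool) (g h : (ι → A) → ℂ) (hg : nsq g ≤ 1) (hh : nsq h ≤ 1) :
    |box S g - box S h| ≤ 4 * √(nsq fun x => g x - h x) := by
  set d : (ι → A) → ℂ := fun x => g x - h x with hd
  have key : ∀ a b c e : (ι → A) → ℂ, nsq a * nsq b * (nsq c * nsq e) ≤ nsq d →
      ‖𝔼 p, (a p.1 * b p.2) * conj (c (swapEquiv S p).1 * e (swapEquiv S p).2)‖ ≤ √(nsq d) := by
    intro a b c e hab
    exact Real.le_sqrt_of_sq_le ((norm_expect_tensor_le (swapEquiv S) a b c e).trans hab)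
  have hg0 := nsq_nonneg g
  have hh0 := nsq_nonneg h
  have hd0 := nsq_nonneg d
  have b1 : nsq g * nsq g ≤ 1 := mul_le_one₀ hg hg0 hg
  have b2 : nsq h * nsq h ≤ 1 := mul_le_one₀ hh hh0 hh
  have b3 : nsq h * nsq g ≤ 1 := mul_le_one₀ hh hg0 hg
  -- The four occurrences of `g` are replaced by `h` one after another.
  have e : ((box S g - box S h : ℝ) : ℂ) =
      𝔼 p, (d p.1 * g p.2) * conj (g (swapEquiv S p).1 * g (swapEquiv S p).2)
      + 𝔼 p, (h p.1 * d p.2) * conj (g (swapEquiv S p).1 * g (swapEquiv S p).2)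
      + 𝔼 p, (h p.1 * h p.2) * conj (d (swapEquiv S p).1 * g (swapEquiv S p).2)
      + 𝔼 p, (h p.1 * h p.2) * conj (h (swapEquiv S p).1 * d (swapEquiv S p).2) := by
    rw [Complex.ofReal_sub, ofReal_box, ofReal_box]
    simp only [← expect_add_distrib, ← expect_sub_distrib]
    refine expect_congr rfl fun p _ => ?_
    simp only [tensorSq, hd, map_mul, map_sub]; ring
  have := congrArg norm e
  rw [Complex.norm_real, Real.norm_eq_abs] at this
  rw [this]
  refine (norm_add_le _ _).trans ?_
  have h1 := key d g g g (by nlinarith [mul_nonneg hd0 hg0, mul_le_one₀ b1 (by positivity) hg])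
  have h2 := key h d g g (by nlinarith [mul_nonneg hd0 hh0, mul_le_one₀ hh (by positivity) b1])
  have h3 := key h h d g (by nlinarith [mul_nonneg hd0 hh0, mul_le_one₀ b2 (by positivity) hg])
  have h4 := key h h h d (by nlinarith [mul_nonneg hd0 hh0, mul_le_one₀ b2 (by positivity) hh])
  refine (add_le_add (norm_add_le _ _) le_rfl).trans ?_
  refine (add_le_add (add_le_add (norm_add_le _ _) le_rfl) le_rfl).trans ?_
  linarith

end Cut

/-! ### Singular value decomposition -/

section SVD
variable {X Z : Type*} [Fintype X] [Fintype Z]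

theorem expect_eq_sum_div (f : Z → ℂ) : 𝔼 z, f z = (∑ z, f z) / (Fintype.card Z : ℂ) :=
  Fintype.expect_eq_sum_div_card _

theorem expect_sum_comm {J : Type*} [Fintype J] (F : Z → J → ℂ) :
    𝔼 z, ∑ j, F z j = ∑ j, 𝔼 z, F z j := by
  simp only [expect_eq_sum_div, sum_div]
  rw [sum_comm]

/-- Singular value decomposition of a matrix with respect to the uniform measures. -/
theorem exists_svd [DecidableEq Z] [Nonempty Z] (M : X → Z → ℂ) :
    ∃ (l : Z → ℝ) (G : Z → X → ℂ) (H : Z → Z → ℂ), (∀ j, 0 ≤ l j) ∧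
      (∀ j k, 𝔼 z, H j z * conj (H k z) = if j = k then 1 else 0) ∧
      (∀ j k, 𝔼 x, G j x * conj (G k x) = if j = k then (l j : ℂ) else 0) ∧
      (∀ j x, G j x = 𝔼 z, M x z * conj (H j z)) ∧
      ∀ x z, M x z = ∑ j, G j x * H j z := by
  classical
  have hN : (Fintype.card Z : ℂ) ≠ 0 := by simp
  -- `c` converts eigenvectors that are unit for the counting measure into unit vectors for the
  -- uniform measure.
  obtain ⟨c, hc⟩ : ∃ c : ℝ, (c : ℂ) * c = Fintype.card Z :=
    ⟨√(Fintype.card Z), by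
      rw [← Complex.ofReal_mul, Real.mul_self_sqrt (Nat.cast_nonneg _)]; simp⟩
  let K : Matrix Z Z ℂ := fun z z' => 𝔼 x, conj (M x z) * M x z'
  have hK : K.IsHermitian := by
    ext z z'
    simp only [K]
    change conj (𝔼 x, _) = _
    rw [conj_expect]
    refine expect_congr rfl fun x _ => ?_
    simp [mul_comm]
  let U : Matrix Z Z ℂ := hK.eigenvectorUnitary
  have hU1 : star U * U = 1 := Unitary.coe_star_mul_self hK.eigenvectorUnitary
  have hU2 : U * star U = 1 := Unitary.coe_mul_star_self hK.eigenvectorUnitary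
  have hev : ∀ j z, ∑ z', K z z' * U z' j = hK.eigenvalues j * U z j := by
    intro j z
    have := congrFun (hK.mulVec_eigenvectorBasis j) z
    simpa [Matrix.mulVec, dotProduct, U, Matrix.IsHermitian.eigenvectorUnitary_apply] using this
  have o1 : ∀ j k, ∑ z, conj (U z j) * U z k = if j = k then 1 else 0 := by
    intro j k
    have := congrFun (congrFun hU1 j) k
    simpa [Matrix.mul_apply, Matrix.one_apply] using this
  have o2 : ∀ z z', ∑ j, U z j * conj (U z' j) = if z = z' then 1 else 0 := by
    intro j k
    have := congrFun (congrFun hU2 j) k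
    simpa [Matrix.mul_apply, Matrix.one_apply] using this
  let H : Z → Z → ℂ := fun j z => c * conj (U z j)
  let G : Z → X → ℂ := fun j x => 𝔼 z, M x z * conj (H j z)
  have hG : ∀ j k, 𝔼 x, G j x * conj (G k x)
      = if j = k then (hK.eigenvalues j : ℂ) / Fintype.card Z else 0 := by
    intro j k
    have h1 : 𝔼 x, G j x * conj (G k x)
        = 𝔼 z', 𝔼 z, K z' z * (conj (H j z) * H k z') := by
      simp only [G, conj_expect, expect_mul_expect_eq]
      rw [expect_expect_comm]
      calc _ = 𝔼 z, 𝔼 z', 𝔼 x, M x z * conj (H j z) * conj (M x z' * conj (H k z')) :=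
            expect_congr rfl fun z _ => expect_expect_comm _
        _ = 𝔼 z', 𝔼 z, 𝔼 x, M x z * conj (H j z) * conj (M x z' * conj (H k z')) :=
            expect_expect_comm _
        _ = _ := by
            refine expect_congr rfl fun z' _ => expect_congr rfl fun z _ => ?_
            simp only [K, expect_mul]
            refine expect_congr rfl fun x _ => ?_
            simp only [map_mul, Complex.conj_conj]; ring
    have h2 : ∀ z', ∑ z, K z' z * (conj (H j z) * H k z')
        = Fintype.card Z * hK.eigenvalues j * (conj (U z' k) * U z' j) := by
      intro z'
      calc _ = (c * c) * conj (U z' k) * ∑ z, K z' z * U z j := by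
            rw [mul_sum]
            refine sum_congr rfl fun z _ => ?_
            simp only [H, map_mul, Complex.conj_conj, Complex.conj_ofReal]; ring
        _ = _ := by rw [hev, hc]; ring
    rw [h1]
    simp only [expect_eq_sum_div, h2]
    rw [← sum_div, ← mul_sum, o1 k j]
    by_cases hjk : j = k
    · subst hjk; simp
    · simp [hjk, Ne.symm hjk]
  refine ⟨fun j => nsq (G j), G, H, fun j => nsq_nonneg _, ?_, ?_, fun j x => rfl, ?_⟩
  · intro j k
    rw [expect_eq_sum_div]
    have : ∑ z, H j z * conj (H k z) = (c * c) * ∑ z, conj (U z j) * U z k := by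
      rw [mul_sum]
      refine sum_congr rfl fun z _ => ?_
      simp only [H, map_mul, Complex.conj_conj, Complex.conj_ofReal]; ring
    rw [this, o1, hc]
    by_cases h : j = k <;> simp [h]
  · intro j k
    by_cases h : j = k
    · subst h
      simp only [nsq, if_true, ofReal_expect, Complex.ofReal_pow, ← Complex.mul_conj']
    · rw [hG]; simp [h]
  · intro x z
    symm
    calc ∑ j, G j x * H j z = ∑ j, 𝔼 z', M x z' * (c * c * (U z' j * conj (U z j))) := by
          refine sum_congr rfl fun j _ => ?_
          simp only [G, expect_mul]
          refine expect_congr rfl fun z' _ => ?_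
          simp only [H, map_mul, Complex.conj_conj, Complex.conj_ofReal]; ring
      _ = 𝔼 z', M x z' * (c * c * ∑ j, U z' j * conj (U z j)) := by
          rw [← expect_sum_comm]
          simp only [mul_sum]
      _ = M x z := by
          simp only [o2, hc, expect_eq_sum_div]
          simp

end SVD

/-! ### Monotonicity under restriction -/

section Restriction

/-- Minkowski's inequality for averages. -/
theorem sqrt_nsq_expect_le {Z X : Type*} [Fintype Z] [Fintype X] (k : Z → X → ℂ) :
    √(nsq fun x => 𝔼 z, k z x) ≤ 𝔼 z, √(nsq (k z)) := by
  apply Real.sqrt_le_iff.2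
  refine ⟨expect_nonneg' fun _ => Real.sqrt_nonneg _, ?_⟩
  have h1 : ((nsq fun x => 𝔼 z, k z x : ℝ) : ℂ) = 𝔼 z, 𝔼 z', 𝔼 x, k z x * conj (k z' x) := by
    simp only [nsq, ofReal_expect, Complex.ofReal_pow, ← Complex.mul_conj', conj_expect,
      expect_mul_expect_eq]
    rw [expect_expect_comm]
    exact expect_congr rfl fun z _ => expect_expect_comm _
  have h2 : nsq (fun x => 𝔼 z, k z x) = ‖𝔼 z, 𝔼 z', 𝔼 x, k z x * conj (k z' x)‖ := by
    rw [← h1, Complex.norm_real, Real.norm_of_nonneg (nsq_nonneg _)]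
  rw [h2, sq, Fintype.expect_mul_expect]
  refine (RCLike.norm_expect_le (K := ℂ)).trans (expect_mono fun z => ?_)
  refine (RCLike.norm_expect_le (K := ℂ)).trans (expect_mono fun z' => ?_)
  rw [← Real.sqrt_mul (nsq_nonneg _)]
  apply Real.le_sqrt_of_sq_le
  simpa [nsq] using norm_sq_expect_mul_le (k z) (fun x => conj (k z' x))

variable {ι A : Type*} [Fintype ι] [DecidableEq ι] [Fintype A]

/-- The function `g` with the coordinates in `R` fixed to those of `z`. -/
def restr (R : ι → Bool) (z : ι → A) (g : (ι → A) → ℂ) : (ι → A) → ℂ := fun x => g (mix R z x)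

theorem bx_eq_nsq {X Y : Type*} [Fintype X] [Fintype Y] (M : X → Y → ℂ) :
    bx M = nsq fun p : Y × Y => 𝔼 x, M x p.1 * conj (M x p.2) := by
  rw [nsq, expect_prod_eq]; rfl

variable [Nonempty A]

/-- The square root of the box functional is the `L²` norm of the kernel of column correlations.
Fixing only row coordinates writes this kernel as the average of the kernels of the restrictions, so
Minkowski's inequality applies. -/
theorem sqrt_box_le_of_and (S R : ι → Bool) (g : (ι → A) → ℂ) :
    √(box S g) ≤ 𝔼 z, √(box S (restr (fun i => R i && S i) z g)) := by
  have h : ∀ y y' : ι → A, 𝔼 x, g (mix S x y) * conj (g (mix S x y'))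
      = 𝔼 z, 𝔼 x, restr (fun i => R i && S i) z g (mix S x y) *
          conj (restr (fun i => R i && S i) z g (mix S x y')) := by
    intro y y'
    rw [← expect_mix R (fun x => g (mix S x y) * conj (g (mix S x y')))]
    refine expect_congr rfl fun z _ => expect_congr rfl fun x _ => ?_
    have : ∀ y, mix (fun i => R i && S i) z (mix S x y) = mix S (mix R z x) y := by
      intro y; funext i
      by_cases h1 : R i <;> by_cases h2 : S i <;> simp [mix, h1, h2]
    simp only [restr, this]
  unfold box
  simp only [bx_eq_nsq, h]
  exact sqrt_nsq_expect_le _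

/-- The coordinates of `R` on the row side are fixed first, then those on the column side, by
passing to the complementary cut. -/
theorem sqrt_box_le (S R : ι → Bool) (g : (ι → A) → ℂ) :
    √(box S g) ≤ 𝔼 z, √(box S (restr R z g)) := by
  have h2 : ∀ h : (ι → A) → ℂ, √(box S h) ≤ 𝔼 z, √(box S (restr (fun i => R i && !S i) z h)) := by
    intro h
    simpa only [box_not] using sqrt_box_le_of_and (fun i => !S i) R h
  refine (sqrt_box_le_of_and S R g).trans ?_
  refine (expect_mono fun z => h2 _).trans_eq ?_
  rw [← expect_mix S (fun z => √(box S (restr R z g)))]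
  refine expect_congr rfl fun z _ => expect_congr rfl fun z' _ => ?_
  congr 2
  funext x
  simp only [restr]
  congr 1
  funext i
  by_cases h1 : R i <;> by_cases h2 : S i <;> simp [mix, h1, h2]

theorem expect_nsq_restr (R : ι → Bool) (g : (ι → A) → ℂ) :
    𝔼 z, nsq (restr R z g) = nsq g := expect_nsq_mix R g

/-- Cauchy–Schwarz applied to `sqrt_box_le`, weighting each restriction by its mean square. The
value `0` of a division by zero is harmless: a restriction of mean square zero has box functional
zero. -/
theorem box_le_expect_restr (S R : ι → Bool) (g : (ι → A) → ℂ) :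
    box S g ≤ (𝔼 z, box S (restr R z g) / nsq (restr R z g)) * nsq g := by
  have h1 : (√(box S g)) ^ 2 ≤ (𝔼 z, √(box S (restr R z g))) ^ 2 := by
    gcongr; exact sqrt_box_le S R g
  rw [Real.sq_sqrt (box_nonneg _ _)] at h1
  refine h1.trans ?_
  have h2 : ∀ z, √(box S (restr R z g))
      = √(box S (restr R z g) / nsq (restr R z g)) * √(nsq (restr R z g)) := by
    intro z
    rw [← Real.sqrt_mul (div_nonneg (box_nonneg _ _) (nsq_nonneg _))]
    congr 1
    rcases eq_or_ne (nsq (restr R z g)) 0 with h | h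
    · have := box_le S (restr R z g)
      rw [h] at this ⊢
      simp only [mul_zero]
      exact le_antisymm (by simpa using this) (box_nonneg _ _)
    · rw [div_mul_cancel₀ _ h]
  simp only [h2]
  refine (expect_mul_sq_le_sq_mul_sq _ _ _).trans_eq ?_
  rw [← expect_nsq_restr R g]
  congr 1
  · exact expect_congr rfl fun z _ =>
      Real.sq_sqrt (div_nonneg (box_nonneg _ _) (nsq_nonneg _))
  · exact expect_congr rfl fun z _ => Real.sq_sqrt (nsq_nonneg _)

/-- The average over restrictions of the ratio of `avgBox` to `nsq`. -/
noncomputable def restrRatio (g : (ι → A) → ℂ) : ℝ :=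
  𝔼 R : ι → Bool, 𝔼 z, avgBox (restr R z g) / nsq (restr R z g)

theorem restrRatio_eq (g : (ι → A) → ℂ) :
    restrRatio g = 𝔼 R : ι → Bool, 𝔼 S : ι → Bool, 𝔼 z,
      box S (restr R z g) / nsq (restr R z g) := by
  unfold restrRatio avgBox
  refine expect_congr rfl fun R _ => ?_
  rw [expect_expect_comm]
  exact expect_congr rfl fun z _ => expect_div _ _ _

theorem avgBox_le_restrRatio (g : (ι → A) → ℂ) : avgBox g ≤ restrRatio g * nsq g := by
  rw [restrRatio_eq, expect_mul]
  calc avgBox g = 𝔼 _R : ι → Bool, avgBox g := (Fintype.expect_const _).symm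
    _ ≤ _ := by
      refine expect_mono fun R => ?_
      rw [expect_mul]
      exact expect_mono fun S => box_le_expect_restr S R g

/-- The box functional concentrates if restrictions do not increase the average. -/
theorem expect_abs_box_sub_le (g : (ι → A) → ℂ) (hg : nsq g = 1) {κ : ℝ}
    (h : restrRatio g ≤ avgBox g + κ) :
    𝔼 S : ι → Bool, |box S g - avgBox g| ≤ 4 * κ := by
  set F : (ι → Bool) → ℝ := fun S => box S g with hF
  set Q : (ι → Bool) → (ι → Bool) → ℝ := fun R S => 𝔼 z,
      box S (restr R z g) / nsq (restr R z g) with hQ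
  have hQF : ∀ R S, F S ≤ Q R S := by
    intro R S
    simpa [hg] using box_le_expect_restr S R g
  -- Once the coordinates in `R` are fixed, only the part of the cut off `R` matters.
  have hQmix : ∀ R S T, Q R (mix R T S) = Q R S := by
    intro R S T
    refine expect_congr rfl fun z _ => ?_
    congr 1
    unfold box
    congr 1
    funext x y
    simp only [restr]
    congr 1
    funext i
    by_cases h1 : R i <;> by_cases h2 : S i <;> simp [mix, h1, h2]
  have hsum : 𝔼 R : ι → Bool, 𝔼 S : ι → Bool, (Q R S - F S) ≤ κ := by
    have : 𝔼 R : ι → Bool, 𝔼 S : ι → Bool, (Q R S - F S) = restrRatio g - avgBox g := by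
      simp only [expect_sub_distrib, Fintype.expect_const, restrRatio_eq, hQ, hF]
      rfl
    linarith
  -- Both values lie below the common bound `Q R S`, and the average gap to it is at most `κ`.
  have hd : 𝔼 R : ι → Bool, 𝔼 S, 𝔼 T, |F S - F (mix R T S)| ≤ 2 * κ := by
    calc _ ≤ 𝔼 R : ι → Bool, 𝔼 S : ι → Bool, 𝔼 T : ι → Bool,
          ((Q R S - F S) + (Q R (mix R T S) - F (mix R T S))) := by
          refine expect_mono fun R => expect_mono fun S => expect_mono fun T => ?_
          have h1 := hQF R S
          have h2 := hQF R (mix R T S)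
          rw [hQmix] at h2 ⊢
          rw [abs_le]; constructor <;> linarith
      _ = 𝔼 R : ι → Bool, 𝔼 S : ι → Bool, (Q R S - F S)
          + 𝔼 R : ι → Bool, 𝔼 S : ι → Bool, (Q R S - F S) := by
          simp only [expect_add_distrib, Fintype.expect_const]
          congr 1
          refine expect_congr rfl fun R _ => ?_
          rw [expect_expect_comm, expect_mix R (fun S => Q R S - F S)]
      _ ≤ _ := by linarith
  -- The same estimate for the complement of `R` completes the path from `S` to `T` through their
  -- mixture.
  have hd' : 𝔼 R : ι → Bool, 𝔼 S, 𝔼 T, |F (mix R T S) - F T| ≤ 2 * κ := by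
    refine le_trans (le_of_eq ?_) hd
    refine Fintype.expect_equiv (xorEquiv fun _ => true) _ _ fun R => ?_
    rw [expect_expect_comm]
    refine expect_congr rfl fun T _ => expect_congr rfl fun S _ => ?_
    rw [abs_sub_comm]
    congr 3
    funext i
    by_cases h1 : R i <;> simp [mix, xorEquiv, h1]
  calc 𝔼 S : ι → Bool, |box S g - avgBox g| ≤ 𝔼 S, 𝔼 T, |F S - F T| := by
        refine expect_mono fun S => ?_
        have : box S g - avgBox g = 𝔼 T, (F S - F T) := by
          rw [expect_sub_distrib, Fintype.expect_const]; rfl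
        rw [this]
        exact abs_expect_le _ _
    _ = 𝔼 _R : ι → Bool, 𝔼 S, 𝔼 T, |F S - F T| := (Fintype.expect_const _).symm
    _ ≤ 𝔼 R : ι → Bool, 𝔼 S, 𝔼 T, (|F S - F (mix R T S)| + |F (mix R T S) - F T|) := by
        refine expect_mono fun R => expect_mono fun S => expect_mono fun T => ?_
        exact abs_sub_le _ _ _
    _ ≤ 4 * κ := by
        simp only [expect_add_distrib]
        linarith

end Restriction

/-! ### Products along two cuts -/

section FourCycle

/-- Expanding the inner square pairs the row Gram matrices of `a` and of `c`, to which
`expect_gram_mul_le` applies. -/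
theorem sq_expect_norm_sq_le_bx {X Y Z : Type*} [Fintype X] [Fintype Y] [Fintype Z]
    (a : X → Y → ℂ) (c : X → Z → ℂ) :
    (𝔼 y, 𝔼 z, ‖𝔼 x, a x y * c x z‖ ^ 2) ^ 2 ≤ bx a * bx c := by
  have h1 : ((𝔼 y, 𝔼 z, ‖𝔼 x, a x y * c x z‖ ^ 2 : ℝ) : ℂ) =
      𝔼 x, 𝔼 x', (𝔼 y, a x y * conj (a x' y)) * (𝔼 z, c x z * conj (c x' z)) := by
    simp only [ofReal_expect, Complex.ofReal_pow, ← Complex.mul_conj', conj_expect,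
      expect_mul_expect_eq]
    calc _ = 𝔼 y, 𝔼 x, 𝔼 z, 𝔼 x', a x y * c x z * conj (a x' y * c x' z) :=
          expect_congr rfl fun y _ => expect_expect_comm _
      _ = 𝔼 x, 𝔼 y, 𝔼 x', 𝔼 z, a x y * c x z * conj (a x' y * c x' z) := by
          rw [expect_expect_comm]
          exact expect_congr rfl fun x _ => expect_congr rfl fun y _ => expect_expect_comm _
      _ = _ := by
          refine expect_congr rfl fun x _ => ?_
          rw [expect_expect_comm]
          refine expect_congr rfl fun x' _ => expect_congr rfl fun y _ =>
            expect_congr rfl fun z _ => ?_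
          simp only [map_mul]; ring
  have h0 : (0 : ℝ) ≤ 𝔼 y, 𝔼 z, ‖𝔼 x, a x y * c x z‖ ^ 2 :=
    expect_nonneg' fun _ => expect_nonneg' fun _ => by positivity
  have h2 := congrArg norm h1
  rw [Complex.norm_real, Real.norm_of_nonneg h0] at h2
  rw [h2]
  have := expect_gram_mul_le (fun y x => a x y) (fun z x => c x z)
  rwa [bx_transpose a, bx_transpose c] at this

/-- With the opposite vertices `x₂` and `x₃` of the four-cycle fixed, the integrand splits into the
two paths through `x₁` and `x₄`; Cauchy–Schwarz in `(x₂, x₃)` separates them. -/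
theorem norm_expect_cycle_le {X₁ X₂ X₃ X₄ : Type*} [Fintype X₁] [Fintype X₂] [Fintype X₃]
    [Fintype X₄] (a : X₁ → X₂ → ℂ) (b : X₃ → X₄ → ℂ) (c : X₁ → X₃ → ℂ) (d : X₂ → X₄ → ℂ) :
    ‖𝔼 x₁, 𝔼 x₂, 𝔼 x₃, 𝔼 x₄, a x₁ x₂ * b x₃ x₄ * c x₁ x₃ * d x₂ x₄‖ ^ 4
      ≤ bx a * bx b * bx c * bx d := by
  have h1 : 𝔼 x₁, 𝔼 x₂, 𝔼 x₃, 𝔼 x₄, a x₁ x₂ * b x₃ x₄ * c x₁ x₃ * d x₂ x₄ =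
      𝔼 p : X₂ × X₃, (𝔼 x₁, a x₁ p.1 * c x₁ p.2) * (𝔼 x₄, d p.1 x₄ * b p.2 x₄) := by
    rw [expect_prod_eq, expect_expect_comm]
    refine expect_congr rfl fun x₂ _ => ?_
    rw [expect_expect_comm]
    refine expect_congr rfl fun x₃ _ => ?_
    rw [expect_mul_expect_eq]
    refine expect_congr rfl fun x₁ _ => expect_congr rfl fun x₄ _ => ?_
    ring
  have h2 := norm_sq_expect_mul_le (X := X₂ × X₃) (fun p => 𝔼 x₁, a x₁ p.1 * c x₁ p.2)
    (fun p => 𝔼 x₄, d p.1 x₄ * b p.2 x₄)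
  rw [← h1, expect_prod_eq, expect_prod_eq] at h2
  have h3 := sq_expect_norm_sq_le_bx a c
  have h4 := sq_expect_norm_sq_le_bx (fun x₄ x₂ => d x₂ x₄) (fun x₄ x₃ => b x₃ x₄)
  rw [bx_transpose d, bx_transpose b] at h4
  calc _ = (‖𝔼 x₁, 𝔼 x₂, 𝔼 x₃, 𝔼 x₄, a x₁ x₂ * b x₃ x₄ * c x₁ x₃ * d x₂ x₄‖ ^ 2) ^ 2 := by ring
    _ ≤ _ := by
      refine (pow_le_pow_left₀ (by positivity) h2 2).trans ?_
      rw [mul_pow]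
      refine (mul_le_mul h3 h4 (by positivity)
        (mul_nonneg (bx_nonneg _) (bx_nonneg _))).trans_eq ?_
      ring

variable {ι A : Type*} [Fintype ι] [DecidableEq ι] [Fintype A]

/-- `a` depends only on the coordinates in `S`. -/
def DepOn (S : ι → Bool) (a : (ι → A) → ℂ) : Prop := ∀ x y, a (mix S x y) = a x

theorem DepOn.eq {S : ι → Bool} {a : (ι → A) → ℂ} (ha : DepOn S a) {x y : ι → A}
    (h : ∀ i, S i → x i = y i) : a x = a y := by
  rw [← ha x y]
  congr 1
  funext i
  by_cases hi : S i <;> simp [mix, hi, h]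

variable [Nonempty A]

/-- Two cuts divide the coordinates into four cells, carried by `x₁, x₂, x₃, x₄`. Each of the four
functions sees two of them, and the resulting incidence is a four-cycle. -/
theorem norm_expect_cuts_le (S T : ι → Bool) {a b c d : (ι → A) → ℂ} (ha : DepOn S a)
    (hb : DepOn (fun i => !S i) b) (hc : DepOn T c) (hd : DepOn (fun i => !T i) d) :
    ‖𝔼 x, a x * b x * c x * d x‖ ^ 4 ≤ box T a * box T b * box S c * box S d := by
  have h : 𝔼 x, a x * b x * c x * d x = 𝔼 x₁, 𝔼 x₂, 𝔼 x₃, 𝔼 x₄,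
      a (mix T x₁ x₂) * b (mix T x₃ x₄) * c (mix S x₁ x₃) * d (mix S x₂ x₄) := by
    rw [← expect_mix S (fun x => a x * b x * c x * d x), ← expect_mix T]
    refine expect_congr rfl fun x₁ _ => expect_congr rfl fun x₂ _ => ?_
    rw [← expect_mix T]
    refine expect_congr rfl fun x₃ _ => expect_congr rfl fun x₄ _ => ?_
    rw [ha, hb.eq (y := mix T x₃ x₄), hc.eq (y := mix S x₁ x₃), hd.eq (y := mix S x₂ x₄)]
    · intro i hi; by_cases hS : S i <;> by_cases hT : T i <;> simp_all [mix]
    · intro i hi; by_cases hS : S i <;> by_cases hT : T i <;> simp_all [mix]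
    · intro i hi; by_cases hS : S i <;> by_cases hT : T i <;> simp_all [mix]
  rw [h]
  exact norm_expect_cycle_le (fun x₁ x₂ => a (mix T x₁ x₂)) (fun x₃ x₄ => b (mix T x₃ x₄))
    (fun x₁ x₃ => c (mix S x₁ x₃)) (fun x₂ x₄ => d (mix S x₂ x₄))

end FourCycle

/-! ### Random phases -/

section Phase
variable {J : Type*} [Fintype J] [DecidableEq J]

/-- The fourth root of unity with index `t`. -/
noncomputable def ph (t : ZMod 4) : ℂ := Complex.I ^ t.val

theorem ph_add_one (t : ZMod 4) : ph (t + 1) = Complex.I * ph t := by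
  have h : ∀ t : ZMod 4, (t + 1).val = t.val + 1 ∨ ((t + 1).val = 0 ∧ t.val = 3) := by decide
  unfold ph
  rcases h t with h | ⟨h1, h2⟩
  · rw [h, pow_succ, mul_comm]
  · rw [h1, h2, pow_zero, ← pow_succ', Complex.I_pow_four]

theorem norm_ph (t : ZMod 4) : ‖ph t‖ = 1 := by simp [ph]

theorem ph_mul_conj (t : ZMod 4) : ph t * conj (ph t) = 1 := by
  rw [Complex.mul_conj']; simp [norm_ph]

/-- Turning the single phase at `a` by a quarter preserves the average, so a monomial for which the
scalar on the right is not `1` averages to zero. -/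
theorem expect_ph_shift (a j k l m : J) :
    𝔼 θ : J → ZMod 4, ph (θ j) * ph (θ k) * conj (ph (θ l)) * conj (ph (θ m)) =
      ((if j = a then Complex.I else 1) * (if k = a then Complex.I else 1) *
        (if l = a then -Complex.I else 1) * (if m = a then -Complex.I else 1)) *
      𝔼 θ : J → ZMod 4, ph (θ j) * ph (θ k) * conj (ph (θ l)) * conj (ph (θ m)) := by
  rw [mul_expect]
  let s : J → ZMod 4 := Pi.single a 1
  have e := Fintype.expect_equiv (Equiv.addRight s)
    (fun θ : J → ZMod 4 => ph ((θ + s) j) * ph ((θ + s) k) * conj (ph ((θ + s) l)) *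
      conj (ph ((θ + s) m)))
    (fun θ : J → ZMod 4 => ph (θ j) * ph (θ k) * conj (ph (θ l)) * conj (ph (θ m)))
    (fun θ => by simp only [Equiv.coe_addRight])
  rw [← e]
  refine expect_congr rfl fun θ _ => ?_
  have h : ∀ i, ph ((θ + s) i) = (if i = a then Complex.I else 1) * ph (θ i) := by
    intro i
    by_cases hi : i = a
    · subst hi; simp [s, ph_add_one]
    · simp [s, hi]
  have h' : ∀ i, conj (ph ((θ + s) i))
      = (if i = a then -Complex.I else 1) * conj (ph (θ i)) := by
    intro i
    rw [h]
    by_cases hi : i = a <;> simp [hi]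
  rw [h, h, h', h']
  ring

theorem expect_ph (j k l m : J) :
    𝔼 θ : J → ZMod 4, ph (θ j) * ph (θ k) * conj (ph (θ l)) * conj (ph (θ m)) =
      (if j = l ∧ k = m then 1 else 0) + (if j = m ∧ k = l then 1 else 0)
        - (if j = k ∧ j = l ∧ j = m then 1 else 0) := by
  have zero_of : ∀ {E w : ℂ}, E = w * E → w ≠ 1 → E = 0 := by
    intro E w h hw
    have : (w - 1) * E = 0 := by linear_combination -h
    exact (mul_eq_zero.1 this).resolve_left (sub_ne_zero.2 hw)
  have hI : Complex.I ≠ 1 := fun h => by simpa using congrArg Complex.im h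
  have hI2 : Complex.I * Complex.I ≠ 1 := by
    rw [Complex.I_mul_I]; norm_num
  have unit2 : ∀ s t : ZMod 4, ph s * ph t * conj (ph s) * conj (ph t) = 1 := by
    intro s t
    calc _ = (ph s * conj (ph s)) * (ph t * conj (ph t)) := by ring
      _ = 1 := by rw [ph_mul_conj, ph_mul_conj, one_mul]
  have unit3 : ∀ s t : ZMod 4, ph s * ph t * conj (ph t) * conj (ph s) = 1 := by
    intro s t
    calc _ = (ph s * conj (ph s)) * (ph t * conj (ph t)) := by ring
      _ = 1 := by rw [ph_mul_conj, ph_mul_conj, one_mul]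
  by_cases hjl : j = l
  · by_cases hkm : k = m
    · subst hjl; subst hkm
      simp only [unit2, Fintype.expect_const]
      by_cases h : j = k <;> simp [h, eq_comm]
    · have := expect_ph_shift k j k l m
      rw [zero_of this]
      · subst hjl
        by_cases h : j = m
        · subst h; simp [hkm, Ne.symm hkm]
        · simp [hkm, h]
      · subst hjl
        by_cases h : j = k
        · subst h; simp [Ne.symm hkm, hI]
        · simp [h, Ne.symm hkm, hI]
  · by_cases hjm : j = m
    · by_cases hkl : k = l
      · subst hjm; subst hkl
        simp only [unit3, Fintype.expect_const]
        simp [hjl]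
      · have := expect_ph_shift k j k l m
        rw [zero_of this]
        · simp [hjl, hkl]
        · subst hjm
          by_cases h : j = k
          · subst h; simp [Ne.symm hkl, hI]
          · simp [h, Ne.symm hkl, hI]
    · have := expect_ph_shift j j k l m
      rw [zero_of this]
      · simp [hjl, hjm]
      -- If `j = k` the scalar is `I² = -1`. Random signs would give `1` here, hence the use of
      -- fourth roots of unity.
      · by_cases h : k = j
        · subst h; simp [Ne.symm hjl, Ne.symm hjm]; norm_num
        · simp [h, Ne.symm hjl, Ne.symm hjm, hI]

/-- Only the two pairings of indices survive the random phases; the subtracted sum is the diagonal,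
which both pairings count. -/
theorem expect_ph_sum (a b c d : J → ℂ) :
    𝔼 θ : J → ZMod 4, (∑ j, ph (θ j) * a j) * (∑ j, ph (θ j) * b j) *
        conj ((∑ j, ph (θ j) * c j) * ∑ j, ph (θ j) * d j) =
      (∑ j, a j * conj (c j)) * (∑ j, b j * conj (d j))
      + (∑ j, a j * conj (d j)) * (∑ j, b j * conj (c j))
      - ∑ j, a j * b j * conj (c j * d j) := by
  have h1 : ∀ θ : J → ZMod 4, (∑ j, ph (θ j) * a j) * (∑ j, ph (θ j) * b j) *
        conj ((∑ j, ph (θ j) * c j) * ∑ j, ph (θ j) * d j) =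
      ∑ j, ∑ k, ∑ l, ∑ m, (a j * b k * conj (c l) * conj (d m)) *
        (ph (θ j) * ph (θ k) * conj (ph (θ l)) * conj (ph (θ m))) := by
    intro θ
    rw [map_mul, map_sum, map_sum, sum_mul_sum, sum_mul_sum, sum_mul]
    refine sum_congr rfl fun j _ => ?_
    rw [sum_mul]
    refine sum_congr rfl fun k _ => ?_
    rw [mul_sum]
    refine sum_congr rfl fun l _ => ?_
    rw [mul_sum]
    refine sum_congr rfl fun m _ => ?_
    simp only [map_mul]; ring
  simp only [h1, expect_sum_comm, ← mul_expect, expect_ph, mul_sub, mul_add, sum_sub_distrib,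
    sum_add_distrib, ite_and, mul_ite, mul_one, mul_zero]
  congr 1
  · congr 1
    · rw [sum_mul_sum]
      refine sum_congr rfl fun j _ => sum_congr rfl fun k _ => ?_
      simp
      ring
    · rw [sum_mul_sum]
      refine sum_congr rfl fun j _ => sum_congr rfl fun k _ => ?_
      simp
      ring
  · refine sum_congr rfl fun j _ => ?_
    simp
    ring

end Phase

/-! ### Decomposition of a function across a cut -/

section CutSVD
variable {ι A : Type*} [Fintype ι] [DecidableEq ι] [Fintype A] [DecidableEq A]

/-- Integrating the coordinates in `R` of `g` against `H`. -/
noncomputable def contract (R : ι → Bool) (H g : (ι → A) → ℂ) : (ι → A) → ℂ :=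
  fun x => 𝔼 z, H z * g (mix R z x)

/-- A singular value decomposition of `g` across the cut `R`. -/
structure CutSVD (R : ι → Bool) (g : (ι → A) → ℂ) where
  l : (ι → A) → ℝ
  G : (ι → A) → (ι → A) → ℂ
  H : (ι → A) → (ι → A) → ℂ
  l_nonneg : ∀ j, 0 ≤ l j
  orthoH : ∀ j k, 𝔼 z, H j z * conj (H k z) = if j = k then 1 else 0
  orthoG : ∀ j k, 𝔼 x, G j x * conj (G k x) = if j = k then (l j : ℂ) else 0
  G_eq : ∀ j x, G j x = 𝔼 z, g (mix R z x) * conj (H j z)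
  eq_sum : ∀ x z, g (mix R z x) = ∑ j, G j x * H j z

theorem nsq_sum_of_ortho {X J : Type*} [Fintype X] [Fintype J] [DecidableEq J] {G : J → X → ℂ}
    {l : J → ℝ} (h : ∀ j k, 𝔼 x, G j x * conj (G k x) = if j = k then (l j : ℂ) else 0)
    (a : J → ℂ) : nsq (fun x => ∑ j, a j * G j x) = ∑ j, ‖a j‖ ^ 2 * l j := by
  apply Complex.ofReal_injective
  simp only [nsq, ofReal_expect, Complex.ofReal_pow, ← Complex.mul_conj', map_sum, sum_mul_sum,
    Complex.ofReal_sum, Complex.ofReal_mul, map_mul, expect_sum_comm]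
  refine sum_congr rfl fun j _ => ?_
  calc _ = ∑ k, a j * conj (a k) * 𝔼 x, G j x * conj (G k x) := by
        refine sum_congr rfl fun k _ => ?_
        rw [mul_expect]
        refine expect_congr rfl fun x _ => ?_
        ring
    _ = _ := by simp [h]

theorem nsq_conj {X : Type*} [Fintype X] (g : X → ℂ) : nsq (fun x => conj (g x)) = nsq g := by
  simp [nsq]

theorem expect_mul_sum_eq {X J : Type*} [Fintype X] [Fintype J] [DecidableEq J] {H : J → X → ℂ}
    (h : ∀ j k, 𝔼 x, H j x * conj (H k x) = if j = k then (1 : ℂ) else 0) (a b : J → ℂ) :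
    𝔼 x, (∑ j, a j * H j x) * conj (∑ j, b j * H j x) = ∑ j, a j * conj (b j) := by
  simp only [map_sum, sum_mul_sum, map_mul, expect_sum_comm]
  refine sum_congr rfl fun j _ => ?_
  calc _ = ∑ k, a j * conj (b k) * 𝔼 x, H j x * conj (H k x) := by
        refine sum_congr rfl fun k _ => ?_
        rw [mul_expect]
        refine expect_congr rfl fun x _ => ?_
        ring
    _ = _ := by simp [h]

variable [Nonempty A]

theorem nonempty_cutSVD (R : ι → Bool) (g : (ι → A) → ℂ) : Nonempty (CutSVD R g) := by
  obtain ⟨l, G, H, h1, h2, h3, h4, h5⟩ := exists_svd (fun x z => g (mix R z x))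
  exact ⟨⟨l, G, H, h1, h2, h3, h4, h5⟩⟩

theorem box_conj (S : ι → Bool) (g : (ι → A) → ℂ) : box S (fun x => conj (g x)) = box S g := by
  unfold box bx
  refine expect_congr rfl fun y _ => expect_congr rfl fun y' _ => ?_
  rw [← RCLike.norm_conj (𝔼 x, g (mix S x y) * conj (g (mix S x y'))), conj_expect]
  simp only [map_mul]

namespace CutSVD
variable {R : ι → Bool} {g : (ι → A) → ℂ} (D : CutSVD R g)

/-- The singular values are carried by `G` while `H` is normalized, so `l j` is the square of a
singular value. -/
theorem nsq_G (j : ι → A) : nsq (D.G j) = D.l j := by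
  apply Complex.ofReal_injective
  have := D.orthoG j j
  simp only [if_true] at this
  rw [← this]
  simp only [nsq, ofReal_expect, Complex.ofReal_pow, ← Complex.mul_conj']

theorem nsq_H (j : ι → A) : nsq (D.H j) = 1 := by
  apply Complex.ofReal_injective
  have := D.orthoH j j
  simp only [if_true] at this
  rw [Complex.ofReal_one, ← this]
  simp only [nsq, ofReal_expect, Complex.ofReal_pow, ← Complex.mul_conj']

theorem contract_conj_H (j : ι → A) : contract R (fun z => conj (D.H j z)) g = D.G j := by
  funext x
  rw [D.G_eq]
  exact expect_congr rfl fun z _ => mul_comm _ _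

theorem expect_conj_G (j z : ι → A) :
    𝔼 x, conj (D.G j x) * g (mix R z x) = D.l j * D.H j z := by
  simp only [D.eq_sum, mul_sum, expect_sum_comm]
  calc _ = ∑ k, (𝔼 x, D.G k x * conj (D.G j x)) * D.H k z := by
        refine sum_congr rfl fun k _ => ?_
        rw [expect_mul]
        refine expect_congr rfl fun x _ => ?_
        ring
    _ = _ := by simp [D.orthoG]

theorem contract_conj_G (j : ι → A) :
    contract (fun i => !R i) (fun z => conj (D.G j z)) g = fun z => (D.l j : ℂ) * D.H j z := by
  funext z
  rw [← D.expect_conj_G]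
  simp only [contract, mix_not]

theorem depOn_G (j : ι → A) : DepOn (fun i => !R i) (D.G j) := by
  intro x y
  simp only [D.G_eq, mix_not, mix_mix_right]

/-- For a nonzero singular value, `H j` is recovered by integrating `g` against `G j`, and the
result sees only the coordinates in `R`. For a zero one, `H j` is an arbitrary basis vector. -/
theorem depOn_H {j : ι → A} (hj : D.l j ≠ 0) : DepOn R (D.H j) := by
  intro x y
  have h : (D.l j : ℂ) * D.H j (mix R x y) = D.l j * D.H j x := by
    rw [← D.expect_conj_G, ← D.expect_conj_G]
    simp only [mix_mix_left]
  exact mul_left_cancel₀ (by exact_mod_cast hj) h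

/-- The function with the singular values multiplied by `a`. -/
noncomputable def comb (a : (ι → A) → ℂ) : (ι → A) → ℂ := fun x => ∑ j, a j * D.G j x * D.H j x

theorem comb_mix (a : (ι → A) → ℂ) (z x : ι → A) :
    D.comb a (mix R z x) = ∑ j, a j * D.G j x * D.H j z := by
  refine sum_congr rfl fun j _ => ?_
  by_cases hj : D.l j = 0
  · have h : ∀ x, D.G j x = 0 := nsq_eq_zero (by rw [D.nsq_G, hj])
    simp [h]
  · rw [D.depOn_H hj, (D.depOn_G j).eq (y := x)]
    intro i hi
    simp_all [mix]

theorem comb_one : D.comb (fun _ => 1) = g := by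
  funext x
  rw [← mix_self R x, D.comb_mix, mix_self]
  simp only [one_mul]
  rw [← D.eq_sum, mix_self]

theorem comb_sub (a b : (ι → A) → ℂ) :
    (fun x => D.comb a x - D.comb b x) = D.comb fun j => a j - b j := by
  funext x
  simp only [comb, ← sum_sub_distrib, sub_mul]

theorem const_mul_comb (c : ℂ) (a : (ι → A) → ℂ) :
    (fun x => c * D.comb a x) = D.comb fun j => c * a j := by
  funext x
  simp only [comb, mul_sum, mul_assoc]

/-- Correlation of combinations over the coordinates in the cut. -/
theorem expect_comb_mul_conj (a b : (ι → A) → ℂ) (x y : ι → A) :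
    𝔼 z, D.comb a (mix R z x) * conj (D.comb b (mix R z y))
      = ∑ j, (a j * D.G j x) * conj (b j * D.G j y) := by
  simp only [comb_mix]
  exact expect_mul_sum_eq D.orthoH (fun j => a j * D.G j x) (fun j => b j * D.G j y)

theorem nsq_comb (a : (ι → A) → ℂ) : nsq (D.comb a) = ∑ j, ‖a j‖ ^ 2 * D.l j := by
  rw [← expect_nsq_mix R, expect_expect_comm]
  apply Complex.ofReal_injective
  simp only [ofReal_expect, Complex.ofReal_pow, ← Complex.mul_conj', expect_comb_mul_conj,
    expect_sum_comm, Complex.ofReal_sum, Complex.ofReal_mul]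
  refine sum_congr rfl fun j _ => ?_
  rw [← D.nsq_G, nsq, ofReal_expect, mul_expect]
  refine expect_congr rfl fun x _ => ?_
  push_cast
  simp only [← Complex.mul_conj', map_mul]; ring

theorem sum_l : ∑ j, D.l j = nsq g := by
  have := D.nsq_comb (fun _ => 1)
  rw [D.comb_one] at this
  simpa using this.symm

/-- The box norm is the Schatten 4-norm of `g` regarded as a matrix across the cut. -/
theorem sum_l_sq : ∑ j, D.l j ^ 2 = box R g := by
  have h : box R g = bx (fun x z => g (mix R z x)) := (bx_transpose _).symm
  have h2 : bx (fun x z => g (mix R z x)) = bx (fun z x => g (mix R z x)) := bx_transpose _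
  apply Complex.ofReal_injective
  rw [h, h2, bx]
  have hk : ∀ y y', 𝔼 x, g (mix R x y) * conj (g (mix R x y'))
      = ∑ j, D.G j y * conj (D.G j y') := by
    intro y y'
    have := D.expect_comb_mul_conj (fun _ => 1) (fun _ => 1) y y'
    rw [D.comb_one] at this
    simpa using this
  simp only [hk, ofReal_expect, Complex.ofReal_pow, ← Complex.mul_conj', map_sum, map_mul,
    sum_mul_sum, Complex.conj_conj, expect_sum_comm, Complex.ofReal_sum]
  refine sum_congr rfl fun j _ => ?_
  symm
  calc _ = ∑ k, (𝔼 y, D.G j y * conj (D.G k y)) * (𝔼 y', D.G k y' * conj (D.G j y')) := by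
        refine sum_congr rfl fun k _ => ?_
        rw [expect_mul_expect_eq]
        refine expect_congr rfl fun y _ => expect_congr rfl fun y' _ => ?_
        ring
    _ = _ := by simp [D.orthoG, sq]

theorem contract_sum (b : (ι → A) → ℂ) :
    contract R (fun z => ∑ j, b j * conj (D.H j z)) g = fun x => ∑ j, b j * D.G j x := by
  funext x
  simp only [contract, sum_mul, expect_sum_comm]
  refine sum_congr rfl fun j _ => ?_
  rw [D.G_eq, mul_expect]
  refine expect_congr rfl fun z _ => ?_
  ring

theorem nsq_sum_conj_H (b : (ι → A) → ℂ) :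
    nsq (fun z => ∑ j, b j * conj (D.H j z)) = ∑ j, ‖b j‖ ^ 2 := by
  have : ∀ j k, 𝔼 z, conj (D.H j z) * conj (conj (D.H k z))
      = if j = k then ((1 : ℝ) : ℂ) else 0 := by
    intro j k
    simp only [Complex.conj_conj]
    have := D.orthoH k j
    simp only [mul_comm (D.H k _)] at this
    rw [this]
    by_cases h : j = k <;> simp [h, eq_comm]
  rw [nsq_sum_of_ortho (l := fun _ => 1) this]
  simp

/-- The average of the box functional over random phases of the components. -/
theorem expect_box_phase (S : ι → Bool) (a : (ι → A) → ℂ) :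
    𝔼 θ : (ι → A) → ZMod 4, box S (fun x => ∑ j, ph (θ j) * (a j * D.G j x)) =
      box (fun i => S i && !R i) (D.comb a) + box (fun i => S i || R i) (D.comb a)
        - ∑ j, box S (fun x => a j * D.G j x) := by
  apply Complex.ofReal_injective
  have e : ∀ F : (ι → A) × (ι → A) → ℂ, 𝔼 p, F p
      = 𝔼 x, 𝔼 x', 𝔼 z, 𝔼 z', F (mix R z x, mix R z' x') := by
    intro F
    rw [expect_prod_eq, ← expect_mix R (fun u => 𝔼 v, F (u, v)), expect_expect_comm]
    refine expect_congr rfl fun x _ => ?_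
    calc _ = 𝔼 z, 𝔼 z', 𝔼 x', F (mix R z x, mix R z' x') :=
          expect_congr rfl fun z _ => (expect_mix R (fun v => F (mix R z x, v))).symm
      _ = 𝔼 z, 𝔼 x', 𝔼 z', F (mix R z x, mix R z' x') :=
          expect_congr rfl fun z _ => expect_expect_comm _
      _ = _ := expect_expect_comm _
  -- The coordinates `z, z'` in `R` are integrated out first. For the cut `S \ R` each stays in its
  -- own tensor factor, for `S ∪ R` they are exchanged; this produces the two pairings of
  -- `expect_ph_sum`.
  have h1 : (box (fun i => S i && !R i) (D.comb a) : ℂ) = 𝔼 x, 𝔼 x',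
      (∑ j, (a j * D.G j x) * conj (a j * D.G j (mix S x' x))) *
      (∑ j, (a j * D.G j x') * conj (a j * D.G j (mix S x x'))) := by
    rw [ofReal_box, e]
    refine expect_congr rfl fun x _ => expect_congr rfl fun x' _ => ?_
    rw [← D.expect_comb_mul_conj, ← D.expect_comb_mul_conj, expect_mul_expect_eq]
    refine expect_congr rfl fun z _ => expect_congr rfl fun z' _ => ?_
    have e1 : mix (fun i => S i && !R i) (mix R z' x') (mix R z x) = mix R z (mix S x' x) := by
      funext i; by_cases h1 : R i <;> by_cases h2 : S i <;> simp [mix, h1, h2]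
    have e2 : mix (fun i => S i && !R i) (mix R z x) (mix R z' x') = mix R z' (mix S x x') := by
      funext i; by_cases h1 : R i <;> by_cases h2 : S i <;> simp [mix, h1, h2]
    simp only [tensorSq, swapEquiv, Equiv.coe_fn_mk, e1, e2, map_mul]
    ring
  have h2 : (box (fun i => S i || R i) (D.comb a) : ℂ) = 𝔼 x, 𝔼 x',
      (∑ j, (a j * D.G j x) * conj (a j * D.G j (mix S x x'))) *
      (∑ j, (a j * D.G j x') * conj (a j * D.G j (mix S x' x))) := by
    rw [ofReal_box, e]
    refine expect_congr rfl fun x _ => expect_congr rfl fun x' _ => ?_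
    rw [← D.expect_comb_mul_conj, ← D.expect_comb_mul_conj, expect_mul_expect_eq]
    refine expect_congr rfl fun z _ => expect_congr rfl fun z' _ => ?_
    have e1 : mix (fun i => S i || R i) (mix R z' x') (mix R z x) = mix R z' (mix S x' x) := by
      funext i; by_cases h1 : R i <;> by_cases h2 : S i <;> simp [mix, h1, h2]
    have e2 : mix (fun i => S i || R i) (mix R z x) (mix R z' x') = mix R z (mix S x x') := by
      funext i; by_cases h1 : R i <;> by_cases h2 : S i <;> simp [mix, h1, h2]
    simp only [tensorSq, swapEquiv, Equiv.coe_fn_mk, e1, e2, map_mul]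
    ring
  have h3 : ((∑ j, box S (fun x => a j * D.G j x) : ℝ) : ℂ) = 𝔼 x, 𝔼 x', ∑ j,
      (a j * D.G j x) * (a j * D.G j x') *
        conj ((a j * D.G j (mix S x' x)) * (a j * D.G j (mix S x x'))) := by
    simp only [Complex.ofReal_sum, ofReal_box, expect_prod_eq, expect_sum_comm]
    rfl
  rw [Complex.ofReal_sub, Complex.ofReal_add, h1, h2, h3, ofReal_expect]
  simp only [ofReal_box]
  rw [expect_expect_comm, expect_prod_eq]
  simp only [← expect_add_distrib, ← expect_sub_distrib]
  refine expect_congr rfl fun x _ => expect_congr rfl fun x' _ => ?_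
  rw [← expect_ph_sum]
  rfl

end CutSVD

end CutSVD

/-! ### The increment step -/

section Gain
variable {ι A : Type*} [Fintype ι] [DecidableEq ι] [Fintype A] [DecidableEq A]

open Classical in
/-- The normalized average box functional of a contraction of `g`, counted only if the contraction
has mean square at least `τ`. -/
noncomputable def gain (τ : ℝ) (R : ι → Bool) (H g : (ι → A) → ℂ) : ℝ :=
  if τ ≤ nsq (contract R H g) then avgBox (contract R H g) / nsq (contract R H g) ^ 2 else 0

/-- The supremum of the gain over contractions against functions in the unit ball. -/
noncomputable def topGain (τ : ℝ) (R : ι → Bool) (g : (ι → A) → ℂ) : ℝ :=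
  ⨆ H : {H : (ι → A) → ℂ // nsq H ≤ 1}, gain τ R H g

variable [Nonempty A] {τ : ℝ} {R : ι → Bool} {g : (ι → A) → ℂ}

theorem gain_nonneg (H : (ι → A) → ℂ) : 0 ≤ gain τ R H g := by
  unfold gain
  split
  · exact div_nonneg (avgBox_nonneg _) (by positivity)
  · exact le_rfl

theorem gain_le_one (H : (ι → A) → ℂ) : gain τ R H g ≤ 1 := by
  unfold gain
  split
  · exact div_le_one_of_le₀ (avgBox_le _) (by positivity)
  · exact zero_le_one

instance : Nonempty {H : (ι → A) → ℂ // nsq H ≤ 1} := ⟨⟨fun _ => 0, by simp [nsq]⟩⟩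

theorem bddAbove_gain : BddAbove (Set.range
    fun H : {H : (ι → A) → ℂ // nsq H ≤ 1} => gain τ R H g) :=
  ⟨1, by rintro _ ⟨H, rfl⟩; exact gain_le_one _⟩

theorem gain_le_topGain {H : (ι → A) → ℂ} (hH : nsq H ≤ 1) : gain τ R H g ≤ topGain τ R g := by
  have h := le_ciSup (bddAbove_gain (τ := τ) (R := R) (g := g)) ⟨H, hH⟩
  exact h

theorem topGain_nonneg : 0 ≤ topGain τ R g :=
  (gain_nonneg (fun _ => 0)).trans (gain_le_topGain (by simp [nsq]))

theorem topGain_le_one : topGain τ R g ≤ 1 := ciSup_le fun _ => gain_le_one _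

theorem avgBox_contract_le (hτ : 0 < τ) {H : (ι → A) → ℂ} (hH : nsq H ≤ 1)
    (h : τ ≤ nsq (contract R H g)) :
    avgBox (contract R H g) ≤ topGain τ R g * nsq (contract R H g) ^ 2 := by
  have h1 : gain τ R H g ≤ topGain τ R g := gain_le_topGain hH
  rw [gain, if_pos h, div_le_iff₀ (by have := hτ.trans_le h; positivity)] at h1
  exact h1

namespace CutSVD
variable (D : CutSVD R g)

/-- A contraction against a random combination of singular vectors has a large box functional. -/
theorem topGain_mul_ge (hg : nsq g = 1) (hτ : 0 < τ) (h2τ : 2 * τ ≤ box R g) {m : ι → A}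
    (hm : ∀ j, D.l j ≤ D.l m) :
    2 * avgBox g - 8 * √((D.l m - box R g) / D.l m) - (D.l m - box R g)
      ≤ topGain τ R g * (1 + box R g) := by
  set L := D.l m with hL
  set π := box R g with hπ
  set s := topGain τ R g with hs
  have hs0 : 0 ≤ s := topGain_nonneg
  have hsum : ∑ j, D.l j = 1 := by rw [D.sum_l, hg]
  have hsq : ∑ j, D.l j ^ 2 = π := D.sum_l_sq
  have hπL : π ≤ L := by
    rw [← hsq]
    calc ∑ j, D.l j ^ 2 ≤ ∑ j, L * D.l j := by
          refine sum_le_sum fun j _ => ?_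
          rw [sq]; exact mul_le_mul_of_nonneg_right (hm j) (D.l_nonneg j)
      _ = L := by rw [← mul_sum, hsum, mul_one]
  have hL0 : 0 < L := by linarith
  -- With these weights the test function has mean square `∑ l j = 1` and the contraction has mean
  -- square `∑ l j ^ 2 = π`; for a flat spectrum the weights are nearly constant, so that `comb a`
  -- is nearly a multiple of `g`.
  set a : (ι → A) → ℂ := fun j => ((√(D.l j) : ℝ) : ℂ) with ha
  have na : ∀ j, ‖a j‖ ^ 2 = D.l j := by
    intro j
    rw [ha, Complex.norm_real, Real.norm_of_nonneg (Real.sqrt_nonneg _),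
      Real.sq_sqrt (D.l_nonneg j)]
  -- the random contraction
  have up : ∀ θ : (ι → A) → ZMod 4,
      avgBox (fun x => ∑ j, ph (θ j) * (a j * D.G j x)) ≤ s * π ^ 2 := by
    intro θ
    have hc := D.contract_sum (fun j => ph (θ j) * a j)
    have hn : nsq (contract R (fun z => ∑ j, ph (θ j) * a j * conj (D.H j z)) g) = π := by
      rw [hc, nsq_sum_of_ortho D.orthoG, ← hsq]
      refine sum_congr rfl fun j _ => ?_
      rw [norm_mul, norm_ph, one_mul, na, sq]
    have hH : nsq (fun z => ∑ j, ph (θ j) * a j * conj (D.H j z)) ≤ 1 := by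
      rw [D.nsq_sum_conj_H, ← hsum]
      refine le_of_eq (sum_congr rfl fun j _ => ?_)
      rw [norm_mul, norm_ph, one_mul, na]
    have := avgBox_contract_le (g := g) (R := R) hτ hH (by rw [hn]; linarith)
    rw [hn, hc] at this
    simpa only [mul_assoc] using this
  have small : ∀ j, avgBox (fun x => a j * D.G j x)
      ≤ s * L ^ 2 * D.l j ^ 2 + L ^ 2 * (D.l j * (L - D.l j)) := by
    intro j
    have hj0 := D.l_nonneg j
    have hjL := hm j
    rw [avgBox_const_mul, show ‖a j‖ ^ 4 = (‖a j‖ ^ 2) ^ 2 by ring, na]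
    have hLj : 0 ≤ L - D.l j := by linarith
    have hll : D.l j ^ 2 ≤ L ^ 2 := by gcongr
    -- Above the threshold `G j` is itself a contraction governed by `s`. Below it the trivial bound
    -- is enough, since `2 * τ ≤ π ≤ L` gives `l j ≤ L - l j`.
    by_cases hjτ : τ ≤ D.l j
    · have := avgBox_contract_le (g := g) (R := R) (H := fun z => conj (D.H j z)) hτ
        (by rw [nsq_conj, D.nsq_H]) (by rw [D.contract_conj_H, D.nsq_G]; exact hjτ)
      rw [D.contract_conj_H, D.nsq_G] at this
      calc D.l j ^ 2 * avgBox (D.G j) ≤ L ^ 2 * (s * D.l j ^ 2) := by gcongr; exact avgBox_nonneg _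
        _ ≤ _ := by
          have : 0 ≤ L ^ 2 * (D.l j * (L - D.l j)) := by positivity
          linarith
    · have h1 := avgBox_le (D.G j)
      rw [D.nsq_G] at h1
      calc D.l j ^ 2 * avgBox (D.G j) ≤ L ^ 2 * (D.l j * D.l j) := by
            rw [← sq]; gcongr; exact avgBox_nonneg _
        _ ≤ L ^ 2 * (D.l j * (L - D.l j)) := by gcongr; linarith
        _ ≤ _ := by
          have : 0 ≤ s * L ^ 2 * D.l j ^ 2 := by positivity
          linarith
  have smallsum : ∑ j, avgBox (fun x => a j * D.G j x) ≤ s * L ^ 2 * π + L ^ 2 * (L - π) := by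
    refine (sum_le_sum fun j _ => small j).trans_eq ?_
    rw [sum_add_distrib, ← mul_sum, ← mul_sum, hsq]
    congr 2
    simp only [mul_sub, sum_sub_distrib, ← sq, hsq, ← sum_mul, hsum, one_mul]
  -- the combination is close to a multiple of `g`
  have hsL : (0 : ℝ) < √L := Real.sqrt_pos.2 hL0
  set c : ℂ := (((√L)⁻¹ : ℝ) : ℂ) with hc
  set g1 : (ι → A) → ℂ := fun x => c * D.comb a x with hg1
  have nc2 : ‖c‖ ^ 2 = L⁻¹ := by
    rw [hc, Complex.norm_real, Real.norm_of_nonneg (by positivity), inv_pow, Real.sq_sqrt hL0.le]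
  have nc : ‖c‖ ^ 4 = (L ^ 2)⁻¹ := by
    rw [show ‖c‖ ^ 4 = (‖c‖ ^ 2) ^ 2 by ring, nc2, inv_pow]
  have hbox : ∀ T : ι → Bool, box T (D.comb a) = L ^ 2 * box T g1 := by
    intro T
    rw [hg1, box_const_mul, nc, mul_inv_cancel_left₀ (by positivity)]
  have hn1 : nsq g1 ≤ 1 := by
    rw [hg1, nsq_const_mul, nc2, D.nsq_comb]
    simp only [na, ← sq, hsq]
    rw [inv_mul_le_iff₀ hL0]; linarith
  -- Uses `(1 - √t)² ≤ 1 - t` on `[0, 1]` with `t = l j / L`.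
  have hdiff : nsq (fun x => g x - g1 x) ≤ (L - π) / L := by
    have : (fun x => g x - g1 x) = D.comb fun j => 1 - c * a j := by
      rw [hg1, D.const_mul_comb, ← D.comb_sub, D.comb_one]
    rw [this, D.nsq_comb]
    calc ∑ j, ‖1 - c * a j‖ ^ 2 * D.l j ≤ ∑ j, (1 - D.l j / L) * D.l j := by
          refine sum_le_sum fun j _ => mul_le_mul_of_nonneg_right ?_ (D.l_nonneg j)
          have e1 : (1 : ℂ) - c * a j = ((1 - √(D.l j / L) : ℝ) : ℂ) := by
            rw [hc, ha, Real.sqrt_div (D.l_nonneg j)]; push_cast; ring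
          rw [e1, Complex.norm_real, Real.norm_eq_abs, sq_abs]
          have h0 : 0 ≤ D.l j / L := div_nonneg (D.l_nonneg j) hL0.le
          have h1 : D.l j / L ≤ 1 := div_le_one_of_le₀ (hm j) hL0.le
          have h2 : √(D.l j / L) ≤ 1 := Real.sqrt_le_one.2 h1
          have h3 := Real.sq_sqrt h0
          nlinarith [Real.sqrt_nonneg (D.l j / L)]
      _ = (L - π) / L := by
          simp only [sub_mul, one_mul, sum_sub_distrib, hsum, div_mul_eq_mul_div, ← sq,
            ← sum_div, hsq]
          field_simp
  set t := (L - π) / L with ht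
  have hcl : ∀ T : ι → Bool, box T g - 4 * √t ≤ box T g1 := by
    intro T
    have h1 := abs_box_sub_box_le T g g1 hg.le hn1
    have h2 : √(nsq fun x => g x - g1 x) ≤ √t := Real.sqrt_le_sqrt hdiff
    have := (abs_le.1 h1).2
    linarith
  have low1 : L ^ 2 * (avgBox g - 4 * √t)
      ≤ 𝔼 S : ι → Bool, box (fun i => S i && !R i) (D.comb a) := by
    simp only [hbox, ← mul_expect]
    gcongr
    calc avgBox g - 4 * √t ≤ (𝔼 S : ι → Bool, box (fun i => S i && !R i) g) - 4 * √t := by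
          have := avgBox_le_expect_box_and (fun i => !R i) g; linarith
      _ = 𝔼 S : ι → Bool, (box (fun i => S i && !R i) g - 4 * √t) := by
          rw [expect_sub_distrib, Fintype.expect_const]
      _ ≤ _ := expect_mono fun S => hcl _
  have low2 : L ^ 2 * (avgBox g - 4 * √t)
      ≤ 𝔼 S : ι → Bool, box (fun i => S i || R i) (D.comb a) := by
    simp only [hbox, ← mul_expect]
    gcongr
    calc avgBox g - 4 * √t ≤ (𝔼 S : ι → Bool, box (fun i => S i || R i) g) - 4 * √t := by
          have := avgBox_le_expect_box_or R g; linarith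
      _ = 𝔼 S : ι → Bool, (box (fun i => S i || R i) g - 4 * √t) := by
          rw [expect_sub_distrib, Fintype.expect_const]
      _ ≤ _ := expect_mono fun S => hcl _
  -- By monotonicity in the set of allowed cuts, each of the first two terms is almost at least `L ^
  -- 2 * avgBox g`; the left side is at most `s * π ^ 2` by `up`.
  have key : 𝔼 θ : (ι → A) → ZMod 4, avgBox (fun x => ∑ j, ph (θ j) * (a j * D.G j x)) =
      𝔼 S : ι → Bool, box (fun i => S i && !R i) (D.comb a)
      + 𝔼 S : ι → Bool, box (fun i => S i || R i) (D.comb a)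
      - ∑ j, avgBox (fun x => a j * D.G j x) := by
    have h1 : 𝔼 θ : (ι → A) → ZMod 4, avgBox (fun x => ∑ j, ph (θ j) * (a j * D.G j x)) =
        𝔼 S : ι → Bool, 𝔼 θ : (ι → A) → ZMod 4,
          box S (fun x => ∑ j, ph (θ j) * (a j * D.G j x)) := expect_expect_comm _
    rw [h1]
    simp only [D.expect_box_phase, expect_sub_distrib, expect_add_distrib]
    congr 1
    unfold avgBox
    exact Finset.expect_sum_comm _ _ _
  have hle : 𝔼 θ : (ι → A) → ZMod 4, avgBox (fun x => ∑ j, ph (θ j) * (a j * D.G j x))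
      ≤ s * π ^ 2 := expect_le univ_nonempty fun θ _ => up θ
  have hπ2 : s * π ^ 2 ≤ s * L ^ 2 := by
    have : 0 ≤ π := box_nonneg _ _
    gcongr
  have fin : L ^ 2 * (2 * avgBox g - 8 * √t - (L - π)) ≤ L ^ 2 * (s * (1 + π)) := by
    nlinarith
  exact le_of_mul_le_mul_left fin (by positivity)

end CutSVD

end Gain

/-! ### Comparing random cuts and deriving the increment. -/

section OneStep
variable {ι A : Type*} [Fintype ι] [DecidableEq ι] [Fintype A] [DecidableEq A] [Nonempty A]

theorem le_avg_of_pow_four_le {x a b c d : ℝ} (ha : 0 ≤ a) (hb : 0 ≤ b) (hc : 0 ≤ c)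
    (hd : 0 ≤ d) (h : x ^ 4 ≤ a * b * c * d) : x ≤ (a + b + c + d) / 4 := by
  have h1 : a * b ≤ ((a + b) / 2) ^ 2 := by nlinarith [sq_nonneg (a - b)]
  have h2 : c * d ≤ ((c + d) / 2) ^ 2 := by nlinarith [sq_nonneg (c - d)]
  have h3 : (a + b) / 2 * ((c + d) / 2) ≤ ((a + b + c + d) / 4) ^ 2 := by
    nlinarith [sq_nonneg ((a + b) - (c + d))]
  have h4 : x ^ 4 ≤ ((a + b + c + d) / 4) ^ 4 := by
    calc x ^ 4 ≤ (a * b) * (c * d) := by linarith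
      _ ≤ ((a + b) / 2) ^ 2 * ((c + d) / 2) ^ 2 := by gcongr
      _ = ((a + b) / 2 * ((c + d) / 2)) ^ 2 := by ring
      _ ≤ (((a + b + c + d) / 4) ^ 2) ^ 2 := by gcongr
      _ = _ := by ring
  exact le_of_pow_le_pow_left₀ (by norm_num) (by positivity) h4

/-- Correlations of `g` with products across cuts are controlled by the box functionals of the
factors. -/
theorem sq_expect_le_avgBox (g : (ι → A) → ℂ) (hg : nsq g = 1)
    (G H : (ι → Bool) → (ι → A) → ℂ) (hG : ∀ S, DepOn (fun i => !S i) (G S))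
    (hH : ∀ S, DepOn S (H S)) :
    ‖𝔼 S, 𝔼 x, g x * conj (G S x * H S x)‖ ^ 2
      ≤ 𝔼 S, (avgBox (G S) + avgBox (H S)) / 2 := by
  set Ψ : (ι → Bool) → (ι → A) → ℂ := fun S x => G S x * H S x with hΨ
  -- Cauchy–Schwarz in `x` discards `g` and leaves correlations between the products belonging to
  -- two independent cuts.
  have h1 : ‖𝔼 S, 𝔼 x, g x * conj (Ψ S x)‖ ^ 2 ≤ nsq (fun x => 𝔼 S, Ψ S x) := by
    have : 𝔼 S, 𝔼 x, g x * conj (Ψ S x) = 𝔼 x, g x * conj (𝔼 S, Ψ S x) := by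
      rw [expect_expect_comm]
      simp only [conj_expect, mul_expect]
    rw [this]
    refine (norm_sq_expect_mul_le _ _).trans_eq ?_
    rw [show (𝔼 x, ‖g x‖ ^ 2) = 1 from hg, one_mul]
    simp [nsq]
  have h2 : ((nsq (fun x => 𝔼 S, Ψ S x) : ℝ) : ℂ) = 𝔼 S, 𝔼 T, 𝔼 x, Ψ S x * conj (Ψ T x) := by
    simp only [nsq, ofReal_expect, Complex.ofReal_pow, ← Complex.mul_conj', conj_expect,
      expect_mul_expect_eq]
    rw [expect_expect_comm]
    exact expect_congr rfl fun z _ => expect_expect_comm _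
  have h3 : nsq (fun x => 𝔼 S, Ψ S x) = ‖𝔼 S, 𝔼 T, 𝔼 x, Ψ S x * conj (Ψ T x)‖ := by
    rw [← h2, Complex.norm_real, Real.norm_of_nonneg (nsq_nonneg _)]
  refine h1.trans ?_
  rw [h3]
  refine (RCLike.norm_expect_le (K := ℂ)).trans ?_
  refine (expect_mono fun S => RCLike.norm_expect_le (K := ℂ)).trans ?_
  have h4 : ∀ S T, ‖𝔼 x, Ψ S x * conj (Ψ T x)‖
      ≤ (box T (H S) + box T (G S) + box S (H T) + box S (G T)) / 4 := by
    intro S T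
    apply le_avg_of_pow_four_le (box_nonneg _ _) (box_nonneg _ _) (box_nonneg _ _) (box_nonneg _ _)
    have h5 := norm_expect_cuts_le S T (a := H S) (b := G S) (c := fun x => conj (H T x))
      (d := fun x => conj (G T x)) (hH S) (hG S) (fun x y => congrArg conj (hH T x y))
      (fun x y => congrArg conj (hG T x y))
    rw [box_conj, box_conj] at h5
    convert h5 using 4
    simp only [hΨ, map_mul]; ring
  refine (expect_mono fun S => expect_mono fun T => h4 S T).trans_eq ?_
  have e1 : ∀ F : (ι → Bool) → (ι → Bool) → ℝ, 𝔼 S, 𝔼 T, F T S = 𝔼 S, 𝔼 T, F S T :=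
    fun F => expect_expect_comm _
  simp only [← expect_div, expect_add_distrib]
  rw [e1 (fun S T => box T (H S)), e1 (fun S T => box T (G S))]
  unfold avgBox
  ring

set_option maxHeartbeats 1000000 in
/-- The real-variable inequality behind the increment step. -/
theorem increment_contradiction {ρ : Type*} [Fintype ρ] [Nonempty ρ] (π L s : ρ → ℝ)
    {p κ τ : ℝ} (hp0 : 0 < p) (hp1 : p < 1) (hκ : 0 < κ)
    (hκp : 2400 * κ < p ^ 5 * (1 - p) ^ 2) (hτ : 4 * τ ≤ p)
    (hπ0 : ∀ r, 0 ≤ π r) (hπL : ∀ r, π r ≤ L r) (hL1 : ∀ r, L r ≤ 1)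
    (hs0 : ∀ r, 0 ≤ s r) (hs1 : ∀ r, s r ≤ 1)
    (hdev : 𝔼 r, |π r - p| ≤ 4 * κ) (hs : 𝔼 r, s r ≤ p + 2 * κ)
    (hL : (𝔼 r, √(L r)) ^ 2 ≤ 𝔼 r, (s r + if τ ≤ L r then 0 else 1))
    (hgain : ∀ r, 2 * τ ≤ π r →
      2 * p - 8 * √((L r - π r) / L r) - (L r - π r) ≤ s r * (1 + π r)) : False := by
  set q := √p with hq
  have hq0 : 0 < q := Real.sqrt_pos.2 hp0
  have hq2 : q ^ 2 = p := Real.sq_sqrt hp0.le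
  have hq1 : q ≤ 1 := Real.sqrt_le_one.2 hp1.le
  have hpq : p ≤ q := by nlinarith
  -- the top singular values are close to `π` on average
  have h1 : (𝔼 r, √(L r)) ^ 2 ≤ p + 10 * κ / p := by
    -- If `L r < τ`, then `π r < p / 4`, so the deviation from `p` exceeds `p / 2` and pays for the
    -- `1`.
    have : 𝔼 r, (s r + if τ ≤ L r then (0 : ℝ) else 1) ≤ 𝔼 r, (s r + 2 / p * |π r - p|) := by
      refine expect_mono fun r => ?_
      gcongr
      split_ifs with h
      · positivity
      · rw [div_mul_eq_mul_div, le_div_iff₀ hp0]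
        have := hπL r
        have := neg_abs_le (π r - p)
        linarith
    rw [show 𝔼 r, (s r + 2 / p * |π r - p|) = 𝔼 r, s r + 2 / p * 𝔼 r, |π r - p| by
      rw [expect_add_distrib, mul_expect]] at this
    have h2 : 2 / p * 𝔼 r, |π r - p| ≤ 2 / p * (4 * κ) := by gcongr
    have h3 : 2 * κ ≤ 2 * κ / p := by
      rw [le_div_iff₀ hp0]; nlinarith
    have h4 : 2 / p * (4 * κ) + 2 * κ / p = 10 * κ / p := by ring
    linarith
  have h2 : 𝔼 r, √(L r) ≤ q + 5 * κ / p ^ 2 := by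
    have h0 : 0 ≤ 5 * κ / p ^ 2 := by positivity
    apply le_of_sq_le_sq _ (by positivity)
    refine h1.trans ?_
    have : 10 * κ / p ≤ 2 * q * (5 * κ / p ^ 2) := by
      have : 2 * q * (5 * κ / p ^ 2) = (q / p) * (10 * κ / p) := by field_simp; ring
      rw [this]
      have : 1 ≤ q / p := (one_le_div hp0).2 hpq
      have h5 : 0 ≤ 10 * κ / p := by positivity
      nlinarith
    nlinarith [sq_nonneg (5 * κ / p ^ 2)]
  have h3 : 𝔼 r, (L r - π r) ≤ 18 * κ / p ^ 2 := by
    -- Factor `L - π` as `(√L - √π)(√L + √π)` with second factor at most `2`, then replace `√π` by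
    -- `q`.
    have hpt : ∀ r, L r - π r ≤ 2 * √(L r) - 2 * q + 2 / p * |π r - p| := by
      intro r
      have hL0 : 0 ≤ L r := (hπ0 r).trans (hπL r)
      have a1 := Real.sq_sqrt hL0
      have a2 := Real.sq_sqrt (hπ0 r)
      have a3 : √(L r) ≤ 1 := Real.sqrt_le_one.2 (hL1 r)
      have a4 : √(π r) ≤ √(L r) := Real.sqrt_le_sqrt (hπL r)
      have a5 := Real.sqrt_nonneg (π r)
      have a6 : q - √(π r) ≤ 1 / p * |π r - p| := by
        rcases le_or_gt q (√(π r)) with h | h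
        · have : 0 ≤ 1 / p * |π r - p| := by positivity
          linarith
        · rw [one_div, inv_mul_eq_div, le_div_iff₀ hp0]
          have b1 : p - π r ≤ |π r - p| := by rw [abs_sub_comm]; exact le_abs_self _
          have b2 : (q - √(π r)) * p ≤ (q - √(π r)) * (q + √(π r)) := by
            apply mul_le_mul_of_nonneg_left _ (by linarith); linarith
          nlinarith
      have a7 : 2 / p * |π r - p| = 2 * (1 / p * |π r - p|) := by ring
      nlinarith
    refine (expect_mono hpt).trans ?_
    rw [expect_add_distrib, expect_sub_distrib, Fintype.expect_const, ← mul_expect, ← mul_expect]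
    have b1 : 2 / p * 𝔼 r, |π r - p| ≤ 2 / p * (4 * κ) := by gcongr
    have b2 : 2 / p * (4 * κ) ≤ 8 * κ / p ^ 2 := by
      rw [div_mul_eq_mul_div, div_le_div_iff₀ hp0 (by positivity)]
      have : p * p ≤ p * 1 := by gcongr
      nlinarith
    have b3 : 2 * (5 * κ / p ^ 2) + 8 * κ / p ^ 2 = 18 * κ / p ^ 2 := by ring
    linarith
  -- averaging the lower bounds for `s`
  set a := p * (1 - p) / 2 with ha
  have hp1' : 0 < 1 - p := by linarith
  have ha0 : 0 < a := by positivity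
  have hpt : ∀ r, 2 * p - a - (32 / (a * p) + 1) * (L r - π r) - 4 * |π r - p|
      ≤ s r * (1 + p) := by
    intro r
    have hd : 0 ≤ L r - π r := by linarith [hπL r]
    have habs := abs_nonneg (π r - p)
    have hc0 : 0 ≤ 32 / (a * p) := by positivity
    -- When `π r < p / 2`, the term `4 * |π r - p|` exceeds `2 * p` and the left side is negative.
    by_cases hr : p / 2 ≤ π r
    · have g1 := hgain r (by linarith)
      have hLp : p / 2 ≤ L r := hr.trans (hπL r)
      have hL0 : 0 < L r := by linarith
      set t := (L r - π r) / L r with ht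
      have ht0 : 0 ≤ t := by positivity
      have t1 : 8 * √t ≤ a + 16 / a * t := by
        have e := Real.sq_sqrt ht0
        have : 16 / a * t = (4 * √t) ^ 2 / a := by rw [mul_pow, e]; ring
        rw [this]
        have : 2 * (4 * √t) * a ≤ a * a + (4 * √t) ^ 2 := by nlinarith [sq_nonneg (4 * √t - a)]
        have h6 : a + (4 * √t) ^ 2 / a = (a * a + (4 * √t) ^ 2) / a := by field_simp
        rw [h6, le_div_iff₀ ha0]
        linarith
      have t2 : 16 / a * t ≤ 32 / (a * p) * (L r - π r) := by
        have : t ≤ 2 / p * (L r - π r) := by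
          rw [ht, div_le_iff₀ hL0, div_mul_eq_mul_div, div_mul_eq_mul_div, le_div_iff₀ hp0]
          nlinarith
        calc 16 / a * t ≤ 16 / a * (2 / p * (L r - π r)) := by gcongr
          _ = _ := by field_simp; ring
      have t3 : s r * π r ≤ s r * p + |π r - p| := by
        have b1 : π r - p ≤ |π r - p| := le_abs_self _
        have b2 : s r * (π r - p) ≤ 1 * |π r - p| := by
          calc s r * (π r - p) ≤ s r * |π r - p| := mul_le_mul_of_nonneg_left b1 (hs0 r)
            _ ≤ _ := mul_le_mul_of_nonneg_right (hs1 r) habs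
        linarith
      have t4 : 0 ≤ 16 / a * t := by positivity
      linarith
    · have b1 : p - π r ≤ |π r - p| := by rw [abs_sub_comm]; exact le_abs_self _
      have b2 : 0 ≤ s r * (1 + p) := mul_nonneg (hs0 r) (by linarith)
      have b3 : 0 ≤ (32 / (a * p) + 1) * (L r - π r) := by positivity
      linarith
  have h4 := expect_mono hpt
  rw [expect_sub_distrib, expect_sub_distrib, Fintype.expect_const, ← mul_expect, ← mul_expect,
    ← expect_mul] at h4
  have h5 : (32 / (a * p) + 1) * 𝔼 r, (L r - π r) ≤ (32 / (a * p) + 1) * (18 * κ / p ^ 2) := by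
    gcongr
  have h6 : (𝔼 r, s r) * (1 + p) ≤ (p + 2 * κ) * (1 + p) := by gcongr
  have h7 : a ≤ (32 / (a * p) + 1) * (18 * κ / p ^ 2) + 20 * κ := by
    have : a + a = p * (1 - p) := by rw [ha]; ring
    nlinarith
  have e1 : (32 / (a * p) + 1) * (18 * κ / p ^ 2) = 1152 * κ / (p ^ 4 * (1 - p)) + 18 * κ / p ^ 2 := by
    rw [ha]; field_simp; ring
  have hden : 0 < p ^ 4 * (1 - p) := by positivity
  have e2 : 18 * κ / p ^ 2 ≤ 18 * κ / (p ^ 4 * (1 - p)) := by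
    apply div_le_div_of_nonneg_left (by positivity) hden
    have : p ^ 4 ≤ p ^ 2 := pow_le_pow_of_le_one hp0.le hp1.le (by norm_num)
    nlinarith [pow_pos hp0 4]
  have e3 : 20 * κ ≤ 20 * κ / (p ^ 4 * (1 - p)) := by
    rw [le_div_iff₀ hden]
    have h8 : p ^ 4 ≤ 1 := pow_le_one₀ hp0.le hp1.le
    have : p ^ 4 * (1 - p) ≤ 1 := by nlinarith [pow_pos hp0 4]
    nlinarith
  have h8 : a ≤ 1190 * κ / (p ^ 4 * (1 - p)) := by
    have : 1190 * κ / (p ^ 4 * (1 - p)) = 1152 * κ / (p ^ 4 * (1 - p))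
        + 18 * κ / (p ^ 4 * (1 - p)) + 20 * κ / (p ^ 4 * (1 - p)) := by ring
    linarith
  rw [le_div_iff₀ hden, ha] at h8
  have : p * (1 - p) / 2 * (p ^ 4 * (1 - p)) = p ^ 5 * (1 - p) ^ 2 / 2 := by ring
  linarith

/-- Either restricting at random or contracting across random cuts increases the normalized
average box functional. -/
theorem increment (g : (ι → A) → ℂ) (hg : nsq g = 1) {κ τ : ℝ} (hτ : 0 < τ)
    (hτg : 4 * τ ≤ avgBox g) (hg1 : avgBox g < 1) (hκ : 0 < κ)
    (hκg : 2400 * κ < avgBox g ^ 5 * (1 - avgBox g) ^ 2) :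
    avgBox g + κ ≤ restrRatio g ∨ ∃ H : (ι → Bool) → (ι → A) → ℂ, (∀ R, nsq (H R) ≤ 1) ∧
      avgBox g + κ ≤ 𝔼 R, gain τ R (H R) g := by
  by_contra hcon
  push Not at hcon
  obtain ⟨hcon1, hcon2⟩ := hcon
  have hp0 : 0 < avgBox g := by linarith
  -- The supremum need not be attained; near-maximizers cost the second `κ`.
  have hs : 𝔼 R, topGain τ R g ≤ avgBox g + 2 * κ := by
    have : ∀ R, ∃ H : {H : (ι → A) → ℂ // nsq H ≤ 1}, topGain τ R g - κ < gain τ R H g :=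
      fun R => exists_lt_of_lt_ciSup (by unfold topGain; linarith)
    choose H hH using this
    have h1 := hcon2 (fun R => H R) (fun R => (H R).2)
    have h2 := expect_mono fun R => (hH R).le
    rw [expect_sub_distrib, Fintype.expect_const] at h2
    linarith
  let D : ∀ R, CutSVD R g := fun R => (nonempty_cutSVD R g).some
  have : ∀ R, ∃ m, ∀ j, (D R).l j ≤ (D R).l m := fun R => Finite.exists_max (D R).l
  choose m hm using this
  set L : (ι → Bool) → ℝ := fun R => (D R).l (m R) with hL
  have hsum : ∀ R, ∑ j, (D R).l j = 1 := fun R => by rw [(D R).sum_l, hg]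
  have hL1 : ∀ R, L R ≤ 1 := fun R => by
    rw [← hsum R]
    exact single_le_sum (f := (D R).l) (fun j _ => (D R).l_nonneg j) (mem_univ (m R))
  have hπL : ∀ R, box R g ≤ L R := fun R => by
    rw [← (D R).sum_l_sq]
    calc ∑ j, (D R).l j ^ 2 ≤ ∑ j, L R * (D R).l j := by
          refine sum_le_sum fun j _ => ?_
          rw [sq]; exact mul_le_mul_of_nonneg_right (hm R j) ((D R).l_nonneg j)
      _ = L R := by rw [← mul_sum, hsum, mul_one]
  have hL0 : ∀ R, 0 < L R := fun R => by
    rcases ((D R).l_nonneg (m R)).lt_or_eq with h | h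
    · exact h
    · exfalso
      have : ∑ j, (D R).l j ≤ 0 := sum_nonpos fun j _ => by rw [h]; exact hm R j
      rw [hsum] at this; linarith
  refine increment_contradiction (fun R => box R g) L (fun R => topGain τ R g) hp0 hg1 hκ hκg
    hτg (fun R => box_nonneg _ _) hπL hL1 (fun R => topGain_nonneg) (fun R => topGain_le_one)
    (expect_abs_box_sub_le g hg hcon1.le) hs ?_
    (fun R hR => (D R).topGain_mul_ge hg hτ hR (hm R))
  -- the top singular vectors
  have hsL : ∀ R, 0 < √(L R) := fun R => Real.sqrt_pos.2 (hL0 R)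
  set c : (ι → Bool) → ℂ := fun R => (((√(L R))⁻¹ : ℝ) : ℂ) with hc
  have nc2 : ∀ R, ‖c R‖ ^ 2 = (L R)⁻¹ := fun R => by
    rw [hc, Complex.norm_real, Real.norm_of_nonneg (inv_nonneg.2 (hsL R).le), inv_pow,
      Real.sq_sqrt (hL0 R).le]
  have nc : ∀ R, ‖c R‖ ^ 4 = (L R ^ 2)⁻¹ := fun R => by
    rw [show ‖c R‖ ^ 4 = (‖c R‖ ^ 2) ^ 2 by ring, nc2, inv_pow]
  set G : (ι → Bool) → (ι → A) → ℂ := fun R x => c R * (D R).G (m R) x with hG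
  set H : (ι → Bool) → (ι → A) → ℂ := fun R => (D R).H (m R) with hH
  have hmain := sq_expect_le_avgBox g hg G H
    (fun R x y => by simp only [hG]; rw [(D R).depOn_G (m R) x y])
    (fun R => (D R).depOn_H (hL0 R).ne')
  -- `G R` and `H R` are the top singular functions, both of mean square `1`, so this is the top
  -- singular value.
  have hcorr : ∀ R, 𝔼 x, g x * conj (G R x * H R x) = ((√(L R) : ℝ) : ℂ) := by
    intro R
    rw [← expect_mix R (fun x => g x * conj (G R x * H R x)), expect_expect_comm]
    calc _ = 𝔼 x, conj (c R) * ((D R).G (m R) x * conj ((D R).G (m R) x)) := by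
          refine expect_congr rfl fun x _ => ?_
          nth_rewrite 1 [(D R).G_eq]
          rw [expect_mul, mul_expect]
          refine expect_congr rfl fun z _ => ?_
          have e1 : (D R).G (m R) (mix R z x) = (D R).G (m R) x := by
            apply ((D R).depOn_G (m R)).eq
            intro i hi
            simp_all [mix]
          simp only [hG, hH, map_mul]
          rw [e1, (D R).depOn_H (hL0 R).ne']
          ring
      _ = _ := by
          rw [← mul_expect, (D R).orthoG]
          simp only [if_true, hc, Complex.conj_ofReal]
          rw [← Complex.ofReal_mul]
          congr 1
          rw [inv_mul_eq_div, div_eq_iff (hsL R).ne', Real.mul_self_sqrt (hL0 R).le]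
  have hlhs : ‖𝔼 S, 𝔼 x, g x * conj (G S x * H S x)‖ = 𝔼 R, √(L R) := by
    simp only [hcorr, ← ofReal_expect]
    rw [Complex.norm_real, Real.norm_of_nonneg (expect_nonneg' fun _ => Real.sqrt_nonneg _)]
  rw [hlhs] at hmain
  refine hmain.trans ?_
  have hGle : ∀ R, avgBox (G R) ≤ topGain τ R g + if τ ≤ L R then 0 else 1 := by
    intro R
    have h0 : avgBox (G R) = avgBox ((D R).G (m R)) / L R ^ 2 := by
      rw [hG, avgBox_const_mul, nc, inv_mul_eq_div]
    rw [h0]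
    split_ifs with h
    · have := avgBox_contract_le (g := g) (R := R) (H := fun z => conj ((D R).H (m R) z)) hτ
        (by rw [nsq_conj, (D R).nsq_H]) (by rw [(D R).contract_conj_H, (D R).nsq_G]; exact h)
      rw [(D R).contract_conj_H, (D R).nsq_G] at this
      rw [add_zero, div_le_iff₀ (by have := hL0 R; positivity)]
      exact this
    · have h1 := avgBox_le ((D R).G (m R))
      rw [(D R).nsq_G] at h1
      have : avgBox ((D R).G (m R)) / L R ^ 2 ≤ 1 := div_le_one_of_le₀ h1 (by positivity)
      have h2 : 0 ≤ topGain τ R g := topGain_nonneg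
      linarith
  -- Contracting `g` against `conj (G R)` across the complementary cut gives `√(L R) * H R`;
  -- complementation preserves the uniform law on cuts.
  have hHle : ∀ R, avgBox (H R) ≤ topGain τ (fun i => !R i) g + if τ ≤ L R then 0 else 1 := by
    intro R
    split_ifs with h
    · have hk : contract (fun i => !R i) (fun z => conj (G R z)) g
          = fun z => ((√(L R) : ℝ) : ℂ) * H R z := by
        have := (D R).contract_conj_G (m R)
        funext z
        have h1 := congrFun this z
        simp only [contract] at h1 ⊢
        calc _ = conj (c R) * 𝔼 z', conj ((D R).G (m R) z') * g (mix (fun i => !R i) z' z) := by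
              rw [mul_expect]
              refine expect_congr rfl fun z' _ => ?_
              simp only [hG, map_mul]; ring
          _ = _ := by
              rw [h1, ← mul_assoc]
              congr 1
              simp only [hc, Complex.conj_ofReal]
              rw [← Complex.ofReal_mul]
              congr 1
              rw [inv_mul_eq_div, div_eq_iff (hsL R).ne', Real.mul_self_sqrt (hL0 R).le]
      have n1 : ‖((√(L R) : ℝ) : ℂ)‖ ^ 2 = L R := by
        rw [Complex.norm_real, Real.norm_of_nonneg (hsL R).le, Real.sq_sqrt (hL0 R).le]
      have n2 : nsq (contract (fun i => !R i) (fun z => conj (G R z)) g) = L R := by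
        rw [hk, nsq_const_mul, n1, hH, (D R).nsq_H, mul_one]
      have := avgBox_contract_le (g := g) (R := fun i => !R i) (H := fun z => conj (G R z)) hτ
        (by
          rw [nsq_conj, hG, nsq_const_mul, nc2, (D R).nsq_G]
          exact (inv_mul_cancel₀ (hL0 R).ne').le) (by rw [n2]; exact h)
      rw [n2, hk, avgBox_const_mul, show ‖((√(L R) : ℝ) : ℂ)‖ ^ 4
        = (‖((√(L R) : ℝ) : ℂ)‖ ^ 2) ^ 2 by ring, n1, mul_comm] at this
      rw [add_zero]
      exact le_of_mul_le_mul_right this (by have := hL0 R; positivity)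
    · have h1 := avgBox_le (H R)
      rw [hH, (D R).nsq_H, one_pow] at h1
      have h2 : 0 ≤ topGain τ (fun i => !R i) g := topGain_nonneg
      linarith
  have hflip : 𝔼 R : ι → Bool, topGain τ (fun i => !R i) g = 𝔼 R : ι → Bool, topGain τ R g := by
    refine Fintype.expect_equiv (xorEquiv fun _ => true) _ _ fun R => ?_
    congr 1
    funext i
    simp [xorEquiv]
  calc 𝔼 S, (avgBox (G S) + avgBox (H S)) / 2
      ≤ 𝔼 S, ((topGain τ S g + if τ ≤ L S then 0 else 1)
          + (topGain τ (fun i => !S i) g + if τ ≤ L S then 0 else 1)) / 2 := by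
        refine expect_mono fun S => ?_
        have := hGle S
        have := hHle S
        linarith
    _ = _ := by
        simp only [← expect_div, expect_add_distrib, hflip]
        ring

end OneStep

/-! ### Product functions -/

section Product
variable {ι A : Type*} [Fintype ι] [DecidableEq ι] [Fintype A] [DecidableEq A] [Nonempty A]

theorem sum_prod_pi {K : Type*} [CommSemiring K] (f : ι → A → K) :
    ∑ u : ι → A, ∏ i, f i (u i) = ∏ i, ∑ a, f i a := by
  rw [prod_univ_sum, Fintype.piFinset_univ]

theorem expect_prod_pi {K : Type*} [Semifield K] [CharZero K] (f : ι → A → K) :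
    𝔼 u : ι → A, ∏ i, f i (u i) = ∏ i, 𝔼 a, f i a := by
  simp only [Fintype.expect_eq_sum_div_card]
  rw [sum_prod_pi, prod_div_distrib]
  simp

theorem nsq_prod (φ : ι → A → ℂ) :
    nsq (fun u : ι → A => ∏ i, φ i (u i)) = ∏ i, nsq (φ i) := by
  unfold nsq
  simp only [norm_prod, ← prod_pow]
  exact expect_prod_pi (fun i a => ‖φ i a‖ ^ 2)

/-- Extension of a unit vector to an orthonormal basis, in function form. -/
theorem exists_basis (φ : A → ℂ) (hφ : nsq φ = 1) (a₀ : A) :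
    ∃ b : A → A → ℂ, b a₀ = φ ∧
      (∀ a a', 𝔼 u, b a u * conj (b a' u) = if a = a' then 1 else 0) ∧
      ∀ u v, ∑ a, b a u * conj (b a v) = if u = v then (Fintype.card A : ℂ) else 0 := by
  have hN : (Fintype.card A : ℂ) ≠ 0 := by simp
  have hNr : (0 : ℝ) < Fintype.card A := by exact_mod_cast Fintype.card_pos
  obtain ⟨c, hc0, hc⟩ : ∃ c : ℝ, 0 < c ∧ c * c = Fintype.card A :=
    ⟨√(Fintype.card A), Real.sqrt_pos.2 hNr, Real.mul_self_sqrt hNr.le⟩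
  have hc' : (c : ℂ) * c = Fintype.card A := by rw [← Complex.ofReal_mul, hc]; simp
  have hcne : (c : ℂ) ≠ 0 := by exact_mod_cast hc0.ne'
  let v : A → EuclideanSpace ℂ A := fun _ => WithLp.toLp 2 fun u => φ u / c
  have hv : ‖v a₀‖ = 1 := by
    rw [EuclideanSpace.norm_eq, Real.sqrt_eq_one]
    have : ∀ u, ‖(v a₀) u‖ ^ 2 = ‖φ u‖ ^ 2 / (c * c) := by
      intro u
      simp only [v, norm_div, Complex.norm_real, Real.norm_of_nonneg hc0.le, div_pow, sq c]
    simp only [this]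
    rw [← sum_div, hc, ← hφ, nsq, Fintype.expect_eq_sum_div_card]
  have ho : Orthonormal ℂ (({a₀} : Set A).domRestrict v) := by
    constructor
    · rintro ⟨a, rfl⟩
      exact hv
    · rintro ⟨a, rfl⟩ ⟨a', rfl⟩ h
      exact absurd rfl h
  obtain ⟨b, hb⟩ := ho.exists_orthonormalBasis_extension_of_card_eq
    (by simp : Module.finrank ℂ (EuclideanSpace ℂ A) = Fintype.card A)
  have hb0 := hb a₀ rfl
  have o1 : ∀ a a', ∑ u, b a u * conj (b a' u) = if a = a' then 1 else 0 := by
    intro a a'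
    have := orthonormal_iff_ite.1 b.orthonormal a' a
    rw [PiLp.inner_apply] at this
    simp only [RCLike.inner_apply] at this
    rw [this]
    by_cases h : a = a' <;> simp [h, eq_comm]
  let B : Matrix A A ℂ := Matrix.of fun a u => b a u
  have hB : B * B.conjTranspose = 1 := by
    ext a a'
    rw [Matrix.mul_apply, Matrix.one_apply]
    exact o1 a a'
  have hB' : B.conjTranspose * B = 1 := mul_eq_one_comm.1 hB
  have o2 : ∀ u w, ∑ a, conj (b a w) * b a u = if w = u then 1 else 0 := by
    intro u w
    have := congrFun (congrFun hB' w) u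
    rw [Matrix.mul_apply, Matrix.one_apply] at this
    exact this
  refine ⟨fun a u => c * b a u, ?_, ?_, ?_⟩
  · funext u
    simp only [hb0, v]
    field_simp
  · intro a a'
    rw [expect_eq_sum_div, ← o1, div_eq_iff hN, sum_mul]
    refine sum_congr rfl fun u _ => ?_
    rw [← hc']
    simp only [map_mul, Complex.conj_ofReal]; ring
  · intro u w
    calc _ = (c * c : ℂ) * ∑ a, conj (b a w) * b a u := by
          rw [mul_sum]
          refine sum_congr rfl fun a _ => ?_
          simp only [map_mul, Complex.conj_ofReal]; ring
      _ = _ := by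
          rw [o2, hc']
          by_cases h : u = w <;> simp [h, eq_comm]

/-- Parseval's identity for a product of orthonormal bases. -/
theorem nsq_eq_sum_coeff (b : ι → A → A → ℂ)
    (hb : ∀ i u v, ∑ a, b i a u * conj (b i a v) = if u = v then (Fintype.card A : ℂ) else 0)
    (h : (ι → A) → ℂ) : nsq h = ∑ x : ι → A, ‖𝔼 u, h u * ∏ i, b i (x i) (u i)‖ ^ 2 := by
  apply Complex.ofReal_injective
  have hN : (Fintype.card (ι → A) : ℂ) ≠ 0 := by simp
  have hker : ∀ u v : ι → A, ∑ x : ι → A, (∏ i, b i (x i) (u i)) * conj (∏ i, b i (x i) (v i))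
      = if u = v then (Fintype.card (ι → A) : ℂ) else 0 := by
    intro u v
    simp only [map_prod, ← prod_mul_distrib]
    rw [sum_prod_pi (fun i a => b i a (u i) * conj (b i a (v i)))]
    simp only [hb, prod_ite_zero, mem_univ, true_implies, funext_iff]
    simp
  simp only [Complex.ofReal_sum, Complex.ofReal_pow, ← Complex.mul_conj', conj_expect,
    expect_mul_expect_eq]
  symm
  calc _ = 𝔼 u, 𝔼 v, h u * conj (h v) *
        ∑ x : ι → A, (∏ i, b i (x i) (u i)) * conj (∏ i, b i (x i) (v i)) := by
        rw [← expect_sum_comm]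
        refine expect_congr rfl fun u _ => ?_
        rw [← expect_sum_comm]
        refine expect_congr rfl fun v _ => ?_
        rw [mul_sum]
        refine sum_congr rfl fun x _ => ?_
        simp only [map_mul]; ring
    _ = 𝔼 u, h u * conj (h u) := by
        refine expect_congr rfl fun u _ => ?_
        simp only [hker, expect_eq_sum_div]
        rw [div_eq_iff hN]
        simp [mul_ite]
    _ = _ := by simp only [nsq, ofReal_expect, Complex.ofReal_pow, ← Complex.mul_conj']

/-- A maximizer among product functions in the unit balls. -/
theorem exists_max_prod (g : (ι → A) → ℂ) : ∃ φ : ι → A → ℂ, (∀ i, nsq (φ i) ≤ 1) ∧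
    ∀ ψ : ι → A → ℂ, (∀ i, nsq (ψ i) ≤ 1) →
      ‖𝔼 x, g x * ∏ i, ψ i (x i)‖ ≤ ‖𝔼 x, g x * ∏ i, φ i (x i)‖ := by
  set s : Set (ι → A → ℂ) := {φ | ∀ i, nsq (φ i) ≤ 1} with hs
  have hcl : IsClosed s := by
    simp only [hs, Set.ofPred_forall]
    refine isClosed_iInter fun i => isClosed_le ?_ continuous_const
    simp only [nsq, Fintype.expect_eq_sum_div_card]
    fun_prop
  have hbd : Bornology.IsBounded s := by
    rw [isBounded_iff_forall_norm_le]
    refine ⟨Fintype.card A, fun φ hφ => ?_⟩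
    have hN : (1 : ℝ) ≤ Fintype.card A := by exact_mod_cast Fintype.card_pos
    refine (pi_norm_le_iff_of_nonneg (by positivity)).2 fun i => ?_
    refine (pi_norm_le_iff_of_nonneg (by positivity)).2 fun a => ?_
    have h1 := hφ i
    rw [nsq, Fintype.expect_eq_sum_div_card, div_le_one (by linarith)] at h1
    have h2 : ‖φ i a‖ ^ 2 ≤ ∑ a, ‖φ i a‖ ^ 2 :=
      single_le_sum (f := fun a => ‖φ i a‖ ^ 2) (fun _ _ => by positivity) (mem_univ a)
    nlinarith [norm_nonneg (φ i a)]
  have hne : s.Nonempty := ⟨fun _ _ => 0, fun i => by simp [nsq]⟩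
  obtain ⟨φ, hφ, hmax⟩ := (Metric.isCompact_of_isClosed_isBounded hcl hbd).exists_isMaxOn hne
    (f := fun φ => ‖𝔼 x, g x * ∏ i, φ i (x i)‖) (by
      simp only [expect_eq_sum_div]
      fun_prop)
  exact ⟨φ, hφ, fun ψ hψ => hmax hψ⟩

/-- A positive maximum forces all factors to be nonzero, and rescaling them to mean square `1` can
only enlarge the correlation. -/
theorem exists_max_prod_unit (g : (ι → A) → ℂ)
    (hg : ∃ ψ : ι → A → ℂ, (∀ i, nsq (ψ i) ≤ 1) ∧ 0 < ‖𝔼 x, g x * ∏ i, ψ i (x i)‖) :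
    ∃ φ : ι → A → ℂ, (∀ i, nsq (φ i) = 1) ∧ ∀ ψ : ι → A → ℂ, (∀ i, nsq (ψ i) ≤ 1) →
      ‖𝔼 x, g x * ∏ i, ψ i (x i)‖ ≤ ‖𝔼 x, g x * ∏ i, φ i (x i)‖ := by
  obtain ⟨φ, hφ, hmax⟩ := exists_max_prod g
  obtain ⟨ψ, hψ, hpos⟩ := hg
  have hv := hpos.trans_le (hmax ψ hψ)
  have hne : ∀ i, 0 < nsq (φ i) := by
    intro i
    rcases (nsq_nonneg (φ i)).lt_or_eq with h | h
    · exact h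
    · exfalso
      have h0 : ∀ x : ι → A, ∏ j, φ j (x j) = 0 := fun x =>
        prod_eq_zero (mem_univ i) (nsq_eq_zero h.symm (x i))
      simp [h0] at hv
  set c : ι → ℂ := fun i => (((√(nsq (φ i)))⁻¹ : ℝ) : ℂ) with hc
  have nc : ∀ i, ‖c i‖ = (√(nsq (φ i)))⁻¹ := fun i => by
    rw [hc, Complex.norm_real, Real.norm_of_nonneg (by positivity)]
  refine ⟨fun i a => c i * φ i a, fun i => ?_, fun χ hχ => (hmax χ hχ).trans ?_⟩
  · rw [nsq_const_mul, nc, inv_pow, Real.sq_sqrt (hne i).le, inv_mul_cancel₀ (hne i).ne']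
  · have : 𝔼 x, g x * ∏ i, c i * φ i (x i) = (∏ i, c i) * 𝔼 x, g x * ∏ i, φ i (x i) := by
      rw [mul_expect]
      refine expect_congr rfl fun x _ => ?_
      rw [prod_mul_distrib]; ring
    rw [this, norm_mul, norm_prod]
    refine le_mul_of_one_le_left (norm_nonneg _) ?_
    have h1 : ∀ i ∈ (univ : Finset ι), 1 ≤ ‖c i‖ := fun i _ => by
      rw [nc]
      exact (one_le_inv₀ (Real.sqrt_pos.2 (hne i))).2 (Real.sqrt_le_one.2 (hφ i))
    simpa using prod_le_prod (fun _ _ => zero_le_one) h1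

end Product

/-! ### The gap in the correlation with product functions -/

section Gap
variable {ι A : Type*} [Fintype ι] [DecidableEq ι] [Fintype A] [DecidableEq A] [Nonempty A]

/-- The coefficient of `g` at a point of a product basis. -/
noncomputable def coeff (b : ι → A → A → ℂ) (g : (ι → A) → ℂ) (x : ι → A) : ℂ :=
  𝔼 u, g u * ∏ i, b i (x i) (u i)

/-- Subtract from the tensor square of `g` its image under the swap. Integrating the second variable
against the basis element at `z` contracts the norm, and Parseval in the first variable yields the
sum; a swap of variables becomes a swap of basis indices. -/
theorem sum_coeff_swap_le (b : ι → A → A → ℂ)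
    (hb : ∀ i u v, ∑ a, b i a u * conj (b i a v) = if u = v then (Fintype.card A : ℂ) else 0)
    (hn : ∀ i a, nsq (b i a) = 1) (g : (ι → A) → ℂ) (S : ι → Bool) (z : ι → A) :
    ∑ x, ‖coeff b g x * coeff b g z - coeff b g (mix S z x) * coeff b g (mix S x z)‖ ^ 2
      ≤ 2 * nsq g ^ 2 - 2 * box S g := by
  set B : (ι → A) → (ι → A) → ℂ := fun x u => ∏ i, b i (x i) (u i) with hB
  set k : (ι → A) → (ι → A) → ℂ := fun u v =>
    g u * g v - g (mix S v u) * g (mix S u v) with hk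
  set K : (ι → A) → ℂ := fun u => 𝔼 v, k u v * B z v with hK
  have hBz : nsq (B z) = 1 := by
    have := nsq_prod (fun i => b i (z i))
    simp only [hn, prod_const_one] at this
    exact this
  have hKle : nsq K ≤ 2 * nsq g ^ 2 - 2 * box S g := by
    rw [← nsq_tensorSq_sub_swap]
    calc nsq K ≤ 𝔼 u, 𝔼 v, ‖k u v‖ ^ 2 := by
          refine expect_mono fun u => ?_
          refine (norm_sq_expect_mul_le _ _).trans_eq ?_
          rw [show (𝔼 v, ‖B z v‖ ^ 2) = 1 from hBz, mul_one]
      _ = _ := by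
          rw [nsq, expect_prod_eq]
          rfl
  rw [nsq_eq_sum_coeff b hb K] at hKle
  refine le_of_eq_of_le (sum_congr rfl fun x _ => ?_) hKle
  congr 2
  have e1 : 𝔼 u, K u * B x u = 𝔼 u, 𝔼 v, g u * g v * (B x u * B z v)
      - 𝔼 u, 𝔼 v, g (mix S v u) * g (mix S u v) * (B x u * B z v) := by
    simp only [hK, hk, expect_mul, ← expect_sub_distrib]
    refine expect_congr rfl fun u _ => expect_congr rfl fun v _ => ?_
    ring
  have e2 : 𝔼 u, 𝔼 v, g (mix S v u) * g (mix S u v) * (B x u * B z v)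
      = 𝔼 u, 𝔼 v, g u * g v * (B (mix S z x) u * B (mix S x z) v) := by
    rw [← expect_mix_mix S (fun u v => g u * g v * (B (mix S z x) u * B (mix S x z) v)),
      expect_expect_comm]
    refine expect_congr rfl fun v _ => expect_congr rfl fun u _ => ?_
    congr 1
    simp only [hB, ← prod_mul_distrib]
    refine prod_congr rfl fun i _ => ?_
    by_cases h : S i <;> simp [mix, h, mul_comm]
  have e3 : ∀ x y, 𝔼 u, 𝔼 v, g u * g v * (B x u * B y v) = coeff b g x * coeff b g y := by
    intro x y
    rw [coeff, coeff, expect_mul_expect_eq]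
    refine expect_congr rfl fun u _ => expect_congr rfl fun v _ => ?_
    simp only [hB]; ring
  change _ = 𝔼 u, K u * B x u
  rw [e1, e2, e3, e3]

/-- At a maximizer the coefficients at points differing in one coordinate vanish. -/
theorem coeff_update_eq_zero (b : ι → A → A → ℂ)
    (hb : ∀ i a a', 𝔼 u, b i a u * conj (b i a' u) = if a = a' then 1 else 0)
    (hn : ∀ i a, nsq (b i a) = 1) (g : (ι → A) → ℂ) (z : ι → A)
    (hmax : ∀ ψ : ι → A → ℂ, (∀ i, nsq (ψ i) ≤ 1) →
      ‖𝔼 x, g x * ∏ i, ψ i (x i)‖ ≤ ‖coeff b g z‖) (i : ι) (a : A) (ha : a ≠ z i) :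
    coeff b g (Function.update z i a) = 0 := by
  set c := coeff b g z with hc
  set d := coeff b g (Function.update z i a) with hd
  by_contra hd0
  set n : ℝ := √(‖c‖ ^ 2 + ‖d‖ ^ 2) with hnn
  have hdp : 0 < ‖d‖ := norm_pos_iff.2 hd0
  have hn0 : 0 < n := Real.sqrt_pos.2 (by positivity)
  have hn2 : n ^ 2 = ‖c‖ ^ 2 + ‖d‖ ^ 2 := Real.sq_sqrt (by positivity)
  have hnC : (n : ℂ) ≠ 0 := by exact_mod_cast hn0.ne'
  -- If `d ≠ 0`, replacing the factor at `i` by this unit combination of two basis vectors would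
  -- raise the correlation to `√(‖c‖² + ‖d‖²) > ‖c‖`.
  set s : ℂ := conj c / n with hs
  set t : ℂ := conj d / n with ht
  have hst : ‖s‖ ^ 2 + ‖t‖ ^ 2 = 1 := by
    rw [hs, ht, norm_div, norm_div, RCLike.norm_conj, RCLike.norm_conj, Complex.norm_real,
      Real.norm_of_nonneg hn0.le, div_pow, div_pow, ← add_div, ← hn2, div_self (by positivity)]
  set χ : A → ℂ := fun u => s * b i (z i) u + t * b i a u with hχ
  set ψ : ι → A → ℂ := Function.update (fun j => b j (z j)) i χ with hψ
  have hχn : nsq χ = 1 := by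
    have h1 : nsq χ = ‖s‖ ^ 2 + ‖t‖ ^ 2 := by
      have := nsq_sub_eq (fun u => s * b i (z i) u) (fun u => -(t * b i a u))
      simp only [sub_neg_eq_add] at this
      rw [hχ, this]
      have h2 : nsq (fun u => -(t * b i a u)) = ‖t‖ ^ 2 := by
        simp only [← neg_mul]
        rw [nsq_const_mul, hn, norm_neg, mul_one]
      have h3 : 𝔼 u, s * b i (z i) u * conj (-(t * b i a u)) = 0 := by
        calc _ = -(s * conj t) * 𝔼 u, b i (z i) u * conj (b i a u) := by
              rw [mul_expect]
              refine expect_congr rfl fun u _ => ?_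
              simp only [map_neg, map_mul]; ring
          _ = 0 := by rw [hb, if_neg ha.symm, mul_zero]
      rw [h2, h3, nsq_const_mul, hn]; simp
    rw [h1, hst]
  have hψn : ∀ j, nsq (ψ j) ≤ 1 := by
    intro j
    by_cases hj : j = i
    · subst hj; simp [hψ, hχn]
    · simp [hψ, hj, hn]
  have hval : 𝔼 x, g x * ∏ j, ψ j (x j) = s * c + t * d := by
    rw [hc, hd, coeff, coeff, mul_expect, mul_expect, ← expect_add_distrib]
    refine expect_congr rfl fun x _ => ?_
    rw [Fintype.prod_eq_mul_prod_compl i (fun j => ψ j (x j)),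
      Fintype.prod_eq_mul_prod_compl i (fun j => b j (z j) (x j)),
      Fintype.prod_eq_mul_prod_compl i (fun j => b j (Function.update z i a j) (x j))]
    have h1 : ∏ j ∈ ({i} : Finset ι)ᶜ, ψ j (x j) = ∏ j ∈ ({i} : Finset ι)ᶜ, b j (z j) (x j) := by
      refine prod_congr rfl fun j hj => ?_
      have : j ≠ i := by simpa using hj
      simp [hψ, this]
    have h2 : ∏ j ∈ ({i} : Finset ι)ᶜ, b j (Function.update z i a j) (x j)
        = ∏ j ∈ ({i} : Finset ι)ᶜ, b j (z j) (x j) := by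
      refine prod_congr rfl fun j hj => ?_
      have : j ≠ i := by simpa using hj
      simp [this]
    rw [h1, h2]
    simp only [hψ, Function.update_self, hχ]
    ring
  have hval2 : s * c + t * d = n := by
    rw [hs, ht, div_mul_eq_mul_div, div_mul_eq_mul_div, ← add_div, div_eq_iff hnC,
      Complex.conj_mul', Complex.conj_mul', ← sq]
    exact_mod_cast hn2.symm
  have := hmax ψ hψn
  rw [hval, hval2, Complex.norm_real, Real.norm_of_nonneg hn0.le] at this
  nlinarith [norm_nonneg c]

/-- The event forces both `i` and `j` to lie in `S`. -/
theorem expect_mix_eq_le (x z : ι → A) {i j : ι} (hij : i ≠ j) (hi : x i ≠ z i) (hj : x j ≠ z j) :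
    𝔼 S : ι → Bool, (if mix S x z = x then (1 : ℝ) else 0) ≤ 1 / 4 := by
  set f : ι → Bool → ℝ := fun k b => if k = i ∨ k = j then (if b then 1 else 0) else 1 with hf
  have h1 : ∀ S : ι → Bool, (if mix S x z = x then (1 : ℝ) else 0) ≤ ∏ k, f k (S k) := by
    intro S
    split_ifs with h
    · have hs : ∀ k, x k ≠ z k → S k = true := by
        intro k hk
        by_contra hS
        have := congrFun h k
        simp [mix, hS] at this
        exact hk this.symm
      have : ∀ k, f k (S k) = 1 := by
        intro k
        by_cases hk : k = i ∨ k = j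
        · have : S k = true := by
            rcases hk with rfl | rfl
            · exact hs _ hi
            · exact hs _ hj
          simp [hf, this]
        · simp [hf, hk]
      simp [this]
    · refine prod_nonneg fun k _ => ?_
      simp only [hf]
      split_ifs <;> norm_num
  refine (expect_mono h1).trans_eq ?_
  rw [expect_prod_pi]
  have h2 : ∀ k, 𝔼 b, f k b = if k ∈ ({i, j} : Finset ι) then (1 / 2 : ℝ) else 1 := by
    intro k
    by_cases hk : k = i ∨ k = j
    · simp [hf, hk]
    · simp [hf, hk]
  simp only [h2]
  rw [prod_ite_mem, univ_inter, prod_const, card_pair hij]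
  norm_num

set_option maxHeartbeats 1000000 in
/-- The inequality for coefficients behind the gap theorem. -/
theorem gap_of_coeff (F : (ι → A) → ℂ) (z : ι → A) (hsum : ∑ x, ‖F x‖ ^ 2 = 1)
    (d : (ι → Bool) → ℝ)
    (hd : ∀ S, ∑ x, ‖F x * F z - F (mix S z x) * F (mix S x z)‖ ^ 2 ≤ d S)
    (h1 : ∀ i a, a ≠ z i → F (Function.update z i a) = 0) :
    ‖F z‖ ^ 2 * ((1 - ‖F z‖ ^ 2) / 2) ≤ 2 * 𝔼 S, d S + (1 - ‖F z‖ ^ 2) ^ 2 / 4 := by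
  set c := ‖F z‖ ^ 2 with hc
  set ε := 1 - c with hε
  -- The mass away from `z` is divided according to whether `x` differs from `z` only inside `S`
  -- (`al`), only outside `S` (`be`), or on both sides (`v3`).
  set al : (ι → Bool) → ℝ := fun S =>
    ∑ x, if mix S x z = x ∧ x ≠ z then ‖F x‖ ^ 2 else 0 with hal
  set be : (ι → Bool) → ℝ := fun S =>
    ∑ x, if mix S z x = x ∧ x ≠ z then ‖F x‖ ^ 2 else 0 with hbe
  set v3 : (ι → Bool) → ℝ := fun S =>
    ∑ x, if mix S x z ≠ x ∧ mix S z x ≠ x then ‖F x‖ ^ 2 else 0 with hv3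
  have al0 : ∀ S, 0 ≤ al S := fun S => sum_nonneg fun x _ => by split_ifs <;> positivity
  have be0 : ∀ S, 0 ≤ be S := fun S => sum_nonneg fun x _ => by split_ifs <;> positivity
  have v30 : ∀ S, 0 ≤ v3 S := fun S => sum_nonneg fun x _ => by split_ifs <;> positivity
  have both : ∀ S x, mix S x z = x → mix S z x = x → x = z := by
    intro S x h2 h3
    funext i
    by_cases h : S i
    · have := congrFun h3 i; simpa [mix, h, eq_comm] using this
    · have := congrFun h2 i; simpa [mix, h, eq_comm] using this
  have part : ∀ S, al S + be S + v3 S = ε := by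
    intro S
    have e1 : ∑ x, (if x = z then ‖F x‖ ^ 2 else 0) = c := by simp [hc]
    have : al S + be S + v3 S + ∑ x, (if x = z then ‖F x‖ ^ 2 else 0) = 1 := by
      rw [hal, hbe, hv3, ← sum_add_distrib, ← sum_add_distrib, ← sum_add_distrib, ← hsum]
      refine sum_congr rfl fun x _ => ?_
      by_cases hz : x = z
      · subst hz; simp [mix_self]
      · by_cases h2 : mix S x z = x
        · have h3 : mix S z x ≠ x := fun h3 => hz (both S x h2 h3)
          simp [hz, h2, h3]
        · by_cases h3 : mix S z x = x <;> simp [hz, h2, h3]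
    linarith
  -- A point of the third kind is determined by its two mixtures with `z`, which are points of the
  -- first and second kind.
  have prod_le : ∀ S, ∑ x, (if mix S x z ≠ x ∧ mix S z x ≠ x then
      ‖F (mix S z x) * F (mix S x z)‖ ^ 2 else 0) ≤ al S * be S := by
    intro S
    have e1 : al S * be S = ∑ p ∈ univ.filter (fun x => mix S x z = x ∧ x ≠ z) ×ˢ
        univ.filter (fun x => mix S z x = x ∧ x ≠ z), ‖F p.1‖ ^ 2 * ‖F p.2‖ ^ 2 := by
      rw [sum_product, hal, hbe]
      simp only [← sum_filter]
      rw [sum_mul_sum]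
    rw [← sum_filter, e1]
    set V := univ.filter (fun x : ι → A => mix S x z ≠ x ∧ mix S z x ≠ x) with hV
    have inj : Set.InjOn (fun x : ι → A => (mix S x z, mix S z x)) V := by
      intro x _ y _ hxy
      have h2 := congrArg Prod.fst hxy
      have h3 := congrArg Prod.snd hxy
      funext i
      by_cases h : S i
      · have := congrFun h2 i; simpa [mix, h] using this
      · have := congrFun h3 i; simpa [mix, h] using this
    calc _ = ∑ p ∈ V.image (fun x : ι → A => (mix S x z, mix S z x)),
          ‖F p.1‖ ^ 2 * ‖F p.2‖ ^ 2 := by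
          rw [sum_image inj]
          refine sum_congr rfl fun x _ => ?_
          rw [norm_mul, mul_pow, mul_comm]
      _ ≤ _ := by
          refine sum_le_sum_of_subset_of_nonneg ?_ fun p _ _ => by positivity
          intro p hp
          obtain ⟨x, hx, rfl⟩ := mem_image.1 hp
          obtain ⟨hx1, hx2⟩ := (mem_filter.1 hx).2
          simp only [mem_product, mem_filter, mem_univ, true_and]
          refine ⟨⟨mix_mix_left _ _ _ _, fun h => hx2 ?_⟩, mix_mix_right _ _ _ _, fun h => hx1 ?_⟩
          · funext i
            have := congrFun h i
            by_cases hi : S i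
            · simp only [mix, hi, if_true] at this ⊢; exact this.symm
            · simp [mix, hi]
          · funext i
            have := congrFun h i
            by_cases hi : S i
            · simp [mix, hi]
            · simp only [mix, hi] at this ⊢; exact this.symm
  have hS : ∀ S, c * v3 S ≤ 2 * d S + 2 * (al S * be S) := by
    intro S
    have : c * v3 S ≤ 2 * ∑ x, ‖F x * F z - F (mix S z x) * F (mix S x z)‖ ^ 2
        + 2 * ∑ x, (if mix S x z ≠ x ∧ mix S z x ≠ x then
          ‖F (mix S z x) * F (mix S x z)‖ ^ 2 else 0) := by
      rw [hv3, mul_sum, mul_sum, mul_sum, ← sum_add_distrib]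
      refine sum_le_sum fun x _ => ?_
      split_ifs with h
      · have h5 : c * ‖F x‖ ^ 2 = ‖F x * F z‖ ^ 2 := by rw [norm_mul, mul_pow, mul_comm]
        rw [h5]
        have h6 := norm_add_le (F x * F z - F (mix S z x) * F (mix S x z))
          (F (mix S z x) * F (mix S x z))
        rw [sub_add_cancel] at h6
        nlinarith [sq_nonneg (‖F x * F z - F (mix S z x) * F (mix S x z)‖
          - ‖F (mix S z x) * F (mix S x z)‖), norm_nonneg (F x * F z)]
      · rw [mul_zero, mul_zero, add_zero]; positivity
    have h2 := hd S
    have h3 := prod_le S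
    linarith
  -- A point at distance at least two from `z` differs from it only inside `S` with probability at
  -- most `1/4`; at distance one the coefficient vanishes by `h1`.
  have hal4 : 𝔼 S, al S ≤ ε / 4 := by
    have e1 : 𝔼 S, al S = ∑ x, (if x ≠ z then ‖F x‖ ^ 2 else 0) *
        𝔼 S : ι → Bool, (if mix S x z = x then (1 : ℝ) else 0) := by
      rw [hal, Finset.expect_sum_comm]
      refine sum_congr rfl fun x _ => ?_
      rw [mul_expect]
      refine expect_congr rfl fun S _ => ?_
      by_cases h2 : mix S x z = x <;> simp [h2]
    have e2 : ε = ∑ x, if x ≠ z then ‖F x‖ ^ 2 else 0 := by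
      have : ∑ x, (if x = z then ‖F x‖ ^ 2 else 0) = c := by simp [hc]
      rw [hε, ← hsum, ← this, ← sum_sub_distrib]
      refine sum_congr rfl fun x _ => ?_
      by_cases h : x = z <;> simp [h]
    rw [e1, e2, sum_div]
    refine sum_le_sum fun x _ => ?_
    split_ifs with hx
    · obtain ⟨i, hi⟩ := Function.ne_iff.1 hx
      by_cases hj : ∃ j, i ≠ j ∧ x j ≠ z j
      · obtain ⟨j, hij, hj⟩ := hj
        have := expect_mix_eq_le x z hij hi hj
        have h0 : 0 ≤ ‖F x‖ ^ 2 := by positivity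
        nlinarith
      · push Not at hj
        have : x = Function.update z i (x i) := by
          funext k
          by_cases hk : k = i
          · subst hk; simp
          · simp [hk, hj k (Ne.symm hk)]
        have h0 : F x = 0 := by rw [this]; exact h1 i _ hi
        simp [h0]
    · simp
  have hbe4 : 𝔼 S, be S ≤ ε / 4 := by
    refine le_of_eq_of_le ?_ hal4
    refine Fintype.expect_equiv (xorEquiv fun _ => true) _ _ fun S => ?_
    have : ∀ x, mix (xorEquiv (fun _ => true) S) x z = mix S z x := by
      intro x
      rw [← mix_not]
      congr 1
      funext i
      simp [xorEquiv]
    simp only [hal, hbe, this]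
  have hε0 : 0 ≤ ε := by
    rw [← part (fun _ => true)]
    exact add_nonneg (add_nonneg (al0 _) (be0 _)) (v30 _)
  have hc0 : 0 ≤ c := by positivity
  have hS2 : ∀ S, c * (ε - al S - be S) ≤ 2 * d S + ε / 2 * (al S + be S) := by
    intro S
    have h2 := hS S
    have h3 := part S
    have h4 : v3 S = ε - al S - be S := by linarith
    rw [h4] at h2
    have h5 : al S + be S ≤ ε := by have := v30 S; linarith
    nlinarith [sq_nonneg (al S - be S), al0 S, be0 S]
  have h2 := expect_mono hS2
  simp only [expect_add_distrib, ← mul_expect, expect_sub_distrib, Fintype.expect_const] at h2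
  nlinarith

/-- If the best product function has correlation at least `3/4` in square, then the missing part is
controlled by the average box functional. -/
theorem gap (g : (ι → A) → ℂ) (hg : nsq g = 1) (φ : ι → A → ℂ) (hφ : ∀ i, nsq (φ i) = 1)
    (hmax : ∀ ψ : ι → A → ℂ, (∀ i, nsq (ψ i) ≤ 1) →
      ‖𝔼 x, g x * ∏ i, ψ i (x i)‖ ≤ ‖𝔼 x, g x * ∏ i, φ i (x i)‖)
    (hw : 3 / 4 ≤ ‖𝔼 x, g x * ∏ i, φ i (x i)‖ ^ 2) :
    1 - ‖𝔼 x, g x * ∏ i, φ i (x i)‖ ^ 2 ≤ 13 * (1 - avgBox g) := by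
  obtain ⟨a₀⟩ := ‹Nonempty A›
  have : Nonempty A := ⟨a₀⟩
  have := fun i => exists_basis (φ i) (hφ i) a₀
  choose b hb0 hborth hbrow using this
  have hn : ∀ i a, nsq (b i a) = 1 := by
    intro i a
    apply Complex.ofReal_injective
    have := hborth i a a
    simp only [if_true] at this
    rw [Complex.ofReal_one, ← this]
    simp only [nsq, ofReal_expect, Complex.ofReal_pow, ← Complex.mul_conj']
  have hz : coeff b g (fun _ => a₀) = 𝔼 x, g x * ∏ i, φ i (x i) := by
    simp only [coeff, hb0]
  have hsum : ∑ x, ‖coeff b g x‖ ^ 2 = 1 := by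
    rw [← hg, nsq_eq_sum_coeff b hbrow g]; rfl
  rw [← hz] at hmax hw ⊢
  have key := gap_of_coeff (coeff b g) (fun _ => a₀) hsum (fun S => 2 * nsq g ^ 2 - 2 * box S g)
    (fun S => sum_coeff_swap_le b hbrow hn g S _)
    (coeff_update_eq_zero b hborth hn g _ hmax)
  have e : 𝔼 S, (2 * nsq g ^ 2 - 2 * box S g) = 2 - 2 * avgBox g := by
    rw [expect_sub_distrib, Fintype.expect_const, ← mul_expect, hg, avgBox]; norm_num
  rw [e] at key
  set w := ‖coeff b g fun _ => a₀‖ ^ 2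
  have hw1 : w ≤ 1 := by
    rw [← hsum]
    exact single_le_sum (f := fun x => ‖coeff b g x‖ ^ 2) (fun _ _ => by positivity) (mem_univ _)
  -- With `w ≥ 3/4`, the inequality `key` yields `(5/16)(1 - w) ≤ 4(1 - avgBox g)`, and `64/5 ≤ 13`.
  nlinarith

end Gap

/-! ### Functions with nearly maximal box functional -/

section Blocks
variable {ι A : Type*} [Fintype ι] [DecidableEq ι] [Fintype A] [DecidableEq A]

/-- The block of a coordinate: its own for coordinates in `K`, a common one for the others. -/
def blk (K : ι → Bool) (i : ι) : Option ι := if K i then some i else none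

/-- The point of `ι → A` read off from the relevant coordinates of the blocks. -/
def pick (K : ι → Bool) (X : Option ι → ι → A) : ι → A := fun i => X (blk K i) i

/-- The coordinates in the block `o`. -/
def rel (K : ι → Bool) (o : Option ι) : ι → Bool := fun i => decide (blk K i = o)

variable [Nonempty A]

/-- Each block carries a full point of `ι → A`, of which only the coordinates of that block are
read. Exchanging these with an independent point is an involution. -/
theorem expect_pick (K : ι → Bool) {M : Type*} [AddCommMonoid M] [Module ℚ≥0 M]
    (f : (ι → A) → M) : 𝔼 X, f (pick K X) = 𝔼 x, f x := by
  let e : (ι → A) × (Option ι → ι → A) ≃ (ι → A) × (Option ι → ι → A) :=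
    { toFun := fun p => (pick K p.2, fun o i => if blk K i = o then p.1 i else p.2 o i)
      invFun := fun p => (pick K p.2, fun o i => if blk K i = o then p.1 i else p.2 o i)
      left_inv := fun p => by
        refine Prod.ext ?_ ?_
        · funext i; simp [pick]
        · funext o i
          by_cases h : blk K i = o
          · subst h; simp [pick]
          · simp [h]
      right_inv := fun p => by
        refine Prod.ext ?_ ?_
        · funext i; simp [pick]
        · funext o i
          by_cases h : blk K i = o
          · subst h; simp [pick]
          · simp [h] }
  have h := Fintype.expect_equiv e (fun p => f (pick K p.2)) (fun p => f p.1) (fun p => rfl)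
  rw [expect_prod_eq, expect_prod_eq] at h
  simpa only [Fintype.expect_const] using h

theorem expect_mix_blocks {O : Type*} [Fintype O] [DecidableEq O] (r : O → ι → Bool)
    {M : Type*} [AddCommMonoid M] [Module ℚ≥0 M] (G : (O → ι → A) → M) :
    𝔼 X : O → ι → A, 𝔼 Y : O → ι → A, G (fun o => mix (r o) (X o) (Y o)) = 𝔼 X, G X := by
  let e : (O → ι → A) × (O → ι → A) ≃ (O → ι → A) × (O → ι → A) :=
    { toFun := fun p => (fun o => mix (r o) (p.1 o) (p.2 o), fun o => mix (r o) (p.2 o) (p.1 o))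
      invFun := fun p => (fun o => mix (r o) (p.1 o) (p.2 o), fun o => mix (r o) (p.2 o) (p.1 o))
      left_inv := fun p => by
        simp only [mix_mix_left, mix_mix_right, mix_self]
      right_inv := fun p => by
        simp only [mix_mix_left, mix_mix_right, mix_self] }
  have h := Fintype.expect_equiv e (fun p => G (fun o => mix (r o) (p.1 o) (p.2 o)))
    (fun p => G p.1) (fun p => rfl)
  rw [expect_prod_eq, expect_prod_eq] at h
  simpa only [Fintype.expect_const] using h

theorem pick_mix (K : ι → Bool) (S : Option ι → Bool) (X Y : Option ι → ι → A) :
    pick K (mix S X Y) = mix (fun i => S (blk K i)) (pick K X) (pick K Y) := by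
  funext i
  by_cases h : S (blk K i) <;> simp [pick, mix, h]

theorem box_pick (K : ι → Bool) (S : Option ι → Bool) (g : (ι → A) → ℂ) :
    box S (fun X : Option ι → ι → A => g (pick K X)) = box (fun i => S (blk K i)) g := by
  unfold box bx
  simp only [pick_mix]
  rw [expect_pick K (fun y => 𝔼 y' : Option ι → ι → A,
    ‖𝔼 x : Option ι → ι → A, g (mix (fun i => S (blk K i)) (pick K x) y) *
      conj (g (mix (fun i => S (blk K i)) (pick K x) (pick K y')))‖ ^ 2)]
  refine expect_congr rfl fun y _ => ?_
  rw [expect_pick K (fun y' => ‖𝔼 x : Option ι → ι → A,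
    g (mix (fun i => S (blk K i)) (pick K x) y) *
      conj (g (mix (fun i => S (blk K i)) (pick K x) y'))‖ ^ 2)]
  refine expect_congr rfl fun y' _ => ?_
  rw [expect_pick K (fun x => g (mix (fun i => S (blk K i)) x y) *
      conj (g (mix (fun i => S (blk K i)) x y')))]

/-- A random cut of the blocks first decides the side of the common block. The induced cut of the
coordinates is then `S ∩ K` or `S ∪ Kᶜ`, and both families have at least the unrestricted average.
-/
theorem avgBox_le_avgBox_pick (K : ι → Bool) (g : (ι → A) → ℂ) :
    avgBox g ≤ avgBox (fun X : Option ι → ι → A => g (pick K X)) := by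
  unfold avgBox
  simp only [box_pick]
  rw [Fintype.expect_equiv (Equiv.piOptionEquivProd (β := fun _ : Option ι => Bool))
    (fun S => box (fun i => S (blk K i)) g)
    (fun p => box (fun i => if K i then p.2 i else p.1) g) (fun S => by
      congr 1
      funext i
      by_cases h : K i <;> simp [blk, h, Equiv.piOptionEquivProd]), expect_prod_eq]
  rw [← Fintype.expect_const (ι := Bool) (𝔼 S : ι → Bool, box S g)]
  refine expect_mono fun b => ?_
  cases b
  · refine (avgBox_le_expect_box_and K g).trans_eq ?_
    refine expect_congr rfl fun S _ => ?_
    congr 1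
    funext i
    by_cases h : K i <;> simp [h]
  · refine (avgBox_le_expect_box_or (fun i => !K i) g).trans_eq ?_
    refine expect_congr rfl fun S _ => ?_
    congr 1
    funext i
    by_cases h : K i <;> simp [h]

theorem DepOn.pick_eq {K : ι → Bool} {o : Option ι} {Φ : (ι → A) → ℂ} (h : DepOn (rel K o) Φ)
    (X : Option ι → ι → A) : Φ (pick K X) = Φ (X o) := by
  apply h.eq
  intro i hi
  have : blk K i = o := by simpa [rel] using hi
  simp [pick, this]

theorem expect_pick_prod (K : ι → Bool) (g : (ι → A) → ℂ) (Φ : Option ι → (ι → A) → ℂ)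
    (hΦ : ∀ o, DepOn (rel K o) (Φ o)) :
    𝔼 X : Option ι → ι → A, g (pick K X) * ∏ o, Φ o (X o) = 𝔼 x, g x * ∏ o, Φ o x := by
  rw [← expect_pick K (fun x => g x * ∏ o, Φ o x)]
  simp only [(hΦ _).pick_eq]

theorem nsq_prod_blocks (K : ι → Bool) (Φ : Option ι → (ι → A) → ℂ)
    (hΦ : ∀ o, DepOn (rel K o) (Φ o)) : nsq (fun x => ∏ o, Φ o x) = ∏ o, nsq (Φ o) := by
  rw [← nsq_prod, nsq, nsq, ← expect_pick K]
  simp only [(hΦ _).pick_eq]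

/-- Averaging a product over irrelevant coordinates. -/
theorem exists_depOn_blocks (K : ι → Bool) (g : (ι → A) → ℂ) (Ψ : Option ι → (ι → A) → ℂ)
    (hΨ : ∀ o, nsq (Ψ o) ≤ 1) : ∃ Φ : Option ι → (ι → A) → ℂ, (∀ o, DepOn (rel K o) (Φ o)) ∧
      (∀ o, nsq (Φ o) ≤ 1) ∧
      𝔼 X : Option ι → ι → A, g (pick K X) * ∏ o, Ψ o (X o) = 𝔼 x, g x * ∏ o, Φ o x := by
  set Φ : Option ι → (ι → A) → ℂ := fun o x => 𝔼 y, Ψ o (mix (rel K o) x y) with hΦ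
  have hdep : ∀ o, DepOn (rel K o) (Φ o) := by
    intro o x y
    simp only [hΦ, mix_mix_left]
  refine ⟨Φ, hdep, fun o => ?_, ?_⟩
  · refine le_trans ?_ (hΨ o)
    rw [← expect_nsq_mix (rel K o) (Ψ o)]
    exact expect_mono fun x => norm_sq_expect_le _
  · rw [← expect_pick_prod K g Φ hdep, ← expect_mix_blocks (rel K)]
    refine expect_congr rfl fun X _ => ?_
    rw [← expect_prod_pi (fun o y => Ψ o (mix (rel K o) (X o) y)), mul_expect]
    refine expect_congr rfl fun Y _ => ?_
    congr 2
    funext i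
    simp [pick, mix, rel]

theorem nsq_contract_le (R : ι → Bool) (H g : (ι → A) → ℂ) :
    nsq (contract R H g) ≤ nsq H * nsq g := by
  calc nsq (contract R H g) ≤ 𝔼 x, nsq H * 𝔼 z, ‖g (mix R z x)‖ ^ 2 :=
        expect_mono fun x => norm_sq_expect_mul_le _ _
    _ = _ := by rw [← mul_expect, expect_expect_comm, expect_nsq_mix]

theorem depOn_of_subset {S T : ι → Bool} {Φ : (ι → A) → ℂ} (h : DepOn S Φ)
    (hST : ∀ i, S i → T i) : DepOn T Φ := by
  intro x y
  apply h.eq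
  intro i hi
  simp [mix, hST i hi]

/-- Across the cut `{i₀}` the function `g` is close to its top rank-one part. Testing that part
against the old product equals testing `g` against a new one: the factor of the common block is
integrated against the singular vector at `i₀`, and that vector becomes the factor of the new block.
-/
theorem split_block (K : ι → Bool) (i₀ : ι) (hi₀ : K i₀ = false) (g : (ι → A) → ℂ)
    (hg : nsq g = 1) {γ : ℝ} (hγ : γ < 1 / 2)
    (hbox : 1 - 2 * γ ≤ box (fun i => decide (i = i₀)) g)
    (Φ : Option ι → (ι → A) → ℂ) (hΦ : ∀ o, DepOn (rel K o) (Φ o)) (hn : ∀ o, nsq (Φ o) ≤ 1) :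
    ∃ Φ' : Option ι → (ι → A) → ℂ, (∀ o, DepOn (rel (Function.update K i₀ true) o) (Φ' o)) ∧
      (∀ o, nsq (Φ' o) ≤ 1) ∧
      ‖𝔼 x, g x * ∏ o, Φ o x‖ - √(2 * γ) ≤ ‖𝔼 x, g x * ∏ o, Φ' o x‖ := by
  set R : ι → Bool := fun i => decide (i = i₀) with hR
  obtain ⟨D⟩ := nonempty_cutSVD R g
  obtain ⟨m, hm⟩ := Finite.exists_max D.l
  have hsum : ∑ j, D.l j = 1 := by rw [D.sum_l, hg]
  have hπL : 1 - 2 * γ ≤ D.l m := by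
    refine hbox.trans ?_
    rw [← D.sum_l_sq]
    calc ∑ j, D.l j ^ 2 ≤ ∑ j, D.l m * D.l j := by
          refine sum_le_sum fun j _ => ?_
          rw [sq]; exact mul_le_mul_of_nonneg_right (hm j) (D.l_nonneg j)
      _ = D.l m := by rw [← mul_sum, hsum, mul_one]
  have hHdep : DepOn R (D.H m) := D.depOn_H (by linarith)
  set Q : (ι → A) → ℂ := fun x => ∏ i, Φ (some i) x with hQ
  have hblk : ∀ i, blk K i₀ ≠ some i := by intro i; simp [blk, hi₀]
  have hQdep : DepOn (fun i => !R i) Q := by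
    intro x y
    refine prod_congr rfl fun i _ => ?_
    refine depOn_of_subset (hΦ (some i)) ?_ x y
    intro k hk
    have h1 : blk K k = some i := by simpa [rel] using hk
    have : k ≠ i₀ := by rintro rfl; exact hblk i h1
    simp [hR, this]
  set N : (ι → A) → ℂ := contract R (D.H m) (Φ none) with hN
  have hNdep : DepOn (fun i => !R i) N := by
    intro x y
    simp only [hN, contract, mix_not, mix_mix_right]
  obtain ⟨x₀⟩ : Nonempty (ι → A) := inferInstance
  -- Before the split the block of `i₀` contains no coordinate, so its factor is a constant.
  have hconst : ∀ x, Φ (some i₀) x = Φ (some i₀) x₀ := by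
    intro x
    apply (hΦ (some i₀)).eq
    intro k hk
    have h1 : blk K k = some i₀ := by simpa [rel] using hk
    exfalso
    by_cases hk : K k
    · have h2 : k = i₀ := by simpa [blk, hk] using h1
      rw [h2, hi₀] at hk
      exact Bool.false_ne_true hk
    · simp [blk, hk] at h1
  set Φ' : Option ι → (ι → A) → ℂ := fun o => match o with
    | none => N
    | some i => if i = i₀ then fun x => conj (D.H m x) * Φ (some i₀) x else Φ (some i) with hΦ'
  have hmixR : ∀ {F : (ι → A) → ℂ}, DepOn (fun i => !R i) F → ∀ z x, F (mix R z x) = F x := by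
    intro F hF z x
    have := hF x z
    rwa [mix_not] at this
  refine ⟨Φ', ?_, ?_, ?_⟩
  · intro o
    rcases o with _ | i
    · simp only [hΦ', hN]
      intro x y
      simp only [contract]
      refine expect_congr rfl fun z _ => ?_
      congr 1
      apply (hΦ none).eq
      intro k hk
      have h1 : K k = false := by simpa [rel, blk] using hk
      by_cases hk0 : k = i₀
      · simp [mix, hR, hk0]
      · simp [mix, hR, hk0, rel, blk, h1]
    · simp only [hΦ']
      by_cases hi : i = i₀
      · subst hi
        simp only [if_true]
        intro x y
        change conj (D.H m _) * Φ (some i) _ = conj (D.H m x) * Φ (some i) x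
        rw [hconst (mix _ x y), hconst x]
        congr 2
        apply hHdep.eq
        intro k hk
        have : k = i := by simpa [hR] using hk
        subst this
        simp [mix, rel, blk]
      · simp only [if_neg hi]
        refine depOn_of_subset (hΦ (some i)) ?_
        intro k hk
        have h1 : blk K k = some i := by simpa [rel] using hk
        have hk0 : k ≠ i₀ := by rintro rfl; exact hblk i h1
        simp only [rel, decide_eq_true_eq]
        rw [← h1]
        simp [blk, hk0]
  · intro o
    rcases o with _ | i
    · simp only [hΦ', hN]
      refine (nsq_contract_le _ _ _).trans ?_
      rw [D.nsq_H, one_mul]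
      exact hn none
    · simp only [hΦ']
      by_cases hi : i = i₀
      · subst hi
        simp only [if_true, hconst]
        have e1 : nsq (fun x => conj (D.H m x) * Φ (some i) x₀) = nsq (Φ (some i)) := by
          have h1 : nsq (Φ (some i)) = ‖Φ (some i) x₀‖ ^ 2 := by
            simp only [nsq, hconst, Fintype.expect_const]
          rw [h1]
          simp only [mul_comm _ (Φ (some i) x₀)]
          rw [nsq_const_mul, nsq_conj, D.nsq_H, mul_one]
        rw [e1]
        exact hn _
      · simp only [if_neg hi]
        exact hn _
  · have hP : ∀ x, ∏ o, Φ o x = Φ none x * Q x := fun x => Fintype.prod_option _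
    have hP' : ∀ x, ∏ o, Φ' o x = N x * (conj (D.H m x) * Q x) := by
      intro x
      rw [Fintype.prod_option]
      congr 1
      simp only [hQ]
      rw [Fintype.prod_eq_mul_prod_compl i₀ (fun i => Φ' (some i) x),
        Fintype.prod_eq_mul_prod_compl i₀ (fun i => Φ (some i) x), ← mul_assoc]
      congr 1
      · simp [hΦ']
      · refine prod_congr rfl fun i hi => ?_
        have : i ≠ i₀ := by simpa using hi
        simp [hΦ', this]
    have hA2 : 𝔼 x, D.G m x * D.H m x * ∏ o, Φ o x = 𝔼 x, g x * ∏ o, Φ' o x := by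
      simp only [hP, hP']
      calc _ = 𝔼 x, D.G m x * Q x * N x := by
            rw [← expect_mix R (fun x => D.G m x * D.H m x * (Φ none x * Q x)),
              expect_expect_comm]
            refine expect_congr rfl fun x _ => ?_
            simp only [hN, contract, mul_expect]
            refine expect_congr rfl fun z _ => ?_
            rw [hmixR (D.depOn_G m), hmixR hQdep, hHdep]
            ring
        _ = _ := by
            rw [← expect_mix R (fun x => g x * (N x * (conj (D.H m x) * Q x))),
              expect_expect_comm]
            refine expect_congr rfl fun x _ => ?_
            rw [D.G_eq, mul_assoc, expect_mul]
            refine expect_congr rfl fun z _ => ?_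
            rw [hmixR hNdep, hmixR hQdep, hHdep]
            ring
    have hA1 : ‖𝔼 x, (g x - D.G m x * D.H m x) * ∏ o, Φ o x‖ ≤ √(2 * γ) := by
      apply Real.le_sqrt_of_sq_le
      refine (norm_sq_expect_mul_le _ _).trans ?_
      have h1 : (𝔼 x, ‖g x - D.G m x * D.H m x‖ ^ 2) = 1 - D.l m := by
        have e1 : (fun x => g x - D.G m x * D.H m x) = D.comb fun j => 1 - if j = m then 1 else 0 := by
          rw [← D.comb_sub, D.comb_one]
          funext x
          simp [CutSVD.comb]
        have e2 := D.nsq_comb fun j => 1 - if j = m then 1 else 0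
        rw [← e1, nsq] at e2
        rw [e2, ← hsum, ← Finset.sum_erase_add univ D.l (mem_univ m), add_sub_cancel_right,
          ← Finset.sum_erase_add univ _ (mem_univ m)]
        simp only [if_true, sub_self, norm_zero, zero_pow two_ne_zero, zero_mul, add_zero]
        refine sum_congr rfl fun j hj => ?_
        simp [(mem_erase.1 hj).1]
      have h2 : (𝔼 x, ‖∏ o, Φ o x‖ ^ 2) ≤ 1 := by
        have := nsq_prod_blocks K Φ hΦ
        rw [nsq] at this
        rw [this]
        exact prod_le_one (fun o _ => nsq_nonneg _) (fun o _ => hn o)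
      rw [h1]
      have h3 : D.l m ≤ 1 := by
        rw [← hsum]
        exact single_le_sum (f := D.l) (fun j _ => D.l_nonneg j) (mem_univ m)
      have h4 : (0 : ℝ) ≤ 𝔼 x, ‖∏ o, Φ o x‖ ^ 2 := expect_nonneg' fun _ => by positivity
      nlinarith
    have e : 𝔼 x, g x * ∏ o, Φ o x
        = 𝔼 x, (g x - D.G m x * D.H m x) * ∏ o, Φ o x + 𝔼 x, g x * ∏ o, Φ' o x := by
      rw [← hA2, ← expect_add_distrib]
      exact expect_congr rfl fun x _ => by ring
    rw [e]
    have := norm_add_le (𝔼 x, (g x - D.G m x * D.H m x) * ∏ o, Φ o x) (𝔼 x, g x * ∏ o, Φ' o x)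
    linarith

theorem expect_coord (f : A → ℝ) (i : ι) : 𝔼 x : ι → A, f (x i) = 𝔼 a, f a := by
  have := expect_prod_pi (K := ℝ) (A := A) (fun (k : ι) a => if k = i then f a else 1)
  have h1 : ∀ x : ι → A, ∏ k, (if k = i then f (x k) else 1) = f (x i) := by
    intro x; simp
  simp only [h1] at this
  rw [this]
  rw [prod_eq_single i]
  · simp
  · intro k _ hk; simp [hk]
  · simp

/-- A function whose average box functional is nearly maximal correlates with a product. -/
theorem exists_prod_of_avgBox (g : (ι → A) → ℂ) (hg : nsq g = 1)
    (h : 1 - 1 / 1000 ≤ avgBox g) : ∃ φ : ι → A → ℂ, (∀ i, nsq (φ i) ≤ 1) ∧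
      1 / 2 ≤ ‖𝔼 x, g x * ∏ i, φ i (x i)‖ ^ 2 := by
  have hbox : ∀ S, 1 - 2 * (1 / 1000) ≤ box S g := by
    intro S
    have := nsq_sub_box_le S g
    rw [hg] at this
    linarith
  -- The bound is independent of `T`. A split lowers the correlation from above `99/100` to at least
  -- `9/10`, whose square exceeds `3/4`, and `gap` applied to the function on blocks restores `1 -
  -- 13/1000`.
  have main : ∀ T : Finset ι, ∃ Φ : Option ι → (ι → A) → ℂ,
      (∀ o, DepOn (rel (fun i => decide (i ∈ T)) o) (Φ o)) ∧ (∀ o, nsq (Φ o) ≤ 1) ∧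
      1 - 13 / 1000 ≤ ‖𝔼 x, g x * ∏ o, Φ o x‖ ^ 2 := by
    intro T
    induction T using Finset.induction_on with
    | empty =>
      -- With a single block the conjugate of `g` is an admissible factor and gives correlation `1`.
      refine ⟨fun o => match o with
        | none => fun x => conj (g x)
        | some _ => fun _ => 1, ?_, ?_, ?_⟩
      · rintro (_ | i)
        · intro x y
          have : mix (rel (fun i => decide (i ∈ (∅ : Finset ι))) none) x y = x := by
            funext i
            simp [mix, rel, blk]
          rw [this]
        · intro x y; rfl
      · rintro (_ | i)
        · simp only [nsq_conj, hg, le_refl]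
        · simp [nsq]
      · have : 𝔼 x, g x * ∏ o : Option ι, (match o with
            | none => fun x => conj (g x)
            | some _ => fun _ => 1 : (ι → A) → ℂ) x = 1 := by
          simp only [Fintype.prod_option, prod_const_one, mul_one]
          rw [← Complex.ofReal_one, ← hg, nsq, ofReal_expect]
          simp only [Complex.ofReal_pow, ← Complex.mul_conj']
        rw [this]
        norm_num
    | insert i₀ T hi₀ ih =>
      obtain ⟨Φ, hΦ, hn, hv⟩ := ih
      obtain ⟨Φ', hΦ', hn', hv'⟩ := split_block (fun i => decide (i ∈ T)) i₀ (by simp [hi₀]) g hg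
        (γ := 1 / 1000) (by norm_num) (hbox _) Φ hΦ hn
      have hK : Function.update (fun i => decide (i ∈ T)) i₀ true
          = fun i => decide (i ∈ insert i₀ T) := by
        funext i
        by_cases h : i = i₀
        · subst h; simp
        · simp [h]
      rw [hK] at hΦ'
      set K : ι → Bool := fun i => decide (i ∈ insert i₀ T) with hKdef
      have hv2 : 9 / 10 ≤ ‖𝔼 x, g x * ∏ o, Φ' o x‖ := by
        have h1 : (99 / 100 : ℝ) ≤ ‖𝔼 x, g x * ∏ o, Φ o x‖ := by
          apply le_of_sq_le_sq _ (norm_nonneg _)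
          linarith
        have h2 : √(2 * (1 / 1000 : ℝ)) ≤ 9 / 100 := by
          apply Real.sqrt_le_iff.2; norm_num
        linarith
      set gK : (Option ι → ι → A) → ℂ := fun X => g (pick K X) with hgK
      have hgK1 : nsq gK = 1 := by
        rw [← hg, nsq, nsq, ← expect_pick K]
      have hval := expect_pick_prod K g Φ' hΦ'
      obtain ⟨φ, hφ, hmax⟩ := exists_max_prod_unit gK ⟨Φ', hn', by rw [hval]; linarith⟩
      have hm1 := hmax Φ' hn'
      rw [hval] at hm1
      have hgap := gap gK hgK1 φ hφ hmax (by nlinarith)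
      have hav := avgBox_le_avgBox_pick K g
      obtain ⟨Φ'', hd, hn'', he⟩ := exists_depOn_blocks K g φ (fun o => (hφ o).le)
      refine ⟨Φ'', hd, hn'', ?_⟩
      rw [← he]
      linarith
  obtain ⟨Φ, hΦ, hn, hv⟩ := main univ
  obtain ⟨x₀⟩ : Nonempty (ι → A) := inferInstance
  have hnone : ∀ x, Φ none x = Φ none x₀ := by
    intro x
    apply (hΦ none).eq
    intro i hi
    simp [rel, blk] at hi
  have hsome : ∀ i x, Φ (some i) x = Φ (some i) (fun _ => x i) := by
    intro i x
    apply (hΦ (some i)).eq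
    intro k hk
    have : k = i := by simpa [rel, blk] using hk
    rw [this]
  refine ⟨fun i a => Φ (some i) fun _ => a, fun i => ?_, ?_⟩
  · have := hn (some i)
    rw [nsq] at this
    simp only [hsome i] at this
    rwa [expect_coord (fun a => ‖Φ (some i) fun _ => a‖ ^ 2) i] at this
  · have e : 𝔼 x, g x * ∏ o, Φ o x
        = Φ none x₀ * 𝔼 x, g x * ∏ i, Φ (some i) (fun _ => x i) := by
      rw [mul_expect]
      refine expect_congr rfl fun x _ => ?_
      rw [Fintype.prod_option, hnone x]
      simp only [← hsome]
      ring
    have hc : ‖Φ none x₀‖ ^ 2 ≤ 1 := by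
      have := hn none
      simpa only [nsq, hnone, Fintype.expect_const] using this
    rw [e, norm_mul, mul_pow] at hv
    have h0 : 0 ≤ ‖𝔼 x, g x * ∏ i, Φ (some i) (fun _ => x i)‖ ^ 2 := by positivity
    nlinarith

end Blocks

/-! ### Correlation with products after random restrictions -/

section Iterate
variable {ι A : Type*} [Fintype ι] [DecidableEq ι] [Fintype A] [DecidableEq A]

/-- The largest squared correlation with a product of functions in the unit balls. -/
noncomputable def prodSq (g : (ι → A) → ℂ) : ℝ :=
  ⨆ φ : {φ : ι → A → ℂ // ∀ i, nsq (φ i) ≤ 1}, ‖𝔼 x, g x * ∏ i, φ.1 i (x i)‖ ^ 2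

/-- The average of `prodSq` over `j` successive uniform random restrictions. -/
noncomputable def iterCorr : ℕ → ((ι → A) → ℂ) → ℝ
  | 0, g => prodSq g
  | j + 1, g => 𝔼 R : ι → Bool, 𝔼 z, iterCorr j (restr R z g)

variable [Nonempty A]

instance : Nonempty {φ : ι → A → ℂ // ∀ i, nsq (φ i) ≤ 1} :=
  ⟨⟨fun _ _ => 0, fun _ => by simp [nsq]⟩⟩

theorem norm_sq_expect_prod_le (g : (ι → A) → ℂ) {φ : ι → A → ℂ} (hφ : ∀ i, nsq (φ i) ≤ 1) :
    ‖𝔼 x, g x * ∏ i, φ i (x i)‖ ^ 2 ≤ nsq g := by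
  refine (norm_sq_expect_mul_le _ _).trans ?_
  have h := nsq_prod φ
  rw [nsq] at h
  rw [h]
  exact mul_le_of_le_one_right (nsq_nonneg g) (prod_le_one (fun i _ => nsq_nonneg _) fun i _ => hφ i)

theorem bddAbove_prodSq (g : (ι → A) → ℂ) : BddAbove (Set.range
    fun φ : {φ : ι → A → ℂ // ∀ i, nsq (φ i) ≤ 1} => ‖𝔼 x, g x * ∏ i, φ.1 i (x i)‖ ^ 2) :=
  ⟨nsq g, by rintro _ ⟨φ, rfl⟩; exact norm_sq_expect_prod_le g φ.2⟩

theorem le_prodSq (g : (ι → A) → ℂ) {φ : ι → A → ℂ} (hφ : ∀ i, nsq (φ i) ≤ 1) :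
    ‖𝔼 x, g x * ∏ i, φ i (x i)‖ ^ 2 ≤ prodSq g := by
  have h := le_ciSup (bddAbove_prodSq g) ⟨φ, hφ⟩
  exact h

theorem prodSq_nonneg (g : (ι → A) → ℂ) : 0 ≤ prodSq g :=
  Real.iSup_nonneg fun _ => by positivity

theorem iterCorr_nonneg (j : ℕ) (g : (ι → A) → ℂ) : 0 ≤ iterCorr j g := by
  induction j generalizing g with
  | zero => exact prodSq_nonneg g
  | succ j ih => exact expect_nonneg' fun R => expect_nonneg' fun z => ih _

/-- Cauchy–Schwarz in `z` for each fixed product; restrictions commute with linear combinations, so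
the bound passes through all `j` levels. -/
theorem iterCorr_expect_le {Z : Type*} [Fintype Z] (j : ℕ) (H : Z → ℂ) (h : Z → (ι → A) → ℂ) :
    iterCorr j (fun x => 𝔼 z, H z * h z x) ≤ nsq H * 𝔼 z, iterCorr j (h z) := by
  induction j generalizing h with
  | zero =>
    refine ciSup_le fun φ => ?_
    have e : 𝔼 x, (𝔼 z, H z * h z x) * ∏ i, φ.1 i (x i)
        = 𝔼 z, H z * 𝔼 x, h z x * ∏ i, φ.1 i (x i) := by
      simp only [expect_mul, mul_expect]
      rw [expect_expect_comm]
      refine expect_congr rfl fun z _ => expect_congr rfl fun x _ => ?_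
      ring
    rw [e]
    refine (norm_sq_expect_mul_le _ _).trans ?_
    refine mul_le_mul_of_nonneg_left ?_ (nsq_nonneg H)
    exact expect_mono fun z => le_prodSq _ φ.2
  | succ j ih =>
    calc iterCorr (j + 1) (fun x => 𝔼 z, H z * h z x)
        ≤ 𝔼 R : ι → Bool, 𝔼 u, nsq H * 𝔼 z, iterCorr j (restr R u (h z)) :=
          expect_mono fun R => expect_mono fun u => ih fun z => restr R u (h z)
      _ = nsq H * 𝔼 R : ι → Bool, 𝔼 u, 𝔼 z, iterCorr j (restr R u (h z)) := by
          simp only [← mul_expect]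
      _ = _ := by
          congr 1
          simp only [iterCorr]
          calc _ = 𝔼 R : ι → Bool, 𝔼 z, 𝔼 u, iterCorr j (restr R u (h z)) :=
                expect_congr rfl fun R _ => expect_expect_comm _
            _ = _ := expect_expect_comm _

/-- Contracting across `R` is averaging the restrictions to `R` with weights `H R`, so it costs one
level of restriction. -/
theorem expect_iterCorr_contract_le (j : ℕ) (g : (ι → A) → ℂ)
    (H : (ι → Bool) → (ι → A) → ℂ) (hH : ∀ R, nsq (H R) ≤ 1) :
    𝔼 R, iterCorr j (contract R (H R) g) ≤ iterCorr (j + 1) g := by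
  refine expect_mono fun R => ?_
  refine (iterCorr_expect_le j (H R) (fun z => restr R z g)).trans ?_
  exact mul_le_of_le_one_left (expect_nonneg' fun z => iterCorr_nonneg _ _) (hH R)

theorem iterCorr_const_mul (j : ℕ) (c : ℂ) (g : (ι → A) → ℂ) :
    iterCorr j (fun x => c * g x) = ‖c‖ ^ 2 * iterCorr j g := by
  induction j generalizing g with
  | zero =>
    simp only [iterCorr, prodSq]
    rw [Real.mul_iSup_of_nonneg (by positivity)]
    congr 1
    funext φ
    rw [← mul_pow, ← norm_mul, mul_expect]
    simp only [mul_assoc]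
  | succ j ih =>
    simp only [iterCorr, mul_expect]
    exact expect_congr rfl fun R _ => expect_congr rfl fun z _ => ih (restr R z g)

/-- The inductive bound for the correlation with products after random restrictions. -/
theorem le_iterCorr {η κ τ : ℝ} (hτ : 0 < τ) (hτη : 4 * τ ≤ η) (hη : η ≤ 1) (hκ : 0 < κ)
    (hκη : 10 ^ 10 * κ ≤ η ^ 5) (j : ℕ) (hj : η ≤ 1 - 1 / 1000 - j * κ) (g : (ι → A) → ℂ) :
    1 / 2 * τ ^ j * (avgBox g / nsq g - (1 - 1 / 1000 - j * κ) * nsq g) ≤ iterCorr j g := by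
  -- reduction to unit functions
  have red : ∀ (j : ℕ) (C s : ℝ), (∀ g : (ι → A) → ℂ, nsq g = 1 →
      C * (avgBox g - s) ≤ iterCorr j g) →
      ∀ g : (ι → A) → ℂ, C * (avgBox g / nsq g - s * nsq g) ≤ iterCorr j g := by
    intro j C s h g
    rcases (nsq_nonneg g).eq_or_lt with h0 | h0
    · rw [← h0]; simp [iterCorr_nonneg]
    · have hs := Real.sqrt_pos.2 h0
      set c : ℂ := (((√(nsq g))⁻¹ : ℝ) : ℂ) with hc
      have nc : ‖c‖ ^ 2 = (nsq g)⁻¹ := by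
        rw [hc, Complex.norm_real, Real.norm_of_nonneg (by positivity), inv_pow,
          Real.sq_sqrt h0.le]
      have h1 := h (fun x => c * g x) (by rw [nsq_const_mul, nc, inv_mul_cancel₀ h0.ne'])
      rw [avgBox_const_mul, iterCorr_const_mul, show ‖c‖ ^ 4 = (‖c‖ ^ 2) ^ 2 by ring, nc] at h1
      have h2 := mul_le_mul_of_nonneg_left h1 h0.le
      rw [mul_inv_cancel_left₀ h0.ne'] at h2
      refine le_of_eq_of_le ?_ h2
      field_simp
  have hη0 : 0 < η := by linarith
  have hη5 : η ^ 5 ≤ 1 := pow_le_one₀ hη0.le hη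
  have hκ' : κ ≤ 1 / 10 ^ 10 := by
    rw [le_div_iff₀ (by positivity)]; linarith
  induction j generalizing g with
  | zero =>
    refine red 0 _ _ (fun g hg => ?_) g
    simp only [pow_zero, mul_one, Nat.cast_zero, zero_mul, sub_zero]
    by_cases hp : 1 - 1 / 1000 ≤ avgBox g
    · obtain ⟨φ, hφ, h⟩ := exists_prod_of_avgBox g hg hp
      have h1 := le_prodSq g hφ
      have h2 := avgBox_le g
      rw [hg] at h2
      have : prodSq g = iterCorr 0 g := rfl
      linarith
    · have := iterCorr_nonneg 0 g
      linarith
  | succ j ih =>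
    refine red (j + 1) _ _ (fun g hg => ?_) g
    push_cast at hj ⊢
    set s : ℝ := 1 - 1 / 1000 - j * κ with hs
    have hs' : 1 - 1 / 1000 - (j + 1) * κ = s - κ := by rw [hs]; ring
    rw [hs'] at hj ⊢
    set C : ℝ := 1 / 2 * τ ^ j with hC
    have hC0 : 0 < C := by positivity
    have hCC : 1 / 2 * τ ^ (j + 1) = C * τ := by rw [hC, pow_succ]; ring
    rw [hCC]
    have ih' : ∀ h : (ι → A) → ℂ, C * (avgBox h / nsq h - s * nsq h) ≤ iterCorr j h :=
      fun h => ih (by linarith) h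
    have hτ1 : τ ≤ 1 / 2 := by linarith
    have hp1 : avgBox g ≤ 1 := by have := avgBox_le g; rwa [hg, one_pow] at this
    by_cases hps : avgBox g < s - κ
    · refine le_trans ?_ (iterCorr_nonneg _ _)
      exact mul_nonpos_of_nonneg_of_nonpos (by positivity) (by linarith)
    push Not at hps
    have hV : C * (restrRatio g - s) ≤ iterCorr (j + 1) g := by
      calc C * (restrRatio g - s)
          = 𝔼 R : ι → Bool, 𝔼 z, C * (avgBox (restr R z g) / nsq (restr R z g)
              - s * nsq (restr R z g)) := by
            simp only [← mul_expect, expect_sub_distrib, expect_nsq_restr, hg,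
              Fintype.expect_const, mul_one]
            rfl
        _ ≤ _ := expect_mono fun R => expect_mono fun z => ih' _
    have hCτ : C * τ * (avgBox g - (s - κ)) ≤ C * (1 / 2) * (avgBox g - (s - κ)) := by
      gcongr
    -- So close to `1` the increment is not available, but monotonicity suffices: the excess over
    -- `s` is at least `κ`, and the factor `τ ≤ 1/2` absorbs the loss of `κ`.
    by_cases hpt : 1 - 1 / 2000 < avgBox g
    · have h1 := avgBox_le_restrRatio g
      rw [hg, mul_one] at h1
      have h2 : C * (avgBox g - s) ≤ C * (restrRatio g - s) := by gcongr
      have hs1 : s ≤ 1 - 1 / 1000 := by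
        have : 0 ≤ (j : ℝ) * κ := by positivity
        linarith
      have h3 : C * (1 / 2) * (avgBox g - (s - κ)) ≤ C * (avgBox g - s) := by
        rw [mul_assoc]
        gcongr
        linarith
      linarith
    push Not at hpt
    have hpη : η ≤ avgBox g := by linarith
    have hκg : 2400 * κ < avgBox g ^ 5 * (1 - avgBox g) ^ 2 := by
      have h1 : η ^ 5 ≤ avgBox g ^ 5 := by gcongr
      have h2 : (1 / 2000 : ℝ) ^ 2 ≤ (1 - avgBox g) ^ 2 := by
        apply pow_le_pow_left₀ (by norm_num); linarith
      have h3 : η ^ 5 * (1 / 2000 : ℝ) ^ 2 ≤ avgBox g ^ 5 * (1 - avgBox g) ^ 2 :=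
        mul_le_mul h1 h2 (by positivity) (pow_nonneg (avgBox_nonneg g) 5)
      nlinarith
    rcases increment g hg hτ (by linarith) (by linarith) hκ hκg with h | ⟨H, hH, h⟩
    · have h2 : C * (avgBox g - (s - κ)) ≤ C * (restrRatio g - s) :=
        mul_le_mul_of_nonneg_left (by linarith) hC0.le
      have h3 : C * (1 / 2) * (avgBox g - (s - κ)) ≤ C * (avgBox g - (s - κ)) := by
        have : 0 ≤ C * (avgBox g - (s - κ)) := mul_nonneg hC0.le (by linarith)
        linarith
      linarith
    · refine le_trans ?_ (expect_iterCorr_contract_le j g H hH)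
      have hs0 : 0 ≤ s := by linarith
      calc C * τ * (avgBox g - (s - κ)) ≤ C * τ * (𝔼 R, gain τ R (H R) g - s) :=
            mul_le_mul_of_nonneg_left (by linarith) (by positivity)
        _ = 𝔼 R, C * τ * (gain τ R (H R) g - s) := by
            rw [← mul_expect, expect_sub_distrib, Fintype.expect_const]
        _ ≤ _ := by
            refine expect_mono fun R => ?_
            have h0 := iterCorr_nonneg j (contract R (H R) g)
            by_cases hgs : gain τ R (H R) g ≤ s
            · refine le_trans ?_ h0
              exact mul_nonpos_of_nonneg_of_nonpos (by positivity) (by linarith)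
            push Not at hgs
            unfold gain at hgs ⊢
            split_ifs at hgs ⊢ with hw
            · set w := nsq (contract R (H R) g) with hwdef
              have hw0 : 0 < w := hτ.trans_le hw
              refine le_trans ?_ (ih' _)
              rw [mul_assoc]
              refine mul_le_mul_of_nonneg_left ?_ hC0.le
              -- The contraction has mean square `w ≥ τ`; undoing the normalization costs the factor
              -- `τ` of this level.
              calc τ * (avgBox (contract R (H R) g) / w ^ 2 - s)
                  ≤ w * (avgBox (contract R (H R) g) / w ^ 2 - s) :=
                    mul_le_mul_of_nonneg_right hw (by linarith)
                _ = _ := by rw [← hwdef]; field_simp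
            · linarith

end Iterate

/-! ### Sums against product weights -/

section Weights
variable {W V Q : Type*} [Fintype W] [Fintype V] [DecidableEq V] [Fintype Q] [DecidableEq Q]

/-- The image of a weight under a map. -/
noncomputable def pushW (π : W → V) (m : W → ℝ) (v : V) : ℝ := ∑ w, if π w = v then m w else 0

/-- The weight on pairs of conditionally independent points with equal images under `q`. -/
noncomputable def dblW (q : W → Q) (m : W → ℝ) (p : W × W) : ℝ :=
  if q p.1 = q p.2 then m p.1 * m p.2 / pushW q m (q p.1) else 0

theorem pushW_nonneg {π : W → V} {m : W → ℝ} (hm : ∀ w, 0 ≤ m w) (v : V) : 0 ≤ pushW π m v :=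
  sum_nonneg fun w _ => by split_ifs; exacts [hm w, le_rfl]

theorem sum_pushW_mul (π : W → V) (m : W → ℝ) (G : V → ℝ) :
    ∑ v, pushW π m v * G v = ∑ w, m w * G (π w) := by
  simp only [pushW, sum_mul]
  rw [sum_comm]
  refine sum_congr rfl fun w _ => ?_
  simp [ite_mul]

theorem sum_pushW (π : W → V) (m : W → ℝ) : ∑ v, pushW π m v = ∑ w, m w := by
  simpa using sum_pushW_mul π m fun _ => 1

theorem le_pushW {π : W → V} {m : W → ℝ} (hm : ∀ w, 0 ≤ m w) (w : W) :
    m w ≤ pushW π m (π w) := by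
  have := single_le_sum (f := fun w' => if π w' = π w then m w' else 0)
    (fun w' _ => by split_ifs; exacts [hm w', le_rfl]) (mem_univ w)
  simpa [pushW] using this

theorem dblW_nonneg {q : W → Q} {m : W → ℝ} (hm : ∀ w, 0 ≤ m w) (p : W × W) :
    0 ≤ dblW q m p := by
  unfold dblW
  split_ifs
  · exact div_nonneg (mul_nonneg (hm _) (hm _)) (pushW_nonneg hm _)
  · exact le_rfl

/-- Cauchy--Schwarz: doubling over the fibres of `q`. -/
theorem norm_sq_sum_le_double (m : W → ℝ) (hm : ∀ w, 0 ≤ m w) (hsum : ∑ w, m w = 1) (q : W → Q)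
    (F : W → ℂ) (H : Q → ℂ) (hH : ∀ u, ‖H u‖ ≤ 1) :
    ‖∑ w, (m w : ℂ) * (F w * H (q w))‖ ^ 2
      ≤ ‖∑ w, ∑ w', (dblW q m (w, w') : ℂ) * (F w * conj (F w'))‖ := by
  -- Grouping by fibres of `q`; Cauchy–Schwarz is weighted by the fibre masses, and a fibre of mass
  -- zero contributes nothing.
  set T : Q → ℂ := fun u => ∑ w, if q w = u then (m w : ℂ) * F w else 0 with hT
  set mq : Q → ℝ := pushW q m with hmq
  have hmq0 : ∀ u, 0 ≤ mq u := pushW_nonneg hm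
  have hT0 : ∀ u, mq u = 0 → T u = 0 := by
    intro u hu
    refine sum_eq_zero fun w _ => ?_
    split_ifs with h
    · have h1 := le_pushW (π := q) hm w
      rw [h] at h1
      have : m w = 0 := le_antisymm (h1.trans_eq hu) (hm w)
      simp [this]
    · rfl
  have h1 : ∑ w, (m w : ℂ) * (F w * H (q w)) = ∑ u, T u * H u := by
    simp only [hT, sum_mul]
    rw [sum_comm]
    refine sum_congr rfl fun w _ => ?_
    simp [ite_mul, mul_assoc]
  have h2 : ∑ w, ∑ w', (dblW q m (w, w') : ℂ) * (F w * conj (F w'))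
      = ((∑ u, ‖T u‖ ^ 2 / mq u : ℝ) : ℂ) := by
    have e : ∀ u, ((‖T u‖ ^ 2 / mq u : ℝ) : ℂ)
        = ∑ w, if q w = u then ∑ w', (dblW q m (w, w') : ℂ) * (F w * conj (F w')) else 0 := by
      intro u
      rw [Complex.ofReal_div, Complex.ofReal_pow, ← Complex.mul_conj', hT, map_sum, sum_mul_sum,
        sum_div]
      refine sum_congr rfl fun w _ => ?_
      split_ifs with h
      · rw [sum_div]
        refine sum_congr rfl fun w' _ => ?_
        unfold dblW
        simp only [h]
        by_cases h' : q w' = u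
        · simp only [h', if_true, map_mul, Complex.conj_ofReal, hmq]
          push_cast
          ring
        · simp [h', Ne.symm h']
      · simp
    rw [Complex.ofReal_sum]
    simp only [e]
    conv_rhs => rw [sum_comm]
    refine sum_congr rfl fun w _ => ?_
    simp
  have h0 : (0 : ℝ) ≤ ∑ u, ‖T u‖ ^ 2 / mq u :=
    sum_nonneg fun u _ => div_nonneg (by positivity) (hmq0 u)
  rw [h1, h2, Complex.norm_real, Real.norm_of_nonneg h0]
  calc ‖∑ u, T u * H u‖ ^ 2 ≤ (∑ u, ‖T u‖) ^ 2 := by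
        gcongr
        refine (norm_sum_le _ _).trans (sum_le_sum fun u _ => ?_)
        rw [norm_mul]
        exact mul_le_of_le_one_right (norm_nonneg _) (hH u)
    _ ≤ (∑ u, mq u) * ∑ u, ‖T u‖ ^ 2 / mq u := by
        refine sum_sq_le_sum_mul_sum_of_sq_le_mul _ (fun u _ => hmq0 u)
          (fun u _ => div_nonneg (by positivity) (hmq0 u)) fun u _ => le_of_eq ?_
        by_cases h : mq u = 0
        · simp [hT0 u h, h]
        · field_simp
    _ = _ := by rw [hmq, sum_pushW, hsum, one_mul]

/-- The joint weight of two maps. -/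
noncomputable def joint {A : Type*} [DecidableEq A] (φ : W → A) (q : W → Q) (m : W → ℝ)
    (a : A) (v : Q) : ℝ := ∑ w, if φ w = a ∧ q w = v then m w else 0

/-- The weight on pairs of endpoints of a walk of two steps through the second factor. -/
noncomputable def pairW {A : Type*} [Fintype A] (P : A → Q → ℝ) (a b : A) : ℝ :=
  ∑ v, P a v * P b v / ∑ c, P c v

theorem sum_joint {A : Type*} [Fintype A] [DecidableEq A] (φ : W → A) (q : W → Q) (m : W → ℝ)
    (v : Q) : ∑ a, joint φ q m a v = pushW q m v := by
  simp only [joint, pushW]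
  rw [sum_comm]
  refine sum_congr rfl fun w _ => ?_
  by_cases h : q w = v <;> simp [h]

/-- The endpoints of a doubled weight. -/
theorem pushW_dblW {A : Type*} [Fintype A] [DecidableEq A] (φ : W → A) (q : W → Q) (m : W → ℝ)
    (a b : A) :
    pushW (fun p : W × W => (φ p.1, φ p.2)) (dblW q m) (a, b) = pairW (joint φ q m) a b := by
  have e : ∀ v, joint φ q m a v * joint φ q m b v / pushW q m v = ∑ w, if q w = v then
      ∑ w', (if (φ w, φ w') = (a, b) then dblW q m (w, w') else 0) else 0 := by
    intro v
    rw [joint, joint, sum_mul_sum, sum_div]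
    refine sum_congr rfl fun w _ => ?_
    rw [sum_div]
    by_cases h : q w = v
    · simp only [h, if_true]
      refine sum_congr rfl fun w' _ => ?_
      by_cases h1 : φ w = a <;> by_cases h2 : φ w' = b <;> by_cases h3 : q w' = v <;>
        simp [dblW, h, h1, h2, h3, eq_comm (a := v)]
    · simp [h]
  simp only [pairW, sum_joint, e]
  rw [sum_comm, pushW, Fintype.sum_prod_type]
  refine sum_congr rfl fun w _ => ?_
  simp

/-- Used for coordinates that are not to be doubled: there `q` remembers the whole point. -/
theorem dblW_of_injective {q : W → Q} (hq : Function.Injective q) [DecidableEq W] (m : W → ℝ)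
    (p : W × W) : dblW q m p = if p.1 = p.2 then m p.1 else 0 := by
  have h : ∀ w, pushW q m (q w) = m w := by
    intro w
    simp [pushW, hq.eq_iff]
  unfold dblW
  rw [h]
  by_cases hp : p.1 = p.2
  · simp [hp]
  · simp [hp, hq.ne hp]

variable {ι : Type*} [Fintype ι] [DecidableEq ι]

/-- The sum of `G` against the product of the weights `m i`. -/
noncomputable def psum (m : ι → W → ℝ) (G : (ι → W) → ℂ) : ℂ :=
  ∑ w : ι → W, ((∏ i, m i (w i) : ℝ) : ℂ) * G w

theorem pushW_pi [DecidableEq W] (π : ι → W → V) (m : ι → W → ℝ) (v : ι → V) :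
    pushW (fun (w : ι → W) i => π i (w i)) (fun w => ∏ i, m i (w i)) v
      = ∏ i, pushW (π i) (m i) (v i) := by
  simp only [pushW]
  rw [prod_univ_sum, Fintype.piFinset_univ]
  refine sum_congr rfl fun w _ => ?_
  rw [prod_ite_zero]
  simp only [funext_iff, mem_univ, true_implies]

theorem psum_push [DecidableEq W] (π : ι → W → V) (m : ι → W → ℝ) (G : (ι → V) → ℂ) :
    psum m (fun w => G fun i => π i (w i)) = psum (fun i => pushW (π i) (m i)) G := by
  unfold psum
  simp only [← pushW_pi]
  simp only [pushW, Complex.ofReal_sum, sum_mul]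
  rw [sum_comm]
  refine sum_congr rfl fun w _ => ?_
  rw [sum_eq_single (fun i => π i (w i))]
  · simp
  · intro v _ hv
    simp [Ne.symm hv]
  · simp

theorem psum_congr {m : ι → W → ℝ} {G G' : (ι → W) → ℂ}
    (h : ∀ w, (∀ i, m i (w i) ≠ 0) → G w = G' w) : psum m G = psum m G' := by
  refine sum_congr rfl fun w _ => ?_
  by_cases hw : ∀ i, m i (w i) ≠ 0
  · rw [h w hw]
  · push Not at hw
    obtain ⟨i, hi⟩ := hw
    have : ∏ i, m i (w i) = 0 := prod_eq_zero (mem_univ i) hi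
    simp [this]

theorem sum_prod_weights [DecidableEq W] {m : ι → W → ℝ} (hm : ∀ i, ∑ w, m i w = 1) :
    ∑ w : ι → W, ∏ i, m i (w i) = 1 := by
  have h := prod_univ_sum (fun _ : ι => (univ : Finset W)) m
  rw [Fintype.piFinset_univ] at h
  rw [← h]
  simp [hm]

/-- Cauchy--Schwarz for product weights. -/
theorem norm_sq_psum_le [DecidableEq W] (m : ι → W → ℝ) (hm : ∀ i w, 0 ≤ m i w)
    (hsum : ∀ i, ∑ w, m i w = 1) (q : ι → W → Q) (F : (ι → W) → ℂ) (H : (ι → Q) → ℂ)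
    (hH : ∀ u, ‖H u‖ ≤ 1) :
    ‖psum m (fun w => F w * H fun i => q i (w i))‖ ^ 2 ≤
      ‖psum (fun i => dblW (q i) (m i))
        (fun p => F (fun i => (p i).1) * conj (F fun i => (p i).2))‖ := by
  refine (norm_sq_sum_le_double (fun w : ι → W => ∏ i, m i (w i))
    (fun w => prod_nonneg fun i _ => hm i _) (sum_prod_weights hsum)
    (fun w i => q i (w i)) F H hH).trans_eq ?_
  congr 1
  have hd : ∀ w w' : ι → W, dblW (fun (w : ι → W) i => q i (w i)) (fun w => ∏ i, m i (w i)) (w, w')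
      = ∏ i, dblW (q i) (m i) (w i, w' i) := by
    intro w w'
    simp only [dblW, pushW_pi]
    rw [prod_ite_zero]
    simp only [funext_iff, mem_univ, true_implies]
    congr 1
    rw [prod_div_distrib, prod_mul_distrib]
  simp only [hd]
  unfold psum
  rw [← Fintype.sum_prod_type'
    (f := fun w w' : ι → W => ((∏ i, dblW (q i) (m i) (w i, w' i) : ℝ) : ℂ) * (F w * conj (F w')))]
  exact Fintype.sum_equiv (Equiv.arrowProdEquivProdArrow ι (fun _ => W) (fun _ => W)).symm _ _
    fun p => rfl

end Weights

/-! ### Doubling of kernels -/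

section Kernel
variable {A V : Type*} [Fintype A] [Fintype V]

theorem pairW_nonneg {P : A → V → ℝ} (hP : ∀ a v, 0 ≤ P a v) (a b : A) : 0 ≤ pairW P a b :=
  sum_nonneg fun v _ => div_nonneg (mul_nonneg (hP a v) (hP b v)) (sum_nonneg fun c _ => hP c v)

theorem pairW_comm (P : A → V → ℝ) (a b : A) : pairW P a b = pairW P b a := by
  simp only [pairW, mul_comm]

theorem sum_pairW {P : A → V → ℝ} (hP : ∀ a v, 0 ≤ P a v) (a : A) :
    ∑ b, pairW P a b = ∑ v, P a v := by
  simp only [pairW]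
  rw [sum_comm]
  refine sum_congr rfl fun v _ => ?_
  rw [← sum_div, ← mul_sum]
  by_cases h : ∑ c, P c v = 0
  · have : P a v = 0 := (sum_eq_zero_iff_of_nonneg fun c _ => hP c v).1 h a (mem_univ a)
    simp [this]
  · field_simp

theorem mul_le_pairW {P : A → V → ℝ} (hP : ∀ a v, 0 ≤ P a v) {v : V} (hv : ∑ c, P c v ≤ 1)
    (a b : A) : P a v * P b v ≤ pairW P a b := by
  have h0 : 0 ≤ ∑ c, P c v := sum_nonneg fun c _ => hP c v
  have h1 : P a v * P b v / ∑ c, P c v ≤ pairW P a b :=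
    single_le_sum (f := fun v => P a v * P b v / ∑ c, P c v)
      (fun v _ => div_nonneg (mul_nonneg (hP a v) (hP b v)) (sum_nonneg fun c _ => hP c v))
      (mem_univ v)
  refine le_trans ?_ h1
  rcases h0.eq_or_lt with h | h
  · have : P a v = 0 :=
      (sum_eq_zero_iff_of_nonneg fun c _ => hP c v).1 h.symm a (mem_univ a)
    simp [this]
  · rw [le_div_iff₀ h]
    exact mul_le_of_le_one_right (mul_nonneg (hP a v) (hP b v)) hv

/-- A symmetric nonnegative kernel with row sums `m`. -/
structure IsKernel (m : A → ℝ) (r : A → A → ℝ) : Prop where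
  nonneg : ∀ a b, 0 ≤ r a b
  symm : ∀ a b, r a b = r b a
  rowSum : ∀ a, ∑ b, r a b = m a

theorem isKernel_pairW {P : A → V → ℝ} (hP : ∀ a v, 0 ≤ P a v) {m : A → ℝ}
    (hm : ∀ a, ∑ v, P a v = m a) : IsKernel m (pairW P) :=
  ⟨pairW_nonneg hP, pairW_comm P, fun a => (sum_pairW hP a).trans (hm a)⟩

theorem IsKernel.pairW {m : A → ℝ} {r : A → A → ℝ} (h : IsKernel m r) :
    IsKernel m (pairW r) := isKernel_pairW h.nonneg h.rowSum

theorem IsKernel.iterate {m : A → ℝ} {r : A → A → ℝ} (h : IsKernel m r) (k : ℕ) :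
    IsKernel m (LocalInverse.pairW^[k] r) := by
  induction k with
  | zero => exact h
  | succ k ih => rw [Function.iterate_succ_apply']; exact ih.pairW

theorem IsKernel.sum_eq_one {m : A → ℝ} (hm : ∑ a, m a = 1) {r : A → A → ℝ} (h : IsKernel m r) :
    ∑ p : A × A, r p.1 p.2 = 1 := by
  rw [Fintype.sum_prod_type]
  simp only [h.rowSum, hm]

end Kernel

/-! ### Mass and images of doubled weights. -/

section Double
variable {W V Q : Type*} [Fintype W] [Fintype V] [DecidableEq V] [Fintype Q] [DecidableEq Q]

theorem pushW_dblW_of_injective [DecidableEq W] {q : W → Q} (hq : Function.Injective q)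
    (m : W → ℝ) (π : W × W → V) (v : V) :
    pushW π (dblW q m) v = pushW (fun w => π (w, w)) m v := by
  unfold pushW
  rw [Fintype.sum_prod_type]
  refine sum_congr rfl fun w _ => ?_
  rw [sum_eq_single w]
  · simp [dblW_of_injective hq]
  · intro w' _ h
    simp [dblW_of_injective hq, Ne.symm h]
  · simp

theorem sum_dblW (q : W → Q) {m : W → ℝ} (hm : ∀ w, 0 ≤ m w) : ∑ p, dblW q m p = ∑ w, m w := by
  rw [Fintype.sum_prod_type]
  refine sum_congr rfl fun w _ => ?_
  have h : ∀ w', dblW q m (w, w')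
      = m w / pushW q m (q w) * (if q w' = q w then m w' else 0) := by
    intro w'
    unfold dblW
    by_cases h : q w' = q w
    · simp [h]; ring
    · simp [h, Ne.symm h]
  simp only [h]
  rw [← mul_sum]
  change m w / pushW q m (q w) * pushW q m (q w) = m w
  by_cases h0 : pushW q m (q w) = 0
  · rw [h0, mul_zero]
    exact le_antisymm (hm w) (h0 ▸ le_pushW hm w)
  · field_simp

end Double

/-! ### Box averages along kernels and their doubling. -/

section Cross
variable {ι A : Type*} [Fintype ι] [DecidableEq ι] [Fintype A] [DecidableEq A]

/-- The product of the values of `f` at the four corners of a box. -/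
noncomputable def cross (S : ι → Bool) (f : (ι → A) → ℂ) (x y : ι → A) : ℂ :=
  f x * conj (f (mix S y x)) * conj (f (mix S x y)) * f y

/-- The sum of `cross S f` against a product of kernels. -/
noncomputable def crossSum (S : ι → Bool) (f : (ι → A) → ℂ) (r r' : A → A → ℝ) : ℂ :=
  psum (fun i (p : A × A) => if S i then r p.1 p.2 else r' p.1 p.2)
    fun w => cross S f (fun i => (w i).1) (fun i => (w i).2)

theorem crossSum_not (S : ι → Bool) (f : (ι → A) → ℂ) (r r' : A → A → ℝ) :
    crossSum (fun i => !S i) f r r' = crossSum S f r' r := by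
  unfold crossSum cross
  congr 1
  · funext i p
    by_cases h : S i <;> simp [h]
  · funext w
    simp only [mix_not]
    ring

/-- Two of the four corners depend, on the coordinates in `S`, only on `x`. Cauchy–Schwarz removes
them and doubles `y` given `x` on `S`; the two copies of `y` are the endpoints of a two-step walk of
`r`. Off `S` nothing is doubled and `r'` remains. -/
theorem norm_crossSum_sq_le (S : ι → Bool) (f : (ι → A) → ℂ) (hf : ∀ x, ‖f x‖ ≤ 1)
    {m : A → ℝ} (hm : ∑ a, m a = 1) {r r' : A → A → ℝ} (hr : IsKernel m r) (hr' : IsKernel m r') :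
    ‖crossSum S f r r'‖ ^ 2 ≤ ‖crossSum S f (pairW r) r'‖ := by
  set ρ : ι → A × A → ℝ := fun i p => if S i then r p.1 p.2 else r' p.1 p.2 with hρ
  set q : ι → A × A → A × A := fun i p => if S i then (p.1, p.1) else p with hq
  set H : (ι → A × A) → ℂ := fun u =>
    f (fun i => (u i).1) * conj (f (mix S (fun i => (u i).1) fun i => (u i).2)) with hH
  set F : (ι → A × A) → ℂ := fun w =>
    conj (f (mix S (fun i => (w i).2) fun i => (w i).1)) * f fun i => (w i).2 with hF
  set π : ι → (A × A) × (A × A) → A × A := fun i p =>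
    if S i then (p.2.2, p.1.2) else p.1 with hπ
  have hρ0 : ∀ i p, 0 ≤ ρ i p := by
    intro i p
    simp only [hρ]
    split_ifs
    exacts [hr.nonneg _ _, hr'.nonneg _ _]
  have hρ1 : ∀ i, ∑ p, ρ i p = 1 := by
    intro i
    simp only [hρ]
    split_ifs
    exacts [hr.sum_eq_one hm, hr'.sum_eq_one hm]
  have hH1 : ∀ u, ‖H u‖ ≤ 1 := by
    intro u
    simp only [hH, norm_mul, RCLike.norm_conj]
    exact mul_le_one₀ (hf _) (norm_nonneg _) (hf _)
  have key := norm_sq_psum_le ρ hρ0 hρ1 q F H hH1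
  have h1 : psum ρ (fun w => F w * H fun i => q i (w i)) = crossSum S f r r' := by
    unfold crossSum
    refine congrArg (psum ρ) ?_
    funext w
    have e1 : (fun i => (q i (w i)).1) = fun i => (w i).1 := by
      funext i
      simp only [hq]
      split_ifs <;> rfl
    have e2 : mix S (fun i => (w i).1) (fun i => (q i (w i)).2)
        = mix S (fun i => (w i).1) (fun i => (w i).2) := by
      funext i
      simp only [hq, mix]
      split_ifs <;> rfl
    simp only [hF, hH, e1, e2, cross]
    ring
  have h2 : psum (fun i => dblW (q i) (ρ i))
      (fun p => F (fun i => (p i).1) * conj (F fun i => (p i).2))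
      = psum (fun i => dblW (q i) (ρ i))
        (fun p => (fun v : ι → A × A => cross S f (fun i => (v i).1) fun i => (v i).2)
          fun i => π i (p i)) := by
    refine psum_congr fun p hp => ?_
    have hqq : ∀ i, q i (p i).1 = q i (p i).2 := by
      intro i
      by_contra h
      exact hp i (by simp [dblW, h])
    have a1 : ∀ i, (p i).1.1 = (p i).2.1 := by
      intro i
      have := hqq i
      simp only [hq] at this
      split_ifs at this
      · exact (Prod.mk.inj this).1
      · exact congrArg Prod.fst this
    have a2 : ∀ i, S i = false → (p i).1.2 = (p i).2.2 := by
      intro i hi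
      have := hqq i
      simp only [hq, hi] at this
      exact congrArg Prod.snd this
    have e1 : mix S (fun i => (p i).2.2) (fun i => (p i).2.1) = fun i => (π i (p i)).1 := by
      funext i
      cases hi : S i <;> simp [mix, hπ, hi, a1]
    have e2 : mix S (fun i => (p i).1.2) (fun i => (p i).1.1)
        = mix S (fun i => (π i (p i)).2) (fun i => (π i (p i)).1) := by
      funext i
      cases hi : S i <;> simp [mix, hπ, hi]
    have e3 : (fun i => (p i).2.2)
        = mix S (fun i => (π i (p i)).1) (fun i => (π i (p i)).2) := by
      funext i
      cases hi : S i
      · simp [mix, hπ, hi, a2 i hi]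
      · simp [mix, hπ, hi]
    have e4 : (fun i => (p i).1.2) = fun i => (π i (p i)).2 := by
      funext i
      cases hi : S i <;> simp [hπ, hi]
    simp only [hF, cross, map_mul, Complex.conj_conj]
    rw [e1, e2, e3, e4]
    ring
  have h3 : ∀ i v, pushW (π i) (dblW (q i) (ρ i)) v
      = if S i then pairW r v.1 v.2 else r' v.1 v.2 := by
    rintro i ⟨a, b⟩
    cases hi : S i
    · have hqi : q i = id := by funext p; simp [hq, hi]
      rw [hqi, pushW_dblW_of_injective Function.injective_id]
      simp [hπ, hi, pushW, hρ]
    · have hqi : q i = fun p => (p.1, p.1) := by funext p; simp [hq, hi]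
      have hρi : ρ i = fun p => r p.1 p.2 := by funext p; simp [hρ, hi]
      have e := pushW_dblW (fun p : A × A => p.2) (q i) (ρ i) b a
      have e' : pushW (π i) (dblW (q i) (ρ i)) (a, b) =
          pushW (fun p : (A × A) × A × A => (p.1.2, p.2.2)) (dblW (q i) (ρ i)) (b, a) := by
        unfold pushW
        refine sum_congr rfl fun p _ => ?_
        simp [hπ, hi, and_comm]
      have ej : ∀ c v, joint (fun p : A × A => p.2) (q i) (ρ i) c v
          = if v.1 = v.2 then r c v.1 else 0 := by
        rintro c ⟨v1, v2⟩
        rw [joint, hqi, hρi, Fintype.sum_prod_type]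
        simp only [Prod.mk.injEq]
        by_cases h : v1 = v2
        · subst h
          simp [ite_and, hr.symm c]
        · simp only [h, if_false]
          refine sum_eq_zero fun x _ => sum_eq_zero fun y _ => if_neg ?_
          rintro ⟨-, rfl, rfl⟩
          exact h rfl
      rw [e', e, pairW_comm]
      simp only [pairW, ej, Fintype.sum_prod_type, if_true]
      refine sum_congr rfl fun x _ => ?_
      rw [sum_eq_single x]
      · simp
      · intro y _ hy
        simp [Ne.symm hy]
      · simp
  rw [h1, h2, psum_push π _ fun v : ι → A × A =>
    cross S f (fun i => (v i).1) fun i => (v i).2] at key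
  refine key.trans_eq ?_
  unfold crossSum
  congr 2
  funext i v
  exact h3 i v

theorem norm_crossSum_pow_le (S : ι → Bool) (f : (ι → A) → ℂ) (hf : ∀ x, ‖f x‖ ≤ 1)
    {m : A → ℝ} (hm : ∑ a, m a = 1) {r r' : A → A → ℝ} (hr : IsKernel m r) (hr' : IsKernel m r')
    (k : ℕ) : ‖crossSum S f r r'‖ ^ 2 ^ k ≤ ‖crossSum S f (pairW^[k] r) r'‖ := by
  induction k with
  | zero => simp
  | succ k ih =>
    rw [pow_succ, pow_mul, Function.iterate_succ_apply']
    exact (pow_le_pow_left₀ (by positivity) ih 2).trans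
      (norm_crossSum_sq_le S f hf hm (hr.iterate k) hr')

/-- Complementing the cut exchanges the two kernels, so the second is iterated like the first. -/
theorem norm_crossSum_pow_le_both (S : ι → Bool) (f : (ι → A) → ℂ) (hf : ∀ x, ‖f x‖ ≤ 1)
    {m : A → ℝ} (hm : ∑ a, m a = 1) {r r' : A → A → ℝ} (hr : IsKernel m r) (hr' : IsKernel m r')
    (k : ℕ) : ‖crossSum S f r r'‖ ^ 2 ^ (2 * k)
      ≤ ‖crossSum S f (pairW^[k] r) (pairW^[k] r')‖ := by
  rw [two_mul, pow_add, pow_mul]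
  refine (pow_le_pow_left₀ (by positivity) (norm_crossSum_pow_le S f hf hm hr hr' k) _).trans ?_
  rw [← crossSum_not S f r', ← crossSum_not S f (pairW^[k] r')]
  exact norm_crossSum_pow_le _ f hf hm hr' (hr.iterate k) k

end Cross

/-! ### Eliminating two of the three functions -/

section ThreeFunctions
variable {ι A B C : Type*} [Fintype ι] [DecidableEq ι] [Fintype A] [DecidableEq A]
  [Fintype B] [DecidableEq B] [Fintype C] [DecidableEq C]

theorem joint_fst_eq_margXZ (μ : A × B × C → ℝ) (a : A) (v : C ⊕ A × B × C) :
    joint (fun w : A × B × C => w.1) (fun w => (Sum.inl w.2.2 : C ⊕ A × B × C)) μ a v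
      = Sum.elim (margXZ μ a) (fun _ => 0) v := by
  cases v with
  | inl c =>
    simp only [joint, margXZ, Sum.elim_inl, Sum.inl.injEq, Fintype.sum_prod_type, ite_and]
    rw [sum_eq_single a]
    · simp
    · intro b _ hb
      simp [hb]
    · simp
  | inr w => simp [joint]

theorem joint_fst_eq_margXY (μ : A × B × C → ℝ) (m : (A × B × C) × A × B × C → ℝ)
    (hm : ∀ p, m p = if p.1 = p.2 then μ p.1 else 0) (a : A)
    (v : B ⊕ (A × B × C) × A × B × C) :
    joint (fun p : (A × B × C) × A × B × C => p.1.1)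
      (fun p => (Sum.inl p.1.2.1 : B ⊕ (A × B × C) × A × B × C)) m a v
      = Sum.elim (margXY μ a) (fun _ => 0) v := by
  cases v with
  | inl b =>
    have h : joint (fun p : (A × B × C) × A × B × C => p.1.1)
      (fun p => (Sum.inl p.1.2.1 : B ⊕ (A × B × C) × A × B × C)) m a (Sum.inl b)
      = ∑ w : A × B × C, if w.1 = a ∧ w.2.1 = b then μ w else 0 := by
      simp only [joint, hm, Sum.inl.injEq]
      rw [Fintype.sum_prod_type]
      refine sum_congr rfl fun w _ => ?_
      by_cases hw : w.1 = a ∧ w.2.1 = b <;> simp [hw]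
    rw [h]
    simp only [margXY, Sum.elim_inl, Fintype.sum_prod_type, ite_and]
    rw [sum_eq_single a]
    · simp only [if_true]
      rw [sum_eq_single b]
      · simp
      · intro b' _ hb
        simp [hb]
      · simp
    · intro b _ hb
      simp [hb]
    · simp
  | inr w => simp [joint]

theorem pairW_sumElim {V Y : Type*} [Fintype V] [Fintype Y] (P : A → V → ℝ) (a b : A) :
    pairW (fun a (v : V ⊕ Y) => Sum.elim (P a) (fun _ => 0) v) a b = pairW P a b := by
  simp [pairW]

/-- The first Cauchy–Schwarz step doubles over the `C`-letter on `S` and removes `h`. The two copies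
of `g` then agree off `S`, so the second step, doubling over the `B`-letter off `S` only, removes
both. -/
theorem norm_corr_pow_four_le (S : ι → Bool) {μ : A × B × C → ℝ}
    (hμ : μ ∈ stdSimplex ℝ (A × B × C)) (f : (ι → A) → ℂ) (g : (ι → B) → ℂ) (h : (ι → C) → ℂ)
    (hg : ∀ y, ‖g y‖ ≤ 1) (hh : ∀ z, ‖h z‖ ≤ 1) :
    ‖psum (fun _ : ι => μ) (fun w => f (fun i => (w i).1) * g (fun i => (w i).2.1)
        * h fun i => (w i).2.2)‖ ^ 4
      ≤ ‖crossSum S f (pairW (margXZ μ)) (pairW (margXY μ))‖ := by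
  -- The sum type records just the letter of `C` where doubling takes place and the full atom
  -- elsewhere.
  set q : ι → A × B × C → C ⊕ A × B × C := fun i w => if S i then Sum.inl w.2.2 else Sum.inr w
    with hq
  set m : ι → (A × B × C) × A × B × C → ℝ := fun i => dblW (q i) μ with hm
  set q' : ι → (A × B × C) × A × B × C → B ⊕ (A × B × C) × A × B × C :=
    fun i p => if S i then Sum.inr p else Sum.inl p.1.2.1 with hq'
  set F : (ι → A × B × C) → ℂ := fun w => f (fun i => (w i).1) * g (fun i => (w i).2.1) with hF
  set F' : (ι → (A × B × C) × A × B × C) → ℂ := fun p =>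
    f (fun i => (p i).1.1) * conj (f fun i => (p i).2.1) with hF'
  set H : (ι → C ⊕ A × B × C) → ℂ := fun u => h fun i => Sum.elim id (fun w => w.2.2) (u i) with hH
  set H' : (ι → B ⊕ (A × B × C) × A × B × C) → ℂ := fun u =>
    g (fun i => Sum.elim id (fun p => p.1.2.1) (u i))
      * conj (g fun i => Sum.elim id (fun p => p.2.2.1) (u i)) with hH'
  set π : ι → ((A × B × C) × A × B × C) × (A × B × C) × A × B × C → A × A := fun i p =>
    if S i then (p.1.1.1, p.1.2.1) else (p.1.1.1, p.2.1.1) with hπ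
  have hm0 : ∀ i p, 0 ≤ m i p := fun i => dblW_nonneg hμ.1
  have hm1 : ∀ i, ∑ p, m i p = 1 := fun i => (sum_dblW (q i) hμ.1).trans hμ.2
  have hmoff : ∀ i, S i = false → ∀ p, m i p = if p.1 = p.2 then μ p.1 else 0 := by
    intro i hi p
    have hqi : q i = Sum.inr := by funext w; simp [hq, hi]
    simp only [hm]
    rw [hqi]
    exact dblW_of_injective Sum.inr_injective μ p
  have k1 := norm_sq_psum_le (fun _ : ι => μ) (fun _ => hμ.1) (fun _ => hμ.2) q F H fun u => hh _
  have k2 := norm_sq_psum_le m hm0 hm1 q' F' H' (by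
    intro u
    simp only [hH', norm_mul, RCLike.norm_conj]
    exact mul_le_one₀ (hg _) (norm_nonneg _) (hg _))
  have e1 : (psum (fun _ : ι => μ) fun w => F w * H fun i => q i (w i))
      = psum (fun _ : ι => μ) (fun w => f (fun i => (w i).1) * g (fun i => (w i).2.1)
        * h fun i => (w i).2.2) := by
    congr 1
    funext w
    have : (fun i => Sum.elim id (fun w : A × B × C => w.2.2) (q i (w i)))
        = fun i => (w i).2.2 := by
      funext i
      cases hi : S i <;> simp [hq, hi]
    simp only [hF, hH, this]
  have e2 : (psum m fun p => F (fun i => (p i).1) * conj (F fun i => (p i).2))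
      = psum m fun p => F' p * H' fun i => q' i (p i) := by
    refine psum_congr fun p hp => ?_
    have a1 : (fun i => Sum.elim id (fun p : (A × B × C) × A × B × C => p.1.2.1) (q' i (p i)))
        = fun i => (p i).1.2.1 := by
      funext i
      cases hi : S i <;> simp [hq', hi]
    have a2 : (fun i => Sum.elim id (fun p : (A × B × C) × A × B × C => p.2.2.1) (q' i (p i)))
        = fun i => (p i).2.2.1 := by
      funext i
      cases hi : S i
      · have h1 := hp i
        rw [hmoff i hi] at h1
        have h2 : (p i).1 = (p i).2 := by
          by_contra h3
          simp [h3] at h1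
        simp [hq', hi, h2]
      · simp [hq', hi]
    simp only [hF, hF', hH', a1, a2, map_mul]
    ring
  have e3 : psum (fun i => dblW (q' i) (m i))
      (fun p => F' (fun i => (p i).1) * conj (F' fun i => (p i).2))
      = psum (fun i => dblW (q' i) (m i))
        (fun p => (fun v : ι → A × A => cross S f (fun i => (v i).1) fun i => (v i).2)
          fun i => π i (p i)) := by
    refine psum_congr fun p hp => ?_
    have hon : ∀ i, S i = true → (p i).1 = (p i).2 := by
      intro i hi
      by_contra h3
      refine hp i ?_
      simp [dblW, hq', hi, h3]
    have hoff : ∀ i, S i = false → (p i).1.1 = (p i).1.2 ∧ (p i).2.1 = (p i).2.2 := by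
      intro i hi
      have h1 := hp i
      refine ⟨?_, ?_⟩ <;> by_contra h3 <;> refine h1 ?_ <;> simp [dblW, hmoff i hi, h3]
    have a1 : (fun i => (π i (p i)).1) = fun i => (p i).1.1.1 := by
      funext i
      cases hi : S i <;> simp [hπ, hi]
    have a2 : (fun i => (π i (p i)).2) = fun i => (p i).2.2.1 := by
      funext i
      cases hi : S i
      · simp [hπ, hi, (hoff i hi).2]
      · simp [hπ, hi, hon i hi]
    have a3 : mix S (fun i => (p i).2.2.1) (fun i => (p i).1.1.1) = fun i => (p i).1.2.1 := by
      funext i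
      cases hi : S i
      · simp [mix, hi, (hoff i hi).1]
      · simp [mix, hi, hon i hi]
    have a4 : mix S (fun i => (p i).1.1.1) (fun i => (p i).2.2.1) = fun i => (p i).2.1.1 := by
      funext i
      cases hi : S i
      · simp [mix, hi, (hoff i hi).2]
      · simp [mix, hi, hon i hi]
    simp only [hF', cross, map_mul, Complex.conj_conj, a1, a2, a3, a4]
    ring
  have e4 : ∀ i v, pushW (π i) (dblW (q' i) (m i)) v
      = if S i then pairW (margXZ μ) v.1 v.2 else pairW (margXY μ) v.1 v.2 := by
    rintro i ⟨a, b⟩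
    cases hi : S i
    · have hqi : q' i = fun p => Sum.inl p.1.2.1 := by funext p; simp [hq', hi]
      have hπi : π i = fun p => (p.1.1.1, p.2.1.1) := by funext p; simp [hπ, hi]
      rw [hqi, hπi]
      rw [pushW_dblW (fun p : (A × B × C) × A × B × C => p.1.1)]
      rw [funext₂ (joint_fst_eq_margXY μ (m i) (hmoff i hi)), pairW_sumElim]
      simp
    · have hqi : q' i = Sum.inr := by funext p; simp [hq', hi]
      have hπi : π i = fun p => (p.1.1.1, p.1.2.1) := by funext p; simp [hπ, hi]
      have hqj : q i = fun w => Sum.inl w.2.2 := by funext p; simp [hq, hi]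
      rw [hqi, hπi, pushW_dblW_of_injective Sum.inr_injective]
      simp only [hm]
      rw [hqj, pushW_dblW (fun w : A × B × C => w.1), funext₂ (joint_fst_eq_margXZ μ),
        pairW_sumElim]
      simp
  rw [e1, e2] at k1
  rw [e3, psum_push π _ fun v : ι → A × A =>
    cross S f (fun i => (v i).1) fun i => (v i).2] at k2
  calc _ = (‖psum (fun _ : ι => μ) (fun w => f (fun i => (w i).1) * g (fun i => (w i).2.1)
        * h fun i => (w i).2.2)‖ ^ 2) ^ 2 := by rw [← pow_mul]
    _ ≤ _ := pow_le_pow_left₀ (by positivity) k1 2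
    _ ≤ _ := k2
    _ = _ := by
      unfold crossSum
      congr 2
      funext i v
      exact e4 i v

end ThreeFunctions

/-! ### Connectivity gives a lower bound for iterated kernels -/

section Connectivity
variable {A V : Type*}

/-- The graph on `A` whose edges are pairs with a common neighbour in the support of `P`. -/
def commonGraph (P : A → V → ℝ) : SimpleGraph A :=
  SimpleGraph.fromRel fun a b => ∃ v, P a v ≠ 0 ∧ P b v ≠ 0

theorem exists_ne_zero_of_connected {P : A → V → ℝ} (h : (supportGraph P).Connected)
    [Nonempty V] (a : A) : ∃ v, P a v ≠ 0 := by
  obtain ⟨v⟩ := ‹Nonempty V›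
  obtain ⟨w⟩ := h.preconnected (Sum.inl a) (Sum.inr v)
  cases w with
  | cons hadj _ =>
    rw [supportGraph, SimpleGraph.fromRel_adj] at hadj
    obtain ⟨-, ⟨a', b', h1, h2, h3⟩ | ⟨a', b', h1, h2, h3⟩⟩ := hadj
    · obtain rfl := Sum.inl_injective h1
      exact ⟨b', h3⟩
    · simp at h2

theorem commonGraph_reachable {P : A → V → ℝ} (h : (supportGraph P).Connected) (a b : A) :
    (commonGraph P).Reachable a b := by
  have key : ∀ u, (supportGraph P).Reachable (Sum.inl a) u →
      Sum.elim (fun b => (commonGraph P).Reachable a b)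
        (fun v => ∀ c, P c v ≠ 0 → (commonGraph P).Reachable a c) u := by
    intro u hu
    rw [SimpleGraph.reachable_iff_reflTransGen] at hu
    induction hu with
    | refl => exact SimpleGraph.Reachable.refl a
    | @tail u u' _ hadj ih =>
      rw [supportGraph, SimpleGraph.fromRel_adj] at hadj
      obtain ⟨-, ⟨a', b', rfl, rfl, h3⟩ | ⟨a', b', rfl, rfl, h3⟩⟩ := hadj
      · intro c hc
        simp only [Sum.elim_inl] at ih
        by_cases hac : a' = c
        · exact hac ▸ ih
        · refine ih.trans (SimpleGraph.Adj.reachable ?_)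
          rw [commonGraph, SimpleGraph.fromRel_adj]
          exact ⟨hac, Or.inl ⟨b', h3, hc⟩⟩
      · exact ih a' h3
  exact key (Sum.inl b) (h.preconnected _ _)

/-- A walk of length at most `2 ^ (k + 1)` is cut after `2 ^ k` steps, and the two-step kernel is
bounded below by the term of the intermediate vertex. Its denominator is a mass at most `1`. -/
theorem le_iterate_pairW [Fintype A] [Fintype V] {P : A → V → ℝ} (hP : ∀ a v, 0 ≤ P a v)
    {m : A → ℝ} (hm : ∀ a, ∑ v, P a v = m a) (hm1 : ∑ a, m a = 1) {α : ℝ} (hα : 0 < α)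
    (hatom : ∀ a v, P a v ≠ 0 → α ≤ P a v) (hex : ∀ a, ∃ v, P a v ≠ 0) (k : ℕ) :
    ∀ (a b : A) (w : (commonGraph P).Walk a b), w.length ≤ 2 ^ k →
      α ^ 2 ^ (k + 1) ≤ pairW^[k] (pairW P) a b := by
  have hcol : ∀ v, ∑ c, P c v ≤ 1 := by
    intro v
    rw [← hm1]
    refine sum_le_sum fun c _ => ?_
    rw [← hm c]
    exact single_le_sum (fun v _ => hP c v) (mem_univ v)
  have hm0 : ∀ a, 0 ≤ m a := fun a => hm a ▸ sum_nonneg fun v _ => hP a v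
  have hE : ∀ a b, (∃ v, P a v ≠ 0 ∧ P b v ≠ 0) → α ^ 2 ≤ pairW P a b := by
    rintro a b ⟨v, ha, hb⟩
    refine le_trans ?_ (mul_le_pairW hP (hcol v) a b)
    rw [sq]
    exact mul_le_mul (hatom a v ha) (hatom b v hb) hα.le (hP a v)
  induction k with
  | zero =>
    intro a b w hw
    simp only [zero_add, pow_one, Function.iterate_zero, id]
    cases w with
    | nil =>
      obtain ⟨v, hv⟩ := hex a
      exact hE a a ⟨v, hv, hv⟩
    | @cons _ c _ hadj w' =>
      have h0 : w'.length = 0 := by simpa using hw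
      obtain rfl := SimpleGraph.Walk.eq_of_length_eq_zero h0
      rw [commonGraph, SimpleGraph.fromRel_adj] at hadj
      obtain ⟨-, h | ⟨v, h1, h2⟩⟩ := hadj
      · exact hE _ _ h
      · exact hE _ _ ⟨v, h2, h1⟩
  | succ k ih =>
    intro a b w hw
    have h1 := ih a (w.getVert (2 ^ k)) (w.take (2 ^ k)) (by
      rw [SimpleGraph.Walk.take_length]; exact min_le_left _ _)
    have h2 := ih (w.getVert (2 ^ k)) b (w.drop (2 ^ k)) (by
      rw [SimpleGraph.Walk.drop_length]
      rw [pow_succ] at hw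
      omega)
    have hK : IsKernel m (pairW^[k] (pairW P)) := (isKernel_pairW hP hm).iterate k
    rw [Function.iterate_succ_apply']
    refine le_trans ?_ (mul_le_pairW hK.nonneg (v := w.getVert (2 ^ k)) ?_ a b)
    · rw [hK.symm b, pow_succ 2 (k + 1), pow_mul, sq]
      exact mul_le_mul h1 h2 (by positivity) (hK.nonneg _ _)
    · simp only [fun c => hK.symm c (w.getVert (2 ^ k))]
      rw [hK.rowSum, ← hm1]
      exact single_le_sum (fun a _ => hm0 a) (mem_univ _)

theorem le_iterate_pairW_of_connected [Fintype A] [Fintype V] [Nonempty V] {P : A → V → ℝ}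
    (hP : ∀ a v, 0 ≤ P a v) {m : A → ℝ} (hm : ∀ a, ∑ v, P a v = m a) (hm1 : ∑ a, m a = 1)
    {α : ℝ} (hα : 0 < α) (hatom : ∀ a v, P a v ≠ 0 → α ≤ P a v)
    (hconn : (supportGraph P).Connected) {k : ℕ} (hk : Fintype.card A ≤ 2 ^ k) (a b : A) :
    α ^ 2 ^ (k + 1) ≤ pairW^[k] (pairW P) a b := by
  classical
  obtain ⟨w⟩ := commonGraph_reachable hconn a b
  have h := w.toPath.2.length_lt
  exact le_iterate_pairW hP hm hm1 hα hatom (exists_ne_zero_of_connected hconn) k a b w.toPath.1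
    (h.le.trans hk)

end Connectivity

/-! ### Random restrictions encoded by optional values -/

section Fill
variable {ι A W V : Type*} [Fintype ι] [DecidableEq ι] [Fintype A] [DecidableEq A]
  [Fintype W] [DecidableEq W] [Fintype V] [DecidableEq V]

/-- The real-valued sum against the product of the weights `m i`. -/
noncomputable def wsum (m : ι → W → ℝ) (G : (ι → W) → ℝ) : ℝ :=
  ∑ w : ι → W, (∏ i, m i (w i)) * G w

theorem wsum_push (π : ι → W → V) (m : ι → W → ℝ) (G : (ι → V) → ℝ) :
    wsum m (fun w => G fun i => π i (w i)) = wsum (fun i => pushW (π i) (m i)) G := by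
  unfold wsum
  rw [← sum_pushW_mul (fun (w : ι → W) i => π i (w i)) (fun w => ∏ i, m i (w i)) G]
  simp only [pushW_pi]

theorem wsum_mono {m : ι → W → ℝ} (hm : ∀ i w, 0 ≤ m i w) {G G' : (ι → W) → ℝ}
    (h : ∀ w, G w ≤ G' w) : wsum m G ≤ wsum m G' :=
  sum_le_sum fun w _ => mul_le_mul_of_nonneg_left (h w) (prod_nonneg fun i _ => hm i _)

theorem psum_div_card (σ : ι → W → ℝ) (G : (ι → W × A) → ℂ) :
    psum (fun i (p : W × A) => σ i p.1 / Fintype.card A) G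
      = psum σ fun w => 𝔼 t : ι → A, G fun i => (w i, t i) := by
  unfold psum
  refine (Fintype.sum_equiv (Equiv.arrowProdEquivProdArrow ι (fun _ => W) (fun _ => A)) _
    (fun p : (ι → W) × (ι → A) => ((∏ i, σ i (p.1 i) / Fintype.card A : ℝ) : ℂ)
      * G fun i => (p.1 i, p.2 i)) fun p => rfl).trans ?_
  rw [Fintype.sum_prod_type]
  refine sum_congr rfl fun w _ => ?_
  dsimp only
  rw [expect_eq_sum_div, ← mul_sum, prod_div_distrib, prod_const, card_univ, Fintype.card_fun]
  push_cast
  ring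

/-- Fill the unset coordinates of `c` by those of `t`. -/
def fill (c : ι → Option A) (t : ι → A) : ι → A := fun i => (c i).getD (t i)

/-- The law on `Option A` giving `none` mass `β` and completing to `m` by the uniform law. -/
noncomputable def optLaw (β : ℝ) (m : A → ℝ) (o : Option A) : ℝ :=
  o.elim β fun a => m a - β / Fintype.card A

/-- For fixed `y`, each mixed corner depends on the free coordinates from one side of the cut only,
so those corners are bounded row and column factors against `f`. -/
theorem norm_expect_cross_le [Nonempty A] (S : ι → Bool) (f : (ι → A) → ℂ) (hf : ∀ x, ‖f x‖ ≤ 1)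
    (c : ι → Option A) (y : ι → A) :
    ‖𝔼 t, cross S f (fill c t) y‖ ^ 4 ≤ box S fun t => f (fill c t) := by
  have hfill : ∀ u v, fill c (mix S u v) = mix S (fill c u) (fill c v) := by
    intro u v
    funext i
    by_cases h : S i <;> simp [fill, mix, h]
  rw [← expect_mix S]
  have e : ∀ u v, cross S f (fill c (mix S u v)) y
      = f (fill c (mix S u v)) * (conj (f (mix S (fill c u) y)) * f y)
        * conj (f (mix S y (fill c v))) := by
    intro u v
    simp only [cross, hfill, mix_mix_left, mix_mix_right]
    ring
  simp only [e]
  refine norm_expect_mul_mul_le_bx _ _ _ (fun u => ?_) fun v => ?_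
  · simp only [norm_mul, RCLike.norm_conj]
    exact mul_le_one₀ (hf _) (norm_nonneg _) (hf _)
  · simpa using hf _

/-- Each kernel is split as `β * m b / |A|` plus a nonnegative remainder. The first part resamples
the letter of `x` uniformly and independently of `y`, and is recorded as `none`; the rest fixes that
letter. -/
theorem norm_crossSum_pow_four_le [Nonempty A] (S : ι → Bool) (f : (ι → A) → ℂ)
    (hf : ∀ x, ‖f x‖ ≤ 1) {m : A → ℝ} (hm0 : ∀ a, 0 ≤ m a) (hm : ∑ a, m a = 1)
    {r r' : A → A → ℝ} (hr : IsKernel m r) (hr' : IsKernel m r') {β : ℝ} (hβ : 0 ≤ β)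
    (h1 : ∀ a b, β ≤ r a b) (h2 : ∀ a b, β ≤ r' a b) :
    ‖crossSum S f r r'‖ ^ 4
      ≤ wsum (fun _ : ι => optLaw β m) fun c => box S fun t => f (fill c t) := by
  set ρ : ι → A → A → ℝ := fun i => if S i then r else r' with hρ
  have hK : ∀ i, IsKernel m (ρ i) := by
    intro i
    simp only [hρ]
    split_ifs
    exacts [hr, hr']
  have hβρ : ∀ i a b, β ≤ ρ i a b := by
    intro i
    simp only [hρ]
    split_ifs
    exacts [h1, h2]
  set σ : ι → Option A × A → ℝ := fun i w =>
    w.1.elim (β * m w.2) fun a => ρ i a w.2 - β * m w.2 / Fintype.card A with hσ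
  have hcard : (1 : ℝ) ≤ Fintype.card A := by exact_mod_cast Fintype.card_pos
  have hm1 : ∀ a, m a ≤ 1 := fun a => hm ▸ single_le_sum (fun a _ => hm0 a) (mem_univ a)
  have hσ0 : ∀ i w, 0 ≤ σ i w := by
    rintro i ⟨o, b⟩
    cases o with
    | none => exact mul_nonneg hβ (hm0 b)
    | some a =>
      have h3 : β * m b / Fintype.card A ≤ β :=
        (div_le_self (mul_nonneg hβ (hm0 b)) hcard).trans (mul_le_of_le_one_right hβ (hm1 b))
      exact sub_nonneg.2 (h3.trans (hβρ i a b))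
  have hpush : ∀ i, pushW (fun w : Option A × A => w.1) (σ i) = optLaw β m := by
    intro i
    funext o
    have e : pushW (fun w : Option A × A => w.1) (σ i) o = ∑ b, σ i (o, b) := by
      unfold pushW
      rw [Fintype.sum_prod_type, sum_eq_single o]
      · simp
      · intro o' _ ho
        simp [ho]
      · simp
    rw [e]
    cases o with
    | none => simp [hσ, optLaw, ← mul_sum, hm]
    | some a => simp [hσ, optLaw, ← sum_div, ← mul_sum, hm, (hK i).rowSum]
  have hσ1 : ∀ i, ∑ w, σ i w = 1 := by
    intro i
    rw [← sum_pushW (fun w : Option A × A => w.1), hpush i, Fintype.sum_option]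
    simp only [optLaw, Option.elim, sum_sub_distrib, hm, sum_const, card_univ, nsmul_eq_mul]
    field_simp
    ring
  have e1 : crossSum S f r r'
      = psum σ fun w => 𝔼 t, cross S f (fill (fun i => (w i).1) t) fun i => (w i).2 := by
    rw [← psum_div_card σ fun p : ι → (Option A × A) × A =>
      cross S f (fill (fun i => (p i).1.1) fun i => (p i).2) fun i => (p i).1.2]
    have := psum_push (fun (_ : ι) (p : (Option A × A) × A) => (p.1.1.getD p.2, p.1.2))
      (fun i (p : (Option A × A) × A) => σ i p.1 / Fintype.card A)
      fun v : ι → A × A => cross S f (fun i => (v i).1) fun i => (v i).2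
    refine Eq.trans ?_ this.symm
    unfold crossSum
    congr 1
    funext i p
    obtain ⟨a, b⟩ := p
    have hρi : (if S i = true then r a b else r' a b) = ρ i a b := by
      simp only [hρ]
      split_ifs <;> rfl
    rw [hρi]
    simp only [pushW, Fintype.sum_prod_type, Fintype.sum_option, Prod.mk.injEq, Option.getD_none,
      Option.getD_some, hσ, Option.elim, ite_and]
    simp
    field_simp
    ring
  rw [e1]
  have n1 : ‖psum σ fun w => 𝔼 t, cross S f (fill (fun i => (w i).1) t) fun i => (w i).2‖
      ≤ ∑ w : ι → Option A × A, (∏ i, σ i (w i))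
        * ‖𝔼 t, cross S f (fill (fun i => (w i).1) t) fun i => (w i).2‖ := by
    refine (norm_sum_le _ _).trans (sum_le_sum fun w _ => ?_)
    rw [norm_mul, Complex.norm_real, Real.norm_of_nonneg (prod_nonneg fun i _ => hσ0 i _)]
  refine (pow_le_pow_left₀ (norm_nonneg _) n1 4).trans ?_
  -- Convexity moves the fourth power inside the average over `c` and `y`; the bound for fixed `c`
  -- no longer involves `y`.
  refine (Real.pow_arith_mean_le_arith_mean_pow univ _ _
    (fun w _ => prod_nonneg fun i _ => hσ0 i _) (sum_prod_weights hσ1)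
    (fun w _ => norm_nonneg _) 4).trans ?_
  have e2 := wsum_push (fun (_ : ι) (w : Option A × A) => w.1) σ
    fun c => box S fun t => f (fill c t)
  simp only [hpush] at e2
  rw [← e2]
  exact wsum_mono hσ0 fun w => norm_expect_cross_le S f hf _ _

end Fill

/-! ### A large average box norm after a random restriction -/

section Marginals
variable {A B C : Type*} [Fintype A] [Fintype B] [Fintype C] {μ : A × B × C → ℝ}

theorem margXY_nonneg (hμ : ∀ w, 0 ≤ μ w) (a : A) (b : B) : 0 ≤ margXY μ a b :=
  sum_nonneg fun _ _ => hμ _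

theorem margXZ_nonneg (hμ : ∀ w, 0 ≤ μ w) (a : A) (c : C) : 0 ≤ margXZ μ a c :=
  sum_nonneg fun _ _ => hμ _

theorem margX_nonneg (hμ : ∀ w, 0 ≤ μ w) (a : A) : 0 ≤ margX μ a :=
  sum_nonneg fun _ _ => sum_nonneg fun _ _ => hμ _

theorem sum_margXY (a : A) : ∑ b, margXY μ a b = margX μ a := rfl

theorem sum_margXZ (a : A) : ∑ c, margXZ μ a c = margX μ a := sum_comm

theorem sum_margX (hμ : ∑ w, μ w = 1) : ∑ a, margX μ a = 1 := by
  rw [← hμ, Fintype.sum_prod_type]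
  simp only [margX, Fintype.sum_prod_type]

theorem le_sum_of_atom {J : Type*} [Fintype J] {F : J → ℝ} (h0 : ∀ j, 0 ≤ F j) {α : ℝ}
    (hα : ∀ j, F j ≠ 0 → α ≤ F j) (h : ∑ j, F j ≠ 0) : α ≤ ∑ j, F j := by
  obtain ⟨j, hj, hne⟩ := exists_ne_zero_of_sum_ne_zero h
  exact (hα j hne).trans (single_le_sum (fun j _ => h0 j) hj)

theorem le_margXY (hμ : ∀ w, 0 ≤ μ w) {α : ℝ} (hα : ∀ w, μ w ≠ 0 → α ≤ μ w) (a : A) (b : B)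
    (h : margXY μ a b ≠ 0) : α ≤ margXY μ a b :=
  le_sum_of_atom (fun _ => hμ _) (fun _ => hα _) h

theorem le_margXZ (hμ : ∀ w, 0 ≤ μ w) {α : ℝ} (hα : ∀ w, μ w ≠ 0 → α ≤ μ w) (a : A) (c : C)
    (h : margXZ μ a c ≠ 0) : α ≤ margXZ μ a c :=
  le_sum_of_atom (fun _ => hμ _) (fun _ => hα _) h

theorem le_margX [Nonempty B] (hμ : ∀ w, 0 ≤ μ w) {α : ℝ} (hα : ∀ w, μ w ≠ 0 → α ≤ μ w)
    (hconn : (supportGraph (margXY μ)).Connected) (a : A) : α ≤ margX μ a := by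
  obtain ⟨b, hb⟩ := exists_ne_zero_of_connected hconn a
  exact (le_margXY hμ hα a b hb).trans
    (single_le_sum (fun b _ => margXY_nonneg hμ a b) (mem_univ b))

variable {ι : Type*} [Fintype ι] [DecidableEq ι] [DecidableEq A]

theorem expect_wsum {W X : Type*} [Fintype W] [Fintype X] (m : ι → W → ℝ)
    (G : X → (ι → W) → ℝ) : 𝔼 x, wsum m (G x) = wsum m fun w => 𝔼 x, G x w := by
  unfold wsum
  rw [Finset.expect_sum_comm]
  simp only [mul_expect]

/-- The exponent collects a factor `4` for removing `g` and `h`, `2 ^ (2 * k)` for iterating both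
kernels, and `4` for passing to the box functional. -/
theorem pow_le_wsum_avgBox [Nonempty A] [Nonempty B] [Nonempty C]
    (hμ : μ ∈ stdSimplex ℝ (A × B × C)) (hconn : PairwiseConnected μ) {α : ℝ} (hα0 : 0 < α)
    (hα : ∀ w, μ w ≠ 0 → α ≤ μ w) {k : ℕ} (hk : Fintype.card A ≤ 2 ^ k)
    {f : (ι → A) → ℂ} {g : (ι → B) → ℂ} {h : (ι → C) → ℂ}
    (hf : ∀ x, ‖f x‖ ≤ 1) (hg : ∀ y, ‖g y‖ ≤ 1) (hh : ∀ z, ‖h z‖ ≤ 1) {ε : ℝ} (hε0 : 0 ≤ ε)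
    (hε : ε ≤ ‖psum (fun _ : ι => μ) (fun w => f (fun i => (w i).1) * g (fun i => (w i).2.1)
        * h fun i => (w i).2.2)‖) :
    ε ^ (4 * 2 ^ (2 * k) * 4) ≤ wsum (fun _ : ι => optLaw (α ^ 2 ^ (k + 1)) (margX μ))
      fun c => avgBox fun t => f (fill c t) := by
  classical
  have hm1 := sum_margX hμ.2
  have hXZ : IsKernel (margX μ) (pairW (margXZ μ)) :=
    isKernel_pairW (margXZ_nonneg hμ.1) sum_margXZ
  have hXY : IsKernel (margX μ) (pairW (margXY μ)) :=
    isKernel_pairW (margXY_nonneg hμ.1) sum_margXY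
  have key : ∀ S : ι → Bool, ε ^ (4 * 2 ^ (2 * k) * 4)
      ≤ wsum (fun _ : ι => optLaw (α ^ 2 ^ (k + 1)) (margX μ))
        fun c => box S fun t => f (fill c t) := by
    intro S
    have k1 := (pow_le_pow_left₀ hε0 hε 4).trans (norm_corr_pow_four_le S hμ f g h hg hh)
    have k2 := (pow_le_pow_left₀ (by positivity) k1 (2 ^ (2 * k))).trans
      (norm_crossSum_pow_le_both S f hf hm1 hXZ hXY k)
    have k3 := (pow_le_pow_left₀ (by positivity) k2 4).trans
      (norm_crossSum_pow_four_le S f hf (margX_nonneg hμ.1) hm1 (hXZ.iterate k) (hXY.iterate k)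
        (β := α ^ 2 ^ (k + 1)) (by positivity)
        (le_iterate_pairW_of_connected (margXZ_nonneg hμ.1) sum_margXZ hm1 hα0
          (le_margXZ hμ.1 hα) hconn.2.1 hk)
        (le_iterate_pairW_of_connected (margXY_nonneg hμ.1) sum_margXY hm1 hα0
          (le_margXY hμ.1 hα) hconn.1 hk))
    rwa [← pow_mul, ← pow_mul, ← mul_assoc] at k3
  calc _ = 𝔼 _S : ι → Bool, ε ^ (4 * 2 ^ (2 * k) * 4) := (Fintype.expect_const _).symm
    _ ≤ _ := expect_mono key
    _ = _ := expect_wsum _ _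

end Marginals

/-! ### Composition of random restrictions -/

section Compose
variable {ι A W V : Type*} [Fintype ι] [DecidableEq ι] [Fintype A] [DecidableEq A]
  [Fintype W] [DecidableEq W] [Fintype V] [DecidableEq V]

theorem wsum_wsum (m : ι → W → ℝ) (m' : ι → V → ℝ) (G : (ι → W) → (ι → V) → ℝ) :
    wsum m (fun w => wsum m' fun v => G w v)
      = wsum (fun i (p : W × V) => m i p.1 * m' i p.2)
        fun p => G (fun i => (p i).1) fun i => (p i).2 := by
  unfold wsum
  symm
  refine (Fintype.sum_equiv (Equiv.arrowProdEquivProdArrow ι (fun _ => W) (fun _ => V)) _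
    (fun p : (ι → W) × (ι → V) => (∏ i, m i (p.1 i) * m' i (p.2 i)) * G p.1 p.2)
    fun p => rfl).trans ?_
  rw [Fintype.sum_prod_type]
  refine sum_congr rfl fun w _ => ?_
  rw [mul_sum]
  refine sum_congr rfl fun v _ => ?_
  rw [prod_mul_distrib]
  ring

theorem expect_eq_wsum (G : (ι → V) → ℝ) :
    𝔼 t, G t = wsum (fun _ _ => 1 / (Fintype.card V : ℝ)) G := by
  rw [Fintype.expect_eq_sum_div_card, wsum, ← mul_sum, prod_const, card_univ, Fintype.card_fun]
  push_cast
  rw [one_div, inv_pow]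
  ring

/-- The uniform probability weight. -/
noncomputable def unifW (A : Type*) [Fintype A] (_ : A) : ℝ := 1 / Fintype.card A

/-- The weight on `Bool` giving `false` mass `θ` and `true` mass `1 - θ`. -/
def bern (θ : ℝ) (b : Bool) : ℝ := if b then 1 - θ else θ

theorem optLaw_nonneg {θ : ℝ} (hθ : 0 ≤ θ) {m : A → ℝ} (h : ∀ a, θ / Fintype.card A ≤ m a)
    (o : Option A) : 0 ≤ optLaw θ m o := by
  cases o with
  | none => exact hθ
  | some a => exact sub_nonneg.2 (h a)

theorem sum_optLaw [Nonempty A] (θ : ℝ) {m : A → ℝ} (hm : ∑ a, m a = 1) :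
    ∑ o, optLaw θ m o = 1 := by
  rw [Fintype.sum_option]
  simp only [optLaw, Option.elim, sum_sub_distrib, hm, sum_const, card_univ, nsmul_eq_mul]
  field_simp
  ring

/-- A uniform random restriction, sampled by first choosing the set of fixed coordinates. -/
theorem wsum_optLaw_unifW [Nonempty A] (θ : ℝ) (G : (ι → Option A) → ℝ) :
    wsum (fun _ : ι => optLaw θ (unifW A)) G
      = wsum (fun _ : ι => bern θ)
        fun R => 𝔼 z : ι → A, G fun i => if R i then some (z i) else none := by
  simp only [expect_eq_wsum]
  rw [wsum_wsum, wsum_push (fun (_ : ι) (p : Bool × A) => if p.1 then some p.2 else none)]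
  congr 1
  funext i o
  cases o with
  | none =>
    simp [pushW, optLaw, bern, Fintype.sum_prod_type]
    field_simp
  | some a =>
    simp [pushW, optLaw, bern, Fintype.sum_prod_type, unifW]
    ring

theorem fill_fill (c c' : ι → Option A) (t : ι → A) :
    fill c (fill c' t) = fill (fun i => (c i).or (c' i)) t := by
  funext i
  cases h : c i <;> simp [fill, h]

theorem fill_ite (R : ι → Bool) (z t : ι → A) :
    fill (fun i => if R i then some (z i) else none) t = mix R z t := by
  funext i
  by_cases h : R i <;> simp [fill, mix, h]

/-- The second restriction acts only on coordinates left free by the first and fills them uniformly,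
so the free masses multiply while the completed law stays `m`. -/
theorem wsum_optLaw_comp [Nonempty A] (β θ : ℝ) (m : A → ℝ) (G : (ι → Option A) → ℝ) :
    wsum (fun _ : ι => optLaw β m) (fun c => wsum (fun _ : ι => optLaw θ (unifW A))
      fun c' => G fun i => (c i).or (c' i)) = wsum (fun _ : ι => optLaw (β * θ) m) G := by
  rw [wsum_wsum]
  rw [wsum_push (fun (_ : ι) (p : Option A × Option A) => p.1.or p.2)]
  congr 1
  funext i o
  cases o with
  | none =>
    simp [pushW, optLaw, Fintype.sum_prod_type]
  | some a =>
    have h : ∀ a' : A, (∑ o, if (some a').or o = some a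
        then optLaw β m (some a') * optLaw θ (unifW A) o else 0)
        = if a' = a then optLaw β m (some a') else 0 := by
      intro a'
      have h1 : ∑ o, optLaw θ (unifW A) o = 1 := sum_optLaw θ (by simp [unifW])
      by_cases h : a' = a
      · simp [h, ← mul_sum, h1]
      · simp [h]
    simp only [pushW, Fintype.sum_prod_type]
    rw [Fintype.sum_option]
    simp only [h]
    simp [optLaw, unifW]
    ring

theorem wsum_half (G : (ι → Bool) → ℝ) : wsum (fun _ : ι => bern (1 / 2)) G = 𝔼 R, G R := by
  rw [expect_eq_wsum]
  congr 1
  funext i b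
  cases b <;> norm_num [bern]

theorem wsum_iterCorr [Nonempty A] (f : (ι → A) → ℂ) (m : A → ℝ) (j : ℕ) (β : ℝ) :
    wsum (fun _ : ι => optLaw β m) (fun c => iterCorr j fun t => f (fill c t))
      = wsum (fun _ : ι => optLaw (β * (1 / 2) ^ j) m) fun c => prodSq fun t => f (fill c t) := by
  induction j generalizing β with
  | zero => simp [iterCorr]
  | succ j ih =>
    rw [pow_succ', ← mul_assoc, ← ih, ← wsum_optLaw_comp]
    congr 1
    funext c
    rw [wsum_optLaw_unifW, wsum_half]
    simp only [← fill_fill, fill_ite]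
    rfl

end Compose

/-! ### From square-integrable to bounded product functions -/

section Bounded
variable {ι A : Type*} [Fintype ι] [DecidableEq ι] [Fintype A] [DecidableEq A] [Nonempty A]

theorem prod_sub_prod_le {J : Type*} (s : Finset J) {x y : J → ℝ} (hy : ∀ i, 0 ≤ y i)
    (hyx : ∀ i, y i ≤ x i) (hx : ∀ i, x i ≤ 1) :
    ∏ i ∈ s, x i - ∏ i ∈ s, y i ≤ ∑ i ∈ s, (x i - y i) := by
  classical
  induction s using Finset.induction_on with
  | empty => simp
  | insert i s hi ih =>
    rw [prod_insert hi, prod_insert hi, sum_insert hi]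
    have h1 : ∏ i ∈ s, x i ≤ 1 := prod_le_one (fun i _ => (hy i).trans (hyx i)) fun i _ => hx i
    have h2 : ∏ i ∈ s, y i ≤ ∏ i ∈ s, x i := prod_le_prod (fun i _ => hy i) fun i _ => hyx i
    have h3 := hy i
    have h4 := hyx i
    have h5 := hx i
    nlinarith

/-- The phase of a complex-valued function. -/
noncomputable def phase (φ : A → ℂ) (a : A) : ℂ := φ a / ‖φ a‖

theorem phase_mul_norm (φ : A → ℂ) (a : A) : phase φ a * ‖φ a‖ = φ a := by
  unfold phase
  by_cases h : φ a = 0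
  · simp [h]
  · have : (‖φ a‖ : ℂ) ≠ 0 := by simpa using h
    field_simp

theorem norm_phase_le (φ : A → ℂ) (a : A) : ‖phase φ a‖ ≤ 1 := by
  unfold phase
  rw [norm_div, Complex.norm_real, norm_norm]
  exact div_self_le_one _

/-- The mean of the absolute value. -/
noncomputable def absMean (φ : A → ℂ) : ℝ := 𝔼 a, ‖φ a‖

theorem absMean_nonneg (φ : A → ℂ) : 0 ≤ absMean φ := expect_nonneg' fun _ => norm_nonneg _

theorem absMean_sq_le (φ : A → ℂ) : absMean φ ^ 2 ≤ nsq φ := by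
  have h := norm_sq_expect_le fun a => (‖φ a‖ : ℂ)
  rw [← ofReal_expect, Complex.norm_real, Real.norm_eq_abs, sq_abs] at h
  simpa [absMean, nsq] using h

/-- On the free coordinates `‖φ i‖` is replaced by its mean, leaving just a phase; on the fixed ones
`φ i` becomes a weight in `z` of mean square at most `1`, removed by Cauchy–Schwarz. The replacement
error is a sum of variances. -/
theorem norm_sq_expect_prod_le_restrict (R : ι → Bool) {g : (ι → A) → ℂ} (hg : ∀ x, ‖g x‖ ≤ 1)
    {φ : ι → A → ℂ} (hφ : ∀ i, nsq (φ i) ≤ 1) :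
    ‖𝔼 x, g x * ∏ i, φ i (x i)‖ ^ 2 ≤
      2 * 𝔼 z : ι → A, ‖𝔼 t : ι → A, g (mix R z t)
          * ∏ i, (if R i then fun _ => 1 else phase (φ i)) (t i)‖ ^ 2
        + 2 * ∑ i, if R i then 0 else 1 - absMean (φ i) ^ 2 := by
  set e : ι → ℝ := fun i => absMean (φ i) with he
  set u : ι → A → ℝ := fun i a => if R i then ‖φ i a‖ else e i with hu
  set a : (ι → A) → ℝ := fun x => ∏ i, ‖φ i (x i)‖ with ha
  set b : (ι → A) → ℝ := fun x => ∏ i, u i (x i) with hb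
  set p : (ι → A) → ℂ := fun x => ∏ i, phase (φ i) (x i) with hp
  have he0 : ∀ i, 0 ≤ e i := fun i => absMean_nonneg _
  have hen : ∀ i, e i ^ 2 ≤ nsq (φ i) := fun i => absMean_sq_le _
  have hp1 : ∀ x, ‖p x‖ ≤ 1 := fun x => by
    rw [hp, norm_prod]
    exact prod_le_one (fun i _ => norm_nonneg _) fun i _ => norm_phase_le _ _
  have h1 : 𝔼 x, g x * ∏ i, φ i (x i)
      = 𝔼 x, g x * p x * ((a x - b x : ℝ) : ℂ) + 𝔼 x, g x * p x * (b x : ℂ) := by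
    rw [← expect_add_distrib]
    refine expect_congr rfl fun x _ => ?_
    have : ∏ i, φ i (x i) = p x * (a x : ℂ) := by
      simp only [hp, ha]
      push_cast
      rw [← prod_mul_distrib]
      exact prod_congr rfl fun i _ => (phase_mul_norm _ _).symm
    rw [this]
    push_cast
    ring
  have h2 : ‖𝔼 x, g x * p x * ((a x - b x : ℝ) : ℂ)‖ ^ 2
      ≤ ∑ i, if R i then 0 else 1 - e i ^ 2 := by
    set y : ι → ℝ := fun i => if R i then nsq (φ i) else e i ^ 2 with hy
    have ea : 𝔼 x, a x ^ 2 = ∏ i, nsq (φ i) := by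
      simp only [ha, ← prod_pow]
      exact expect_prod_pi fun i a => ‖φ i a‖ ^ 2
    have eb : 𝔼 x, b x ^ 2 = ∏ i, y i := by
      simp only [hb, ← prod_pow]
      rw [expect_prod_pi fun i a => u i a ^ 2]
      refine prod_congr rfl fun i _ => ?_
      simp only [hu, hy]
      split_ifs
      · rfl
      · simp
    -- `b` is the conditional expectation of `a` given the coordinates in `R`, so `𝔼 (a - b)² = 𝔼 a²
    -- - 𝔼 b²`.
    have eab : 𝔼 x, a x * b x = ∏ i, y i := by
      simp only [ha, hb, ← prod_mul_distrib]
      rw [expect_prod_pi fun i a => ‖φ i a‖ * u i a]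
      refine prod_congr rfl fun i _ => ?_
      simp only [hu, hy]
      split_ifs
      · simp only [← sq]
        rfl
      · rw [← expect_mul, sq]
        rfl
    calc _ ≤ 𝔼 x, ‖g x * p x * ((a x - b x : ℝ) : ℂ)‖ ^ 2 := norm_sq_expect_le _
      _ ≤ 𝔼 x, (a x ^ 2 - 2 * (a x * b x) + b x ^ 2) := by
          refine expect_mono fun x => ?_
          have : ‖g x * p x‖ ≤ 1 := by
            rw [norm_mul]
            exact mul_le_one₀ (hg x) (norm_nonneg _) (hp1 x)
          rw [norm_mul, Complex.norm_real, mul_pow, Real.norm_eq_abs, sq_abs]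
          calc _ ≤ 1 * (a x - b x) ^ 2 := by
                gcongr
                exact pow_le_one₀ (norm_nonneg _) this
            _ = _ := by ring
      _ = ∏ i, nsq (φ i) - ∏ i, y i := by
          rw [expect_add_distrib, expect_sub_distrib, ← mul_expect, ea, eb, eab]
          ring
      _ ≤ ∑ i, (nsq (φ i) - y i) := by
          refine prod_sub_prod_le _ (fun i => ?_) (fun i => ?_) hφ
          · simp only [hy]
            split_ifs
            exacts [nsq_nonneg _, sq_nonneg _]
          · simp only [hy]
            split_ifs
            exacts [le_rfl, hen i]
      _ ≤ _ := by
          refine sum_le_sum fun i _ => ?_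
          simp only [hy]
          split_ifs
          · simp
          · linarith [hφ i]
  have h3 : ‖𝔼 x, g x * p x * (b x : ℂ)‖ ^ 2
      ≤ 𝔼 z : ι → A, ‖𝔼 t : ι → A, g (mix R z t)
          * ∏ i, (if R i then fun _ => 1 else phase (φ i)) (t i)‖ ^ 2 := by
    set d : ι → A → ℂ := fun i a => if R i then φ i a else (e i : ℂ) with hd
    have e1 : 𝔼 x, g x * p x * (b x : ℂ) = 𝔼 z : ι → A, (∏ i, d i (z i)) * 𝔼 t : ι → A,
        g (mix R z t) * ∏ i, (if R i then fun _ => 1 else phase (φ i)) (t i) := by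
      rw [← expect_mix R]
      refine expect_congr rfl fun z _ => ?_
      rw [mul_expect]
      refine expect_congr rfl fun t _ => ?_
      have : p (mix R z t) * (b (mix R z t) : ℂ)
          = (∏ i, d i (z i)) * ∏ i, (if R i then fun _ => 1 else phase (φ i)) (t i) := by
        simp only [hp, hb]
        push_cast
        rw [← prod_mul_distrib, ← prod_mul_distrib]
        refine prod_congr rfl fun i _ => ?_
        by_cases h : R i
        · simp [mix, hu, hd, h, phase_mul_norm]
        · simp [mix, hu, hd, h, mul_comm]
      rw [mul_assoc, this]
      ring
    rw [e1]
    refine (norm_sq_expect_mul_le _ _).trans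
      (mul_le_of_le_one_left (expect_nonneg' fun _ => by positivity) ?_)
    change nsq (fun z : ι → A => ∏ i, d i (z i)) ≤ 1
    rw [nsq_prod]
    refine prod_le_one (fun i _ => nsq_nonneg _) fun i _ => ?_
    by_cases h : R i
    · simpa [hd, h] using hφ i
    · have := (hen i).trans (hφ i)
      simpa [hd, h, nsq] using this
  rw [h1]
  have h4 := norm_add_le (𝔼 x, g x * p x * ((a x - b x : ℝ) : ℂ)) (𝔼 x, g x * p x * (b x : ℂ))
  have h5 := pow_le_pow_left₀ (norm_nonneg _) h4 2
  nlinarith [sq_nonneg (‖𝔼 x, g x * p x * ((a x - b x : ℝ) : ℂ)‖ - ‖𝔼 x, g x * p x * (b x : ℂ)‖)]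

/-- Since `g` is bounded, the correlation is at most the product of the means of `‖φ i‖`; taking
logarithms turns this into a bound on the sum of the deficits. -/
theorem sum_one_sub_absMean_sq_le {g : (ι → A) → ℂ} (hg : ∀ x, ‖g x‖ ≤ 1) {φ : ι → A → ℂ}
    (hw : 0 < ‖𝔼 x, g x * ∏ i, φ i (x i)‖ ^ 2) :
    ∑ i, (1 - absMean (φ i) ^ 2) ≤ 1 / ‖𝔼 x, g x * ∏ i, φ i (x i)‖ ^ 2 := by
  have h1 : ‖𝔼 x, g x * ∏ i, φ i (x i)‖ ≤ ∏ i, absMean (φ i) := by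
    unfold absMean
    rw [← expect_prod_pi fun i a => ‖φ i a‖]
    refine (RCLike.norm_expect_le (K := ℂ)).trans (expect_mono fun x => ?_)
    rw [norm_mul, norm_prod]
    exact mul_le_of_le_one_left (prod_nonneg fun i _ => norm_nonneg _) (hg x)
  have h2 : ‖𝔼 x, g x * ∏ i, φ i (x i)‖ ^ 2 ≤ ∏ i, absMean (φ i) ^ 2 := by
    rw [prod_pow]
    exact pow_le_pow_left₀ (norm_nonneg _) h1 2
  have h3 : ∀ i, 0 < absMean (φ i) ^ 2 := by
    intro i
    refine lt_of_le_of_ne (sq_nonneg _) fun h => ?_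
    have : ∏ i, absMean (φ i) ^ 2 = 0 := prod_eq_zero (mem_univ i) h.symm
    linarith
  set w := ‖𝔼 x, g x * ∏ i, φ i (x i)‖ ^ 2
  calc ∑ i, (1 - absMean (φ i) ^ 2) ≤ ∑ i, -Real.log (absMean (φ i) ^ 2) :=
        sum_le_sum fun i _ => by linarith [Real.log_le_sub_one_of_pos (h3 i)]
    _ = -Real.log (∏ i, absMean (φ i) ^ 2) := by
        rw [Real.log_prod fun i _ => (h3 i).ne', sum_neg_distrib]
    _ ≤ -Real.log w := neg_le_neg (Real.log_le_log hw h2)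
    _ = Real.log (1 / w) := by rw [one_div, Real.log_inv]
    _ ≤ 1 / w - 1 := Real.log_le_sub_one_of_pos (by positivity)
    _ ≤ 1 / w := by linarith

theorem wsum_coord {W : Type*} [Fintype W] [DecidableEq W] {m : W → ℝ} (hm : ∑ w, m w = 1)
    (i : ι) (H : W → ℝ) : wsum (fun _ : ι => m) (fun w => H (w i)) = ∑ w, m w * H w := by
  have h := prod_univ_sum (fun _ : ι => (univ : Finset W))
    fun (j : ι) (w : W) => m w * if j = i then H w else 1
  have h1 : ∀ w : ι → W, (∏ j, m (w j) * if j = i then H (w j) else 1)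
      = (∏ j, m (w j)) * H (w i) := by
    intro w
    rw [prod_mul_distrib]
    simp
  simp only [Fintype.piFinset_univ, h1] at h
  rw [wsum, ← h, prod_eq_single i]
  · simp
  · intro j _ hj
    simp [hj, hm]
  · simp

theorem wsum_sum {J W : Type*} [Fintype J] [Fintype W] (m : ι → W → ℝ) (G : J → (ι → W) → ℝ) :
    wsum m (fun w => ∑ j, G j w) = ∑ j, wsum m (G j) := by
  unfold wsum
  rw [sum_comm]
  simp only [mul_sum]

theorem wsum_add {W : Type*} [Fintype W] (m : ι → W → ℝ) (G G' : (ι → W) → ℝ) :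
    wsum m (fun w => G w + G' w) = wsum m G + wsum m G' := by
  unfold wsum
  rw [← sum_add_distrib]
  simp only [mul_add]

theorem wsum_const_mul {W : Type*} [Fintype W] (m : ι → W → ℝ) (c : ℝ) (G : (ι → W) → ℝ) :
    wsum m (fun w => c * G w) = c * wsum m G := by
  unfold wsum
  rw [mul_sum]
  exact sum_congr rfl fun w _ => by ring

theorem wsum_const {W : Type*} [Fintype W] [DecidableEq W] {m : ι → W → ℝ}
    (hm : ∀ i, ∑ w, m i w = 1) (c : ℝ) : wsum m (fun _ => c) = c := by
  rw [wsum, ← sum_mul, sum_prod_weights hm, one_mul]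

/-- Correlation at least `δ` with a bounded product function. -/
def BddCorr (δ : ℝ) (g : (ι → A) → ℂ) : Prop :=
  ∃ P : ι → A → ℂ, (∀ i a, ‖P i a‖ ≤ 1) ∧ δ ≤ ‖𝔼 x, g x * ∏ i, P i (x i)‖

open Classical in
/-- The indicator of `BddCorr δ`. -/
noncomputable def bddInd (δ : ℝ) (g : (ι → A) → ℂ) : ℝ := if BddCorr δ g then 1 else 0

theorem norm_sq_expect_le_bddInd {δ : ℝ} (hδ : 0 ≤ δ) {g : (ι → A) → ℂ} (hg : ∀ x, ‖g x‖ ≤ 1)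
    {P : ι → A → ℂ} (hP : ∀ i a, ‖P i a‖ ≤ 1) :
    ‖𝔼 x, g x * ∏ i, P i (x i)‖ ^ 2 ≤ bddInd δ g + δ := by
  have h1 : ‖𝔼 x, g x * ∏ i, P i (x i)‖ ≤ 1 := by
    refine norm_expect_le_one fun x => ?_
    rw [norm_mul, norm_prod]
    exact mul_le_one₀ (hg x) (by positivity)
      (prod_le_one (fun i _ => norm_nonneg _) fun i _ => hP _ _)
  unfold bddInd
  split_ifs with h
  · have := pow_le_one₀ (n := 2) (norm_nonneg _) h1
    linarith
  · have h2 : ‖𝔼 x, g x * ∏ i, P i (x i)‖ < δ := by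
      by_contra h3
      exact h ⟨P, hP, not_lt.1 h3⟩
    nlinarith [norm_nonneg (𝔼 x, g x * ∏ i, P i (x i))]

/-- A squared correlation `w ≤ c` is absorbed by the term `c`. If `w > c`, the total deficit is at
most `1 / c`, and each coordinate is free with probability `θ`, so the expected replacement error is
at most `2 * θ / c`. -/
theorem prodSq_le_wsum {g : (ι → A) → ℂ} (hg : ∀ x, ‖g x‖ ≤ 1) {θ δ c : ℝ} (hθ0 : 0 ≤ θ)
    (hθ1 : θ ≤ 1) (hδ : 0 ≤ δ) (hc : 0 < c) :
    prodSq g ≤ 2 * wsum (fun _ : ι => optLaw θ (unifW A))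
        (fun o => bddInd δ (fun t => g (fill o t)) + δ) + (c + 2 * θ / c) := by
  have hb0 : ∀ b, 0 ≤ bern θ b := by
    intro b
    cases b
    · simpa [bern] using hθ0
    · simpa [bern] using hθ1
  have hb1 : ∑ b, bern θ b = 1 := by simp [bern]
  have hX : 0 ≤ wsum (fun _ : ι => optLaw θ (unifW A))
        (fun o => bddInd δ (fun t => g (fill o t)) + δ) := by
    refine sum_nonneg fun o _ => mul_nonneg (prod_nonneg fun i _ => optLaw_nonneg hθ0 ?_ _) ?_
    · intro a
      unfold unifW
      gcongr
    · dsimp only [bddInd]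
      split_ifs <;> linarith
  refine ciSup_le fun ⟨φ, hφ⟩ => ?_
  change ‖𝔼 x, g x * ∏ i, φ i (x i)‖ ^ 2 ≤ _
  set w := ‖𝔼 x, g x * ∏ i, φ i (x i)‖ ^ 2 with hw
  rcases le_or_gt w c with h | h
  · have : 0 ≤ 2 * θ / c := by positivity
    linarith
  have hwpos : 0 < w := hc.trans h
  have key : ∀ R : ι → Bool, w ≤ 2 * (𝔼 z : ι → A,
      (bddInd δ (fun t => g (fill (fun i => if R i then some (z i) else none) t)) + δ))
      + 2 * ∑ i, if R i then 0 else 1 - absMean (φ i) ^ 2 := by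
    intro R
    refine (norm_sq_expect_prod_le_restrict R hg hφ).trans ?_
    gcongr with z
    simp only [fill_ite]
    refine norm_sq_expect_le_bddInd hδ (fun t => hg _) fun i a => ?_
    split_ifs
    · simp
    · exact norm_phase_le _ _
  have h2 := wsum_mono (fun _ => hb0) key
  rw [wsum_const fun _ => hb1, wsum_add, wsum_const_mul, wsum_const_mul, ← wsum_optLaw_unifW θ
    fun o => bddInd δ (fun t => g (fill o t)) + δ, wsum_sum] at h2
  have h3 : ∑ i, wsum (fun _ : ι => bern θ) (fun R => if R i then 0 else 1 - absMean (φ i) ^ 2)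
      = θ * ∑ i, (1 - absMean (φ i) ^ 2) := by
    rw [mul_sum]
    refine sum_congr rfl fun i _ => ?_
    rw [wsum_coord hb1 i fun b => if b then 0 else 1 - absMean (φ i) ^ 2]
    simp [bern]
  rw [h3] at h2
  have h4 := sum_one_sub_absMean_sq_le hg hwpos
  have h5 : θ * ∑ i, (1 - absMean (φ i) ^ 2) ≤ θ * (1 / c) := by
    refine mul_le_mul_of_nonneg_left (h4.trans ?_) hθ0
    exact one_div_le_one_div_of_le hc h.le
  have h6 : 2 * θ / c = 2 * (θ * (1 / c)) := by ring
  linarith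

end Bounded

/-! ### Correlation with bounded products after a random restriction -/

/-- The decrement of the density in one restriction step. -/
noncomputable def decrement (η : ℝ) : ℝ := (η / 4) ^ 5 / 10 ^ 10

/-- The number of restriction steps. -/
noncomputable def numSteps (η : ℝ) : ℕ := ⌊(1 - 1 / 1000 - η / 4) / decrement η⌋₊

/-- The average correlation obtained after all restriction steps. -/
noncomputable def corrGain (η : ℝ) : ℝ := (η / 16) ^ numSteps η * (η / 4)

/-- The fraction of unset coordinates after all restriction steps. -/
noncomputable def aliveRate (η : ℝ) : ℝ := (1 / 2) ^ numSteps η * (corrGain η ^ 2 / 32)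

/-! ### Quantitative bounds for the parameters. -/

section Parameters
variable {η : ℝ}

theorem decrement_pos (hη : 0 < η) : 0 < decrement η := by
  unfold decrement
  positivity

theorem numSteps_mul_le (hη : 0 < η) (hη1 : η ≤ 1) :
    numSteps η * decrement η ≤ 1 - 1 / 1000 - η / 4 := by
  have h := Nat.floor_le (a := (1 - 1 / 1000 - η / 4) / decrement η)
    (div_nonneg (by linarith) (decrement_pos hη).le)
  rwa [le_div_iff₀ (decrement_pos hη)] at h

theorem le_numSteps_mul (hη : 0 < η) (hη1 : η ≤ 1) :
    1 - 1 / 1000 - η / 2 ≤ numSteps η * decrement η := by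
  have h := Nat.lt_floor_add_one ((1 - 1 / 1000 - η / 4) / decrement η)
  rw [div_lt_iff₀ (decrement_pos hη)] at h
  have h2 : decrement η ≤ η / 4 := by
    unfold decrement
    have : (η / 4) ^ 5 ≤ η / 4 := by
      calc (η / 4) ^ 5 ≤ (η / 4) ^ 1 :=
            pow_le_pow_of_le_one (by linarith) (by linarith) (by norm_num)
        _ = η / 4 := pow_one _
    refine (div_le_self (by positivity) (by norm_num)).trans this
  change _ < ((numSteps η : ℝ) + 1) * _ at h
  linarith

theorem corrGain_pos (hη : 0 < η) : 0 < corrGain η := by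
  unfold corrGain
  positivity

theorem corrGain_le_one (hη : 0 < η) (hη1 : η ≤ 1) : corrGain η ≤ 1 := by
  unfold corrGain
  exact mul_le_one₀ (pow_le_one₀ (by linarith) (by linarith)) (by linarith) (by linarith)

theorem aliveRate_pos (hη : 0 < η) : 0 < aliveRate η := by
  have := corrGain_pos hη
  unfold aliveRate
  positivity

theorem aliveRate_le (hη : 0 < η) (hη1 : η ≤ 1) : aliveRate η ≤ corrGain η / 32 := by
  have h1 := corrGain_pos hη
  have h2 := corrGain_le_one hη hη1
  have h3 : (1 / 2 : ℝ) ^ numSteps η ≤ 1 := pow_le_one₀ (by norm_num) (by norm_num)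
  unfold aliveRate
  calc _ ≤ 1 * (corrGain η ^ 2 / 32) := by gcongr
    _ ≤ _ := by nlinarith

/-- There are `O(η⁻⁵)` steps. Each costs a constant multiple of `η`, bounded below through `exp
(-1/x) ≤ x`, which accounts for the sixth power. -/
theorem exp_neg_le_aliveRate (hη : 0 < η) (hη1 : η ≤ 1) :
    Real.exp (-(10 ^ 20 / η ^ 6)) ≤ aliveRate η := by
  set J := numSteps η with hJ
  have hJle : (J : ℝ) ≤ 10 ^ 14 / η ^ 5 := by
    have h := numSteps_mul_le hη hη1
    rw [← le_div_iff₀ (decrement_pos hη)] at h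
    refine h.trans ?_
    have : (10 : ℝ) ^ 14 / η ^ 5 = (10 ^ 4 / 4 ^ 5) / decrement η := by
      unfold decrement
      field_simp
    rw [this]
    have hd := decrement_pos hη
    gcongr
    linarith
  have hexp : ∀ x : ℝ, 0 < x → Real.exp (-(1 / x)) ≤ x := by
    intro x hx
    rw [Real.exp_neg, inv_le_comm₀ (Real.exp_pos _) hx, inv_eq_one_div]
    linarith [Real.add_one_le_exp (1 / x)]
  have hhalf : Real.exp (-(J * 2)) ≤ (1 / 2) ^ J := by
    rw [← mul_neg, Real.exp_nat_mul]
    exact pow_le_pow_left₀ (Real.exp_pos _).le (by simpa using hexp (1 / 2) (by norm_num)) _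
  have hτ : Real.exp (-(J * (16 / η))) ≤ (η / 16) ^ J := by
    rw [← mul_neg, Real.exp_nat_mul]
    exact pow_le_pow_left₀ (Real.exp_pos _).le (by simpa using hexp (η / 16) (by positivity)) _
  have h4 : Real.exp (-(4 / η)) ≤ η / 4 := by simpa using hexp (η / 4) (by positivity)
  have h32 : Real.exp (-32) ≤ 1 / 32 := by simpa using hexp (1 / 32) (by norm_num)
  have hg : Real.exp (-(J * (16 / η)) + -(4 / η)) ≤ corrGain η := by
    rw [Real.exp_add]
    unfold corrGain
    gcongr
  have hall : Real.exp (-(J * 2) + (2 * (-(J * (16 / η)) + -(4 / η)) + -32)) ≤ aliveRate η := by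
    have e2 : Real.exp (2 * (-(J * (16 / η)) + -(4 / η)))
        = Real.exp (-(J * (16 / η)) + -(4 / η)) ^ 2 := by
      rw [← Real.exp_nat_mul]
      norm_num
    rw [Real.exp_add, Real.exp_add (2 * _), e2]
    unfold aliveRate
    have e3 : corrGain η ^ 2 / 32 = corrGain η ^ 2 * (1 / 32) := by ring
    rw [e3]
    gcongr
  refine le_trans (Real.exp_le_exp.2 ?_) hall
  have hη6 : 1 ≤ 1 / η ^ 6 := by
    rw [le_div_iff₀ (by positivity), one_mul]
    exact pow_le_one₀ hη.le hη1
  have hη5 : 1 / η ^ 5 ≤ 1 / η ^ 6 :=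
    one_div_le_one_div_of_le (by positivity) (pow_le_pow_of_le_one hη.le hη1 (by norm_num))
  have hη1' : 1 / η ≤ 1 / η ^ 6 := by
    refine one_div_le_one_div_of_le (by positivity) ?_
    calc η ^ 6 ≤ η ^ 1 := pow_le_pow_of_le_one hη.le hη1 (by norm_num)
      _ = η := pow_one _
  have hJη : J * (16 / η) ≤ 16 * 10 ^ 14 * (1 / η ^ 6) := by
    calc (J : ℝ) * (16 / η) ≤ 10 ^ 14 / η ^ 5 * (16 / η) := by gcongr
      _ = _ := by field_simp
  have e1 : (10 : ℝ) ^ 14 / η ^ 5 = 10 ^ 14 * (1 / η ^ 5) := by ring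
  have e2 : (10 : ℝ) ^ 20 / η ^ 6 = 10 ^ 20 * (1 / η ^ 6) := by ring
  have e3 : 4 / η = 4 * (1 / η) := by ring
  rw [e1] at hJle
  rw [e2, e3]
  norm_num at hη6 hη5 hη1' hJη hJle ⊢
  linarith

end Parameters

/-! ### Assembling the increment and the passage to bounded products. -/

section Conclusion
variable {ι A : Type*} [Fintype ι] [DecidableEq ι] [Fintype A] [DecidableEq A] [Nonempty A]

/-- After `J` steps the threshold in `le_iterCorr` has dropped to at most `η / 2`, so at least half
of the average box functional remains above it. -/
theorem le_wsum_bddInd {f : (ι → A) → ℂ} (hf : ∀ x, ‖f x‖ ≤ 1) {m : A → ℝ}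
    (hm : ∑ a, m a = 1) {β η : ℝ} (hβ0 : 0 ≤ β) (hβ1 : β ≤ 1) (hβm : ∀ a, β ≤ m a)
    (hη : 0 < η) (hη1 : η ≤ 1)
    (h : η ≤ wsum (fun _ : ι => optLaw β m) fun c => avgBox fun t => f (fill c t)) :
    β * aliveRate η ≤ wsum (fun _ : ι => optLaw (β * aliveRate η) m)
      fun c => bddInd (β * aliveRate η) fun t => f (fill c t) := by
  have hcard : (1 : ℝ) ≤ Fintype.card A := by exact_mod_cast Fintype.card_pos
  have hlaw : ∀ γ, 0 ≤ γ → γ ≤ β → ∀ o, 0 ≤ optLaw γ m o := by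
    intro γ h0 h1 o
    exact optLaw_nonneg h0 (fun a => (div_le_self h0 hcard).trans (h1.trans (hβm a))) o
  set J := numSteps η with hJ
  set s : ℝ := 1 - 1 / 1000 - J * decrement η with hs
  have hs1 : η / 4 ≤ s := by linarith [numSteps_mul_le hη hη1]
  have hs2 : s ≤ η / 2 := by linarith [le_numSteps_mul hη hη1]
  have hgp := corrGain_pos hη
  have hg1 := corrGain_le_one hη hη1
  have hτJ : (0 : ℝ) ≤ (η / 16) ^ J := by positivity
  have step : ∀ g : (ι → A) → ℂ, (∀ x, ‖g x‖ ≤ 1) →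
      1 / 2 * (η / 16) ^ J * avgBox g + -(1 / 2 * (η / 16) ^ J * (η / 2)) ≤ iterCorr J g := by
    intro g hg
    have h1 := le_iterCorr (ι := ι) (A := A) (η := η / 4) (κ := decrement η) (τ := η / 16)
      (by positivity) (by linarith) (by linarith) (decrement_pos hη)
      (by unfold decrement; field_simp; rfl) J hs1 g
    rw [← hs] at h1
    refine le_trans ?_ h1
    have hn1 : nsq g ≤ 1 :=
      expect_le univ_nonempty fun x _ => pow_le_one₀ (norm_nonneg _) (hg x)
    have hn0 := nsq_nonneg g
    have hb0 := avgBox_nonneg g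
    have hb : avgBox g ≤ avgBox g / nsq g := by
      rcases hn0.eq_or_lt with h0 | h0
      · have := avgBox_le g
        rw [← h0] at this ⊢
        simp only [div_zero]
        linarith
      · exact le_div_self hb0 h0 hn1
    have hsn : s * nsq g ≤ η / 2 :=
      (mul_le_of_le_one_right (by linarith) hn1).trans hs2
    have : 1 / 2 * (η / 16) ^ J * (avgBox g - η / 2)
        ≤ 1 / 2 * (η / 16) ^ J * (avgBox g / nsq g - s * nsq g) := by
      gcongr
    linarith
  have k1 : corrGain η ≤
      wsum (fun _ : ι => optLaw β m) fun c => iterCorr J fun t => f (fill c t) := by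
    refine le_trans ?_ (wsum_mono (fun _ => hlaw β hβ0 le_rfl)
      fun c => step (fun t => f (fill c t)) fun x => hf _)
    rw [wsum_add, wsum_const_mul, wsum_const fun _ => sum_optLaw β hm]
    have : 1 / 2 * (η / 16) ^ J * η ≤ 1 / 2 * (η / 16) ^ J
        * wsum (fun _ : ι => optLaw β m) fun c => avgBox fun t => f (fill c t) := by
      gcongr
    unfold corrGain
    linarith
  rw [wsum_iterCorr] at k1
  have hhalf : (1 / 2 : ℝ) ^ J ≤ 1 := pow_le_one₀ (by norm_num) (by norm_num)
  -- With `c = corrGain η / 4` the error `c + 2 * θ / c` equals `corrGain η / 2`.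
  set θ := corrGain η ^ 2 / 32 with hθ
  have hθ0 : 0 ≤ θ := by positivity
  have hθ1 : θ ≤ 1 := by
    have : corrGain η ^ 2 ≤ 1 := pow_le_one₀ hgp.le hg1
    linarith
  set δ := β * aliveRate η with hδ
  have hδ0 : 0 ≤ δ := mul_nonneg hβ0 (aliveRate_pos hη).le
  have hδg : δ ≤ corrGain η / 32 :=
    (mul_le_of_le_one_left (aliveRate_pos hη).le hβ1).trans (aliveRate_le hη hη1)
  have hδeq : β * (1 / 2) ^ J * θ = δ := by
    rw [hδ, aliveRate, mul_assoc]
  have k2 : corrGain η ≤ 2 * wsum (fun _ : ι => optLaw δ m)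
      (fun c => bddInd δ (fun t => f (fill c t)) + δ) + corrGain η / 2 := by
    refine k1.trans ((wsum_mono (fun _ => hlaw _ (by positivity)
      (mul_le_of_le_one_right hβ0 hhalf)) fun c => prodSq_le_wsum (g := fun t => f (fill c t))
        (fun x => hf _) hθ0 hθ1 hδ0 (c := corrGain η / 4) (by positivity)).trans_eq ?_)
    rw [wsum_add, wsum_const_mul, wsum_const fun _ => sum_optLaw _ hm]
    simp only [fill_fill]
    rw [wsum_optLaw_comp (ι := ι) _ θ m fun c => bddInd δ (fun t => f (fill c t)) + δ, hδeq]
    congr 1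
    rw [hθ]
    field_simp
    ring
  rw [wsum_add, wsum_const fun _ => sum_optLaw _ hm] at k2
  linarith

end Conclusion

/-! ### Translation to the restriction probability of the statement. -/

section Probability
variable {A : Type*} [Fintype A] [DecidableEq A] [Nonempty A] {n : ℕ}

/-- The partial assignment given by values on a set of coordinates. -/
def partialAssign (p : (I : Finset (Fin n)) × (I → A)) (i : Fin n) : Option A :=
  if h : i ∈ p.1 then some (p.2 ⟨i, h⟩) else none

theorem partialAssign_bijective :
    Function.Bijective (partialAssign : ((I : Finset (Fin n)) × (I → A)) → Fin n → Option A) := by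
  constructor
  · rintro ⟨I, z⟩ ⟨I', z'⟩ h
    have hI : I = I' := by
      ext i
      have := congrArg Option.isSome (congrFun h i)
      by_cases h1 : i ∈ I <;> by_cases h2 : i ∈ I' <;> simp_all [partialAssign]
    subst hI
    congr 1
    funext i
    have := congrFun h i
    simpa [partialAssign] using this
  · intro c
    refine ⟨⟨univ.filter fun i => (c i).isSome, fun i => (c i).get (mem_filter.1 i.2).2⟩, ?_⟩
    funext i
    cases h : c i <;> simp [partialAssign, h]

theorem prod_coe_mul_prod_notMem {M : Type*} [CommMonoid M] (I : Finset (Fin n)) (F : Fin n → M) :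
    (∏ i : I, F i) * ∏ i : {i // i ∉ I}, F i = ∏ i, F i := by
  rw [← Fintype.prod_subtype_mul_prod_subtype (fun i => i ∈ I) F]
  congr!

/-- The restricted function ignores the coordinates in `I`, so their factors average out to a
constant of modulus at most `1`. -/
theorem restrict_correlates {f : (Fin n → A) → ℂ} {I : Finset (Fin n)} {z : I → A} {δ : ℝ}
    (h : BddCorr δ fun t => f (fill (partialAssign ⟨I, z⟩) t)) :
    CorrelatesWithProduct (restrict f I z) δ := by
  obtain ⟨P, hP, hδ⟩ := h
  refine ⟨fun i => P i, fun i a => hP i a, hδ.trans ?_⟩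
  have e : 𝔼 x : Fin n → A, f (fill (partialAssign ⟨I, z⟩) x) * ∏ i, P i (x i)
      = (𝔼 u : {i // i ∈ I} → A, ∏ i : {i // i ∈ I}, P i (u i)) *
        𝔼 x : {i // i ∉ I} → A, restrict f I z x * ∏ i : {i // i ∉ I}, P i (x i) := by
    rw [Fintype.expect_equiv (Equiv.piEquivPiSubtypeProd (fun i => i ∈ I) fun _ => A) _
      (fun p : ({i // i ∈ I} → A) × ({i // i ∉ I} → A) =>
        (∏ i : {i // i ∈ I}, P i (p.1 i))
          * (restrict f I z p.2 * ∏ i : {i // i ∉ I}, P i (p.2 i)))]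
    · rw [expect_prod_eq, expect_mul_expect]
    · intro x
      have h1 : f (fill (partialAssign ⟨I, z⟩) x) = restrict f I z fun i => x i := by
        unfold restrict
        congr 1
        funext i
        by_cases hi : i ∈ I <;> simp [fill, partialAssign, hi]
      rw [h1, ← prod_coe_mul_prod_notMem I fun i => P i (x i)]
      simp only [Equiv.piEquivPiSubtypeProd_apply]
      ring
  rw [e, norm_mul]
  refine mul_le_of_le_one_left (norm_nonneg _) (norm_expect_le_one fun u => ?_)
  rw [norm_prod]
  exact prod_le_one (fun i _ => norm_nonneg _) fun i _ => hP _ _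

/-- Independent draws from `optLaw δ m` leave a coordinate free with mass `δ` and otherwise fix it
with weight `(1 - δ) * ν`, which is the random restriction of the statement. -/
theorem wsum_bddInd_le_restrictionProb (f : (Fin n → A) → ℂ) {m ν : A → ℝ} {δ : ℝ} (hδ : 0 ≤ δ)
    (hδ1 : δ ≤ 1) (hν0 : ∀ a, 0 ≤ ν a)
    (hν : ∀ a, m a = (1 - δ) * ν a + δ * (1 / (Fintype.card A : ℝ))) :
    wsum (fun _ : Fin n => optLaw δ m) (fun c => bddInd δ fun t => f (fill c t))
      ≤ restrictionProb (n := n) δ ν fun I z => CorrelatesWithProduct (restrict f I z) δ := by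
  unfold wsum restrictionProb
  rw [← partialAssign_bijective.sum_comp, Fintype.sum_sigma]
  refine sum_le_sum fun I _ => ?_
  rw [mul_sum]
  refine sum_le_sum fun z _ => ?_
  have hprod : ∏ i, optLaw δ m (partialAssign ⟨I, z⟩ i)
      = (1 - δ) ^ I.card * δ ^ (n - I.card) * ∏ i, ν (z i) := by
    rw [← prod_coe_mul_prod_notMem I]
    have h1 : ∀ i : {i // i ∈ I}, optLaw δ m (partialAssign ⟨I, z⟩ i) = (1 - δ) * ν (z i) := by
      rintro ⟨i, hi⟩
      simp only [partialAssign, hi, dif_pos, optLaw, Option.elim, hν]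
      ring
    have h2 : ∀ i : {i // i ∉ I}, optLaw δ m (partialAssign ⟨I, z⟩ i) = δ := by
      rintro ⟨i, hi⟩
      simp [partialAssign, hi, optLaw]
    simp only [h1, h2, prod_mul_distrib, prod_const, card_univ]
    have h3 : Fintype.card {i // i ∉ I} = n - I.card := by
      rw [Fintype.card_subtype_compl, Fintype.card_fin]
      congr 1
      exact Fintype.card_of_subtype I fun _ => Iff.rfl
    rw [h3, Fintype.card_coe]
    ring
  rw [hprod, mul_assoc ((1 - δ) ^ I.card * δ ^ (n - I.card))]
  refine mul_le_mul_of_nonneg_left ?_ (mul_nonneg (pow_nonneg (by linarith) _) (pow_nonneg hδ _))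
  have hp : 0 ≤ ∏ i, ν (z i) := prod_nonneg fun i _ => hν0 _
  dsimp only [bddInd]
  by_cases h1 : BddCorr δ fun t => f (fill (partialAssign ⟨I, z⟩) t)
  · rw [if_pos h1, if_pos (restrict_correlates h1), mul_one]
  · rw [if_neg h1, mul_zero]
    split_ifs
    exacts [hp, le_rfl]

end Probability

/-! ### Choice of the parameters -/

theorem card_mul_le_one {A : Type*} [Fintype A] {m : A → ℝ} {α : ℝ} (h : ∀ a, α ≤ m a)
    (hm : ∑ a, m a = 1) : Fintype.card A * α ≤ 1 := by
  rw [← hm]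
  calc (Fintype.card A : ℝ) * α = ∑ _a : A, α := by simp
    _ ≤ _ := sum_le_sum fun a _ => h a

/-- Subtracting a multiple of the uniform law and renormalizing. -/
theorem exists_stdSimplex_decomp {A : Type*} [Fintype A] [Nonempty A] {m : A → ℝ}
    (hm : ∑ a, m a = 1) {δ : ℝ} (hδ0 : 0 ≤ δ) (hδ1 : δ < 1) (h : ∀ a, δ ≤ m a) :
    ∃ ν ∈ stdSimplex ℝ A, ∀ a, m a = (1 - δ) * ν a + δ * (1 / (Fintype.card A : ℝ)) := by
  have hcard : (1 : ℝ) ≤ Fintype.card A := by exact_mod_cast Fintype.card_pos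
  have h1 : 0 < 1 - δ := by linarith
  refine ⟨fun a => (m a - δ / Fintype.card A) / (1 - δ), ⟨fun a => ?_, ?_⟩, fun a => ?_⟩
  · exact div_nonneg (sub_nonneg.2 ((div_le_self hδ0 hcard).trans (h a))) h1.le
  · rw [← sum_div, sum_sub_distrib, hm, sum_const, card_univ, nsmul_eq_mul,
      mul_div_cancel₀ _ (by positivity), div_self h1.ne']
  · field_simp
    ring

theorem exp_neg_mul_rpow_le {β ε : ℝ} (hβ : 0 < β) (hε : 0 < ε) (hε1 : ε ≤ 1) (M : ℕ) {K : ℝ}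
    (hK : 6 * M + |Real.log β| + 10 ^ 20 ≤ K) :
    Real.exp (-(K * ε ^ (-K))) ≤ β * aliveRate (ε ^ M) := by
  have hη : 0 < ε ^ M := by positivity
  have hη1 : ε ^ M ≤ 1 := pow_le_one₀ hε.le hε1
  have h6 : 1 ≤ 1 / (ε ^ M) ^ 6 := by
    rw [le_div_iff₀ (by positivity), one_mul]
    exact pow_le_one₀ hη.le hη1
  have h0 := abs_nonneg (Real.log β)
  have hM : (0 : ℝ) ≤ 6 * M := by positivity
  -- The summand `6 * M` in `K` serves the exponent; `|Real.log β| + 10 ^ 20` serves the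
  -- multiplicative constant.
  have hpow : 1 / (ε ^ M) ^ 6 ≤ ε ^ (-K) := by
    have e : 1 / (ε ^ M) ^ 6 = ε ^ (-(6 * M : ℝ)) := by
      rw [Real.rpow_neg hε.le, one_div, ← pow_mul, ← Real.rpow_natCast]
      push_cast
      rw [mul_comm]
    rw [e]
    exact Real.rpow_le_rpow_of_exponent_ge hε hε1 (by linarith)
  calc Real.exp (-(K * ε ^ (-K))) ≤ Real.exp (Real.log β + -(10 ^ 20 / (ε ^ M) ^ 6)) := by
        refine Real.exp_le_exp.2 ?_
        have h1 : (|Real.log β| + 10 ^ 20) * (1 / (ε ^ M) ^ 6) ≤ K * ε ^ (-K) :=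
          mul_le_mul (by linarith) hpow (by positivity) (by linarith)
        have h2 : |Real.log β| ≤ |Real.log β| * (1 / (ε ^ M) ^ 6) := le_mul_of_one_le_right h0 h6
        have h3 := neg_abs_le (Real.log β)
        have h4 : (10 : ℝ) ^ 20 / (ε ^ M) ^ 6 = 10 ^ 20 * (1 / (ε ^ M) ^ 6) := by ring
        rw [h4]
        linarith
    _ = β * Real.exp (-(10 ^ 20 / (ε ^ M) ^ 6)) := by rw [Real.exp_add, Real.exp_log hβ]
    _ ≤ _ := by
        gcongr
        exact exp_neg_le_aliveRate hη hη1

end LocalInverse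

theorem mainTheorem2 (α : ℝ) (hα : 0 < α) :
    ∃ K : ℝ, 0 < K ∧
      ∀ (A : Type*) (B : Type*) (C : Type*) [Fintype A] [Fintype B] [Fintype C]
        (μ : A × B × C → ℝ),
        μ ∈ stdSimplex ℝ (A × B × C) →
        LocalInverse.PairwiseConnected μ →
        (∀ w, μ w ≠ 0 → α ≤ μ w) →
        ∀ ε : ℝ, 0 < ε →
          ∃ δ : ℝ, 0 < δ ∧ δ < 1 ∧
            (ε ≤ 1 → Real.exp (-(K * ε ^ (-K))) ≤ δ) ∧
            ∃ ν : A → ℝ, ν ∈ stdSimplex ℝ A ∧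
              (∀ a, LocalInverse.margX μ a = (1 - δ) * ν a + δ * (1 / (Fintype.card A : ℝ))) ∧
              ∀ (n : ℕ) (f : (Fin n → A) → ℂ) (g : (Fin n → B) → ℂ) (h : (Fin n → C) → ℂ),
                (∀ x, ‖f x‖ ≤ 1) → (∀ y, ‖g y‖ ≤ 1) → (∀ z, ‖h z‖ ≤ 1) →
                ε ≤ ‖LocalInverse.corr3 μ f g h‖ →
                δ ≤ LocalInverse.restrictionProb (n := n) δ ν
                  (fun I z =>
                    LocalInverse.CorrelatesWithProduct (LocalInverse.restrict f I z) δ) := by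
  classical
  -- Every letter of `A` has marginal mass at least `α`, so `|A| ≤ 1 / α` and the number of
  -- doublings can be chosen from `α` alone.
  obtain ⟨k, hk⟩ : ∃ k : ℕ, 1 / α ≤ 2 ^ k := by
    obtain ⟨k, hk⟩ := pow_unbounded_of_one_lt (1 / α) (one_lt_two (α := ℝ))
    exact ⟨k, hk.le⟩
  set β := α ^ 2 ^ (k + 1) with hβ
  set M := 4 * 2 ^ (2 * k) * 4 with hM
  have hβ0 : 0 < β := by positivity
  refine ⟨6 * M + |Real.log β| + 10 ^ 20, by positivity, ?_⟩
  intro A B C _ _ _ μ hμ hconn hatom ε hε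
  obtain ⟨⟨a₀, b₀, c₀⟩, -, hw⟩ := Finset.exists_ne_zero_of_sum_ne_zero
    (hμ.2.trans_ne one_ne_zero)
  have : Nonempty A := ⟨a₀⟩
  have : Nonempty B := ⟨b₀⟩
  have : Nonempty C := ⟨c₀⟩
  have hm1 := LocalInverse.sum_margX hμ.2
  have hαm : ∀ a, α ≤ LocalInverse.margX μ a := LocalInverse.le_margX hμ.1 hatom hconn.1
  have hcard := LocalInverse.card_mul_le_one hαm hm1
  have hcard1 : (1 : ℝ) ≤ Fintype.card A := by exact_mod_cast Fintype.card_pos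
  have hα1 : α ≤ 1 := by nlinarith
  have hcardk : Fintype.card A ≤ 2 ^ k := by
    have : (Fintype.card A : ℝ) ≤ 2 ^ k := (by rwa [le_div_iff₀ hα] : _ ≤ 1 / α).trans hk
    exact_mod_cast this
  have hβα : β ≤ α := pow_le_of_le_one hα.le hα1 (by positivity)
  have hβm : ∀ a, β ≤ LocalInverse.margX μ a := fun a => hβα.trans (hαm a)
  have hβ1 : β ≤ 1 := hβα.trans hα1
  -- Truncation keeps `ε' ^ M ≤ 1`, as the increment requires, when `ε > 1`.
  set ε' := min ε 1 with hε'
  have hε'0 : 0 < ε' := lt_min hε one_pos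
  have hη : 0 < ε' ^ M := by positivity
  have hη1 : ε' ^ M ≤ 1 := pow_le_one₀ hε'0.le (min_le_right _ _)
  have hr0 := LocalInverse.aliveRate_pos hη
  have hr1 : LocalInverse.aliveRate (ε' ^ M) < 1 := by
    have h1 := LocalInverse.aliveRate_le hη hη1
    have h2 := LocalInverse.corrGain_le_one hη hη1
    linarith
  have hδ0 : 0 < β * LocalInverse.aliveRate (ε' ^ M) := mul_pos hβ0 hr0
  have hδ1 : β * LocalInverse.aliveRate (ε' ^ M) < 1 :=
    (mul_le_of_le_one_left hr0.le hβ1).trans_lt hr1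
  obtain ⟨ν, hν, hdec⟩ := LocalInverse.exists_stdSimplex_decomp hm1 hδ0.le hδ1
    fun a => (mul_le_of_le_one_right hβ0.le hr1.le).trans (hβm a)
  refine ⟨_, hδ0, hδ1, fun hε1 => ?_, ν, hν, hdec, ?_⟩
  · rw [hε', min_eq_left hε1]
    exact LocalInverse.exp_neg_mul_rpow_le hβ0 hε hε1 M le_rfl
  · intro n f g h hf hg hh hcorr
    exact (LocalInverse.le_wsum_bddInd hf hm1 hβ0.le hβ1 hβm hη hη1
      (LocalInverse.pow_le_wsum_avgBox hμ hconn hα hatom hcardk hf hg hh hε'0.le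
        ((min_le_left _ _).trans hcorr))).trans
      (LocalInverse.wsum_bddInd_le_restrictionProb f hδ0.le hδ1.le hν.1 hdec)
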